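/- Let $N\ge 2$, $0<\alpha<1$, $\beta>0$, and for $j=1,2$ let $\mu_j>0$, $2<p_j<2+\frac{4\alpha}{N}$, $r_j>1$, with $r_1+r_2<2+\frac{4\alpha}{N}$. All functions are complex-valued. The operator $(-\Delta)^{s}$ is the Fourier multiplier with symbol $|\xi|^{2s}$, and $H^\alpha=H^\alpha(\mathbb{R}^N)$ is the space of all $u\in L^2(\mathbb{R}^N)$ with $\|u\|_{H^\alpha}=\|(1+|\xi|^2)^{\alpha/2}\widehat u\|_{L^2}<\infty$. On $H^\alpha\times H^\alpha$ use the norm $\|(u_1,u_2)\|_\alpha=(\|u_1\|_{H^\alpha}^2+\|u_2\|_{H^\alpha}^2)^{1/2}$. Put $f_j(z)=\mu_j|z|^{p_j-2}z$ and $F(z_1,z_2)=\beta|z_1|^{r_1}|z_2|^{r_2}$, so that $\partial_1F(z_1,z_2)=\beta r_1|z_1|^{r_1-2}z_1|z_2|^{r_2}$ and $\partial_2F(z_1,z_2)=\beta r_2|z_1|^{r_1}|z_2|^{r_2-2}z_2$. Define the energy $$E(u_1,u_2)=\frac12\int_{\mathbb{R}^N}\left(|(-\Delta)^{\alpha/2}u_1|^2+|(-\Delta)^{\alpha/2}u_2|^2\right)dx-\int_{\mathbb{R}^N}\left(\frac{\mu_1}{p_1}|u_1|^{p_1}+\frac{\mu_2}{p_2}|u_2|^{p_2}+F(u_1,u_2)\right)dx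 .$$ For $\tau=(\tau_1,\tau_2)$ with $\tau_1,\tau_2>0$ let $V(\tau)$ be the set of minimizers of $E$ over all $(u_1,u_2)\in H^\alpha\times H^\alpha$ with $\|u_1\|_{L^2}=\sqrt{\tau_1}$ and $\|u_2\|_{L^2}=\sqrt{\tau_2}$. Consider the system $$i\,\partial_t\Psi_j+(-\Delta)^\alpha\Psi_j=f_j(\Psi_j)+\partial_jF(\Psi_1,\Psi_2),\qquad j=1,2,\quad x\in\mathbb{R}^N,\ t>0. \tag{1}$$ A (global) solution of (1) is a map $t\mapsto\Psi(t)=(\Psi_1(t),\Psi_2(t))\in H^\alpha\times H^\alpha$, $t\ge0$, such that for $j=1,2$ and each Schwartz function $\varphi$ the pairing $\langle\varphi,\Psi_j(t)\rangle=\int\overline{\varphi}\,\Psi_j(t)\,dx$ is continuous on $[0,\infty)$, differentiable for $t>0$, and satisfies there $$i\frac{d}{dt}\langle\varphi,\Psi_j(t)\rangle+\langle(-\Delta)^\alpha\varphi,\Psi_j(t)\rangle=\int_{\mathbb{R}^N}\overline{\varphi}\,\big(f_j(\Psi_j(t))+\partial_jF(\Psi_1(t),\Psi_2(t))\big)\,dx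 .$$ **Theorem.** For every $\tau=(\tau_1,\tau_2)$ with $\tau_1,\tau_2>0$ the set $V(\tau)$ is stable in the following sense. For every $\varepsilon>0$ there is $\delta>0$ such that, if $\Psi_0\in H^\alpha\times H^\alpha$ satisfies $$\inf_{\mathbf u\in V(\tau)}\|\Psi_0-\mathbf u\|_\alpha<\delta ,$$ then every solution $\Psi$ of (1) with $\Psi(0)=\Psi_0$ that conserves the energy and the masses, that is, $E(\Psi(t))=E(\Psi_0)$ and $\int_{\mathbb{R}^N}|\Psi_j(t)|^2dx=\int_{\mathbb{R}^N}|\Psi_j(0)|^2dx$ for all $t\ge0$ and $j=1,2$, satisfies $$\sup_{t\ge0}\ \inf_{\mathbf u\in V(\tau)}\|\Psi(t)-\mathbf u\|_\alpha<\varepsilon .$$ (The infimum over an empty set is $+\infty$. Existence of solutions is not part of the claim.) -/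

import Mathlib

open MeasureTheory Filter Topology FourierTransform
open scoped ENNReal SchwartzMap

namespace FractionalNLS

noncomputable section

/-- Euclidean space `ℝ^N`. -/
abbrev Space (N : ℕ) : Type := EuclideanSpace ℝ (Fin N)

/-- The complex Hilbert space `L²(ℝ^N)`. -/
abbrev L2 (N : ℕ) : Type := Lp (α := Space N) ℂ 2

/-- Pairs `(u₁, u₂)` of functions in `L²(ℝ^N)`. -/
abbrev L2Pair (N : ℕ) : Type := Fin 2 → L2 N

/-- The function `ξ ↦ (1 + |ξ|²)^{α/2} û(ξ)`.  Mathlib's Fourier transform has the kernel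
`exp (-2πi⟨x, ξ⟩)`, so the angular frequency is `2πξ`; with this factor the Fourier transform
is the unitary one, and `(-Δ)^1` below is the usual Laplacian. -/
def besselWeighted {N : ℕ} (α : ℝ) (u : L2 N) : Space N → ℂ :=
  fun ξ => ((1 + (2 * Real.pi * ‖ξ‖) ^ 2) ^ (α / 2) : ℝ) • (𝓕 u : L2 N) ξ

/-- Membership of `u ∈ L²(ℝ^N)` in the fractional Sobolev space `H^α(ℝ^N)`. -/
def MemH {N : ℕ} (α : ℝ) (u : L2 N) : Prop :=
  MemLp (besselWeighted α u) 2 volume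

/-- The norm of `H^α(ℝ^N)`, with value `∞` outside of `H^α(ℝ^N)`. -/
def normH {N : ℕ} (α : ℝ) (u : L2 N) : ℝ≥0∞ :=
  eLpNorm (besselWeighted α u) 2 volume

/-- The norm of `H^α(ℝ^N) × H^α(ℝ^N)`. -/
def pairNorm {N : ℕ} (α : ℝ) (u : L2Pair N) : ℝ≥0∞ :=
  (normH α (u 0) ^ 2 + normH α (u 1) ^ 2) ^ (1 / 2 : ℝ)

/-- The distance `inf_{v ∈ V} ‖u - v‖_α` (which is `∞` if `V` is empty). -/
def pairDist {N : ℕ} (α : ℝ) (u : L2Pair N) (V : Set (L2Pair N)) : ℝ≥0∞ :=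
  ⨅ v ∈ V, pairNorm α (u - v)

open Classical in
/-- The fractional Laplacian `(-Δ)^s u`, with Fourier transform `|ξ|^{2s} û(ξ)`, for every
`u ∈ L²(ℝ^N)` for which the latter function is square integrable (for `s > 0`: for
`u ∈ H^{2s}(ℝ^N)`); it is set to `0` for the other `u`. -/
def fracLaplacian {N : ℕ} (s : ℝ) (u : L2 N) : L2 N :=
  if h : MemLp (fun ξ : Space N => ((2 * Real.pi * ‖ξ‖) ^ (2 * s) : ℝ) • (𝓕 u : L2 N) ξ)
      2 volume
  then 𝓕⁻ (h.toLp _ : L2 N) else 0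

/-- The coupling function `F(z₁, z₂) = β |z₁|^{r₁} |z₂|^{r₂}`. -/
def coupling (β : ℝ) (r : Fin 2 → ℝ) (z : Fin 2 → ℂ) : ℝ :=
  β * ‖z 0‖ ^ r 0 * ‖z 1‖ ^ r 1

/-- The partial derivative `∂ⱼF(z₁, z₂) = β rⱼ |zⱼ|^{rⱼ - 2} zⱼ |zₖ|^{rₖ}`, `{j, k} = {1, 2}`, that
is, the gradient of `F` in the variable `zⱼ ∈ ℂ = ℝ²`. -/
def couplingDeriv (β : ℝ) (r : Fin 2 → ℝ) (j : Fin 2) (z : Fin 2 → ℂ) : ℂ :=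
  (β * r j * ‖z j‖ ^ (r j - 2) * ‖z (1 - j)‖ ^ r (1 - j) : ℝ) • z j

/-- The nonlinearity `f(z) = μ |z|^{p - 2} z`. -/
def powerNonlin (μ p : ℝ) (z : ℂ) : ℂ :=
  (μ * ‖z‖ ^ (p - 2) : ℝ) • z

/-- The energy `E(u₁, u₂)`. -/
def energy {N : ℕ} (α β : ℝ) (μ p r : Fin 2 → ℝ) (u : L2Pair N) : ℝ :=
  1 / 2 * (∫ x, (‖fracLaplacian (α / 2) (u 0) x‖ ^ 2 + ‖fracLaplacian (α / 2) (u 1) x‖ ^ 2))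
    - ∫ x, (μ 0 / p 0 * ‖u 0 x‖ ^ p 0 + μ 1 / p 1 * ‖u 1 x‖ ^ p 1
        + coupling β r (fun j => u j x))

/-- The constraint set `S_{τ₁} × S_{τ₂}`, where `S_ρ = {u ∈ H^α : ‖u‖_{L²} = √ρ}`. -/
def constraintSet {N : ℕ} (α : ℝ) (τ : Fin 2 → ℝ) : Set (L2Pair N) :=
  {u | ∀ j, MemH α (u j) ∧ ‖u j‖ = √(τ j)}

/-- The set `V(τ)` of the minimizers of the energy over `S_{τ₁} × S_{τ₂}`. -/
def minimizers {N : ℕ} (α β : ℝ) (μ p r : Fin 2 → ℝ) (τ : Fin 2 → ℝ) : Set (L2Pair N) :=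
  {u | u ∈ constraintSet α τ ∧ ∀ v ∈ (constraintSet α τ : Set (L2Pair N)),
    energy α β μ p r u ≤ energy α β μ p r v}

/-- The `H^α`-valued curve `t ↦ Ψ(t)`, `t ≥ 0`, is a (weak) solution of the system
`i ∂ₜΨⱼ + (-Δ)^α Ψⱼ = fⱼ(Ψⱼ) + ∂ⱼF(Ψ₁, Ψ₂)`, `j = 1, 2`: for each Schwartz function `φ` the
pairing `⟨φ, Ψⱼ(t)⟩ = ∫ conj(φ) Ψⱼ(t)` is continuous on `[0, ∞)` and, for `t > 0`, it is
differentiable and satisfies the equation tested against `φ`.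
Only the values of `Ψ` at times `t ≥ 0` matter. -/
structure IsSolution {N : ℕ} (α β : ℝ) (μ p r : Fin 2 → ℝ) (Ψ : ℝ → L2Pair N) : Prop where
  memH : ∀ t, 0 ≤ t → ∀ j, MemH α (Ψ t j)
  continuousOn : ∀ (j : Fin 2) (φ : 𝓢(Space N, ℂ)),
    ContinuousOn (fun t => inner ℂ (φ.toLp 2) (Ψ t j)) (Set.Ici 0)
  equation : ∀ (j : Fin 2) (φ : 𝓢(Space N, ℂ)) (t : ℝ), 0 < t →
    DifferentiableAt ℝ (fun s => inner ℂ (φ.toLp 2) (Ψ s j)) t ∧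
    Complex.I * deriv (fun s => inner ℂ (φ.toLp 2) (Ψ s j)) t
        + inner ℂ (fracLaplacian α (φ.toLp 2)) (Ψ t j)
      = ∫ x, (starRingEnd ℂ) (φ x) *
          (powerNonlin (μ j) (p j) (Ψ t j x) + couplingDeriv β r j (fun k => Ψ t k x))

/-- The curve `t ↦ Ψ(t)`, `t ≥ 0`, conserves the energy and both masses. -/
def ConservesEnergyAndMass {N : ℕ} (α β : ℝ) (μ p r : Fin 2 → ℝ) (Ψ : ℝ → L2Pair N) : Prop :=
  ∀ t, 0 ≤ t → energy α β μ p r (Ψ t) = energy α β μ p r (Ψ 0) ∧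
    ∀ j, ∫ x, ‖Ψ t j x‖ ^ 2 = ∫ x, ‖Ψ 0 j x‖ ^ 2

end

end FractionalNLS

/-! ### Fourier multipliers and the description of H^α by weights in L². -/

open MeasureTheory Filter Topology FourierTransform
open scoped ENNReal SchwartzMap

namespace FractionalNLS
noncomputable section
variable {N : ℕ}

/-! Energy and masses are conserved, so instability would produce pairs that stay at a fixed
distance from V(τ) while their masses tend to τ and their energies to the minimum m. It is therefore
enough that such a sequence converges in H^α × H^α, along a subsequence and after translations, to a
minimizer (`Admissible.exists_shift_tendsto`). Initial data close to V(τ) exist only if V(τ) is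
nonempty, so m is an attained value and minimizers need not be constructed beforehand.

The sequence is bounded, because for subcritical exponents the potential energy is dominated by a
small multiple of the kinetic energy plus a constant depending on the masses
(`exists_lintegral_rpow_le_kinetic`). Moreover m < 0, as widely spread Gaussians show
(`exists_energy_neg`), so the sequence does not vanish in L^q and has, after translations, a nonzero
weak limit u (`exists_shift_weakTendsto`). Energy and masses split asymptotically between u and the
remainder (`Admissible.split`). It remains to exclude a remainder that carries mass.

The main device is the superposition (|u|² + |v|²)^{1/2}, taken in each component. Masses add.
Gagliardo's formula shows that the kinetic energy is subadditive (`exists_superposition`), and the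
potential density is superadditive, strictly at points where both pairs are nonzero. Translating one
pair forces such an overlap, so two nonzero pairs can always be merged with a strict gain of energy
(`Admissible.exists_superpose_lt`).

Suppose mass is lost. If the remainder vanishes in L^q, its limiting energy is nonnegative, and
superposing u with a pair of negative energy and of the missing mass falls below m. Otherwise the
remainder contains a second nonzero profile v. Merging u with a translate of v gains a fixed amount
of energy, adding the rest by superposition costs nothing, and the resulting pairs have masses
tending to τ and limiting energy below m. Both cases are impossible
(`Admissible.remainder_eq_zero`). Two profiles suffice, and subadditivity of the minimal energy as a
function of the masses is never discussed.

Functions in H^α are represented by their weights w = (1 + |2πξ|²)^{α/2} û in L². All weak limits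
are then taken in L², and the inclusion H^α → L² and the operator (-Δ)^{α/2} become the bounded
operators `ofWeight` and `gradOfWeight`. -/

open Classical in
/-- Multiplication of `L²` functions by a bounded function. -/
def mulCLM (m : Space N → ℂ) : L2 N →L[ℂ] L2 N :=
  if hm : MemLp m ∞ volume then (ContinuousLinearMap.mul ℂ ℂ).holderL volume ∞ 2 2 (hm.toLp m)
  else 0

lemma coeFn_mulCLM {m : Space N → ℂ} (hm : MemLp m ∞ volume) (f : L2 N) :
    mulCLM m f =ᵐ[volume] fun ξ => m ξ * f ξ := by
  rw [mulCLM, dif_pos hm]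
  filter_upwards [(ContinuousLinearMap.mul ℂ ℂ).coeFn_holder (r := 2) (hm.toLp m) f,
    hm.coeFn_toLp] with ξ h1 h2
  simpa [h2] using! h1

lemma memLp_top_of_measurable_of_bound {m : Space N → ℂ} (hm : Measurable m) {C : ℝ} (hC : ∀ ξ, ‖m ξ‖ ≤ C) :
    MemLp m ∞ volume :=
  memLp_top_of_bound hm.aestronglyMeasurable C (Eventually.of_forall hC)

/-- The symbol `(1 + |2πξ|²)^{α/2}` of the Bessel potential. -/
def besselSymbol (α : ℝ) (ξ : Space N) : ℝ := (1 + (2 * Real.pi * ‖ξ‖) ^ 2) ^ (α / 2)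

/-- The symbol `|2πξ|^α` of `(-Δ)^{α/2}`. -/
def rieszSymbol (α : ℝ) (ξ : Space N) : ℝ := (2 * Real.pi * ‖ξ‖) ^ α

lemma measurable_besselSymbol (α : ℝ) : Measurable (besselSymbol (N := N) α) := by
  unfold besselSymbol; fun_prop

lemma measurable_rieszSymbol (α : ℝ) : Measurable (rieszSymbol (N := N) α) := by
  unfold rieszSymbol; fun_prop

lemma one_le_besselSymbol {α : ℝ} (hα : 0 ≤ α) (ξ : Space N) : 1 ≤ besselSymbol α ξ := by
  apply Real.one_le_rpow _ (by positivity)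
  nlinarith [sq_nonneg (2 * Real.pi * ‖ξ‖)]

lemma besselSymbol_pos (α : ℝ) (ξ : Space N) : 0 < besselSymbol α ξ := by
  unfold besselSymbol; positivity

lemma rieszSymbol_nonneg (α : ℝ) (ξ : Space N) : 0 ≤ rieszSymbol α ξ := by
  unfold rieszSymbol; positivity

lemma rieszSymbol_le_besselSymbol {α : ℝ} (hα : 0 ≤ α) (ξ : Space N) :
    rieszSymbol α ξ ≤ besselSymbol α ξ := by
  have h : rieszSymbol α ξ = ((2 * Real.pi * ‖ξ‖) ^ 2) ^ (α / 2) := by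
    rw [rieszSymbol, ← Real.rpow_natCast, ← Real.rpow_mul (by positivity)]
    congr 1; push_cast; ring
  rw [h, besselSymbol]
  exact Real.rpow_le_rpow (by positivity) (by linarith) (by positivity)

lemma memLp_besselSymbol_inv {α : ℝ} (hα : 0 ≤ α) :
    MemLp (fun ξ : Space N => (((besselSymbol α ξ)⁻¹ : ℝ) : ℂ)) ∞ volume := by
  have := measurable_besselSymbol (N := N) α
  refine memLp_top_of_measurable_of_bound (by fun_prop) (C := 1) fun ξ => ?_
  have h := one_le_besselSymbol hα ξ
  rw [Complex.norm_real, norm_inv, Real.norm_of_nonneg (by linarith)]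
  exact inv_le_one_of_one_le₀ h

lemma memLp_rieszSymbol_mul_besselSymbol_inv {α : ℝ} (hα : 0 ≤ α) :
    MemLp (fun ξ : Space N => ((rieszSymbol α ξ * (besselSymbol α ξ)⁻¹ : ℝ) : ℂ)) ∞ volume := by
  have := measurable_besselSymbol (N := N) α
  have := measurable_rieszSymbol (N := N) α
  refine memLp_top_of_measurable_of_bound (by fun_prop) (C := 1) fun ξ => ?_
  rw [Complex.norm_real, Real.norm_of_nonneg
    (mul_nonneg (rieszSymbol_nonneg α ξ) (inv_nonneg.2 (besselSymbol_pos α ξ).le)),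
    ← div_eq_mul_inv, div_le_one (besselSymbol_pos α ξ)]
  exact rieszSymbol_le_besselSymbol hα ξ

/-- The isomorphism `w ↦ 𝓕⁻ ((1 + |2πξ|²)^{-α/2} w)` of `L²` onto `H^α`. -/
def ofWeight (α : ℝ) : L2 N →L[ℂ] L2 N :=
  (fourierInvCLM ℂ (L2 N)).comp (mulCLM fun ξ => (((besselSymbol α ξ)⁻¹ : ℝ) : ℂ))

/-- The composition of `ofWeight α` with `(-Δ)^{α/2}`. -/
def gradOfWeight (α : ℝ) : L2 N →L[ℂ] L2 N :=
  (fourierInvCLM ℂ (L2 N)).comp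
    (mulCLM fun ξ => ((rieszSymbol α ξ * (besselSymbol α ξ)⁻¹ : ℝ) : ℂ))

lemma fourier_ofWeight {α : ℝ} (hα : 0 ≤ α) (w : L2 N) :
    (𝓕 (ofWeight α w) : L2 N) =ᵐ[volume] fun ξ => (((besselSymbol α ξ)⁻¹ : ℝ) : ℂ) * w ξ := by
  have : (𝓕 (ofWeight α w) : L2 N) = mulCLM (fun ξ => (((besselSymbol α ξ)⁻¹ : ℝ) : ℂ)) w := by
    simp [ofWeight]
  rw [this]
  exact coeFn_mulCLM (memLp_besselSymbol_inv hα) w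

lemma fourier_gradOfWeight {α : ℝ} (hα : 0 ≤ α) (w : L2 N) :
    (𝓕 (gradOfWeight α w) : L2 N) =ᵐ[volume]
      fun ξ => (rieszSymbol α ξ : ℂ) * (𝓕 (ofWeight α w) : L2 N) ξ := by
  have : (𝓕 (gradOfWeight α w) : L2 N)
      = mulCLM (fun ξ => ((rieszSymbol α ξ * (besselSymbol α ξ)⁻¹ : ℝ) : ℂ)) w := by
    simp [gradOfWeight]
  rw [this]
  filter_upwards [coeFn_mulCLM (memLp_rieszSymbol_mul_besselSymbol_inv hα) w,
    fourier_ofWeight hα w] with ξ h1 h2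
  rw [h1, h2]; push_cast; ring

lemma besselWeighted_ofWeight {α : ℝ} (hα : 0 ≤ α) (w : L2 N) :
    besselWeighted α (ofWeight α w) =ᵐ[volume] w := by
  filter_upwards [fourier_ofWeight hα w] with ξ h
  have h0 : ((besselSymbol α ξ : ℝ) : ℂ) ≠ 0 := by exact_mod_cast (besselSymbol_pos α ξ).ne'
  have : besselWeighted α (ofWeight α w) ξ
    = (besselSymbol α ξ : ℂ) * (𝓕 (ofWeight α w) : L2 N) ξ := by
    simp [besselWeighted, besselSymbol]
  rw [this, h]
  push_cast
  rw [← mul_assoc, mul_inv_cancel₀ h0, one_mul]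

lemma memH_ofWeight {α : ℝ} (hα : 0 ≤ α) (w : L2 N) : MemH α (ofWeight α w) :=
  (memLp_congr_ae (besselWeighted_ofWeight hα w)).2 (Lp.memLp w)

lemma normH_ofWeight {α : ℝ} (hα : 0 ≤ α) (w : L2 N) : normH α (ofWeight α w) = ‖w‖ₑ := by
  rw [normH, eLpNorm_congr_ae (besselWeighted_ofWeight hα w), Lp.enorm_def]

/-- Together with `normH_ofWeight` this identifies H^α isometrically with L², so that every
statement about H^α can be made about weights. -/
lemma MemH.exists_ofWeight_eq {α : ℝ} (hα : 0 ≤ α) {u : L2 N} (hu : MemH α u) :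
    ∃ w, ofWeight α w = u := by
  refine ⟨hu.toLp _, ?_⟩
  have : (𝓕 (ofWeight α (hu.toLp _)) : L2 N) = 𝓕 u := by
    apply Lp.ext
    filter_upwards [fourier_ofWeight hα (hu.toLp _), hu.coeFn_toLp] with ξ h1 h2
    have h0 : ((besselSymbol α ξ : ℝ) : ℂ) ≠ 0 := by exact_mod_cast (besselSymbol_pos α ξ).ne'
    have h3 : besselWeighted α u ξ = (besselSymbol α ξ : ℂ) * (𝓕 u : L2 N) ξ := by
      simp [besselWeighted, besselSymbol]
    rw [h1, h2, h3]
    push_cast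
    rw [← mul_assoc, inv_mul_cancel₀ h0, one_mul]
  exact (Lp.fourierTransformₗᵢ (Space N) ℂ).injective this

/-- On H^α the default value of `fracLaplacian` does not occur, and the kinetic energy is the
squared norm of a bounded operator applied to the weight. -/
lemma fracLaplacian_ofWeight {α : ℝ} (hα : 0 ≤ α) (w : L2 N) :
    fracLaplacian (α / 2) (ofWeight α w) = gradOfWeight α w := by
  have hae : (fun ξ : Space N => ((2 * Real.pi * ‖ξ‖) ^ (2 * (α / 2)) : ℝ) •
      (𝓕 (ofWeight α w) : L2 N) ξ) =ᵐ[volume] (𝓕 (gradOfWeight α w) : L2 N) := by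
    filter_upwards [fourier_gradOfWeight hα w] with ξ h
    rw [h, rieszSymbol]
    simp [mul_div_cancel₀]
  have hm := (memLp_congr_ae hae).2 (Lp.memLp (𝓕 (gradOfWeight α w) : L2 N))
  rw [fracLaplacian, dif_pos hm]
  have : hm.toLp _ = (𝓕 (gradOfWeight α w) : L2 N) := by
    apply Lp.ext
    exact hm.coeFn_toLp.trans hae
  rw [this, fourierInv_fourier_eq]

lemma continuous_neg_inner :
    Continuous fun p : Space N × Space N => (-innerₗ (Space N)) p.1 p.2 := by
  have : (fun p : Space N × Space N => (-innerₗ (Space N)) p.1 p.2)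
      = fun p => -inner ℝ p.1 p.2 := by ext p; simp
  rw [this]; fun_prop

/-- On `L¹ ∩ L²` the inverse Fourier transform of `L²` is given by the integral. -/
lemma coeFn_fourierInv_toLp {g : Space N → ℂ} (h1 : Integrable g) (h2 : MemLp g 2 volume) :
    (𝓕⁻ (h2.toLp g) : L2 N) =ᵐ[volume] 𝓕⁻ g := by
  have hcont : Continuous (𝓕⁻ g) :=
    VectorFourier.fourierIntegral_continuous Real.continuous_fourierChar
      (L := -innerₗ (Space N)) continuous_neg_inner h1
  -- Tested against a smooth compactly supported φ, hence a Schwartz function Φ, both sides equal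
  -- the integral of 𝓕⁻Φ · g: on the left by the definition for tempered distributions, on the right
  -- by Fubini, since g is integrable.
  apply ae_eq_of_integral_contDiff_smul_eq
    ((Lp.memLp _).locallyIntegrable (by norm_num)) hcont.locallyIntegrable
  intro φ hφ hφc
  have hc1 : HasCompactSupport (Complex.ofRealCLM ∘ φ) := hφc.comp_left rfl
  have hc2 : ContDiff ℝ ((⊤ : ℕ∞) : WithTop ℕ∞) (Complex.ofRealCLM ∘ φ) :=
    Complex.ofRealCLM.contDiff.comp hφ
  set Φ : 𝓢(Space N, ℂ) := hc1.toSchwartzMap hc2 with hΦ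
  have e1 : ∫ x, φ x • (𝓕⁻ (h2.toLp g) : L2 N) x
      = ∫ x, Φ x • (𝓕⁻ (h2.toLp g) : L2 N) x := by
    simp [hΦ]
  have e2 : ∫ x, φ x • (𝓕⁻ g) x = ∫ x, Φ x • (𝓕⁻ g) x := by
    simp [hΦ]
  rw [e1, e2, ← Lp.toTemperedDistribution_apply, ← Lp.fourierInv_toTemperedDistribution_eq,
    TemperedDistribution.fourierInv_apply, Lp.toTemperedDistribution_apply]
  have e3 : ∫ x, (𝓕⁻ Φ) x • (h2.toLp g) x = ∫ x, (𝓕⁻ Φ) x • g x := by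
    apply integral_congr_ae
    filter_upwards [h2.coeFn_toLp] with x hx
    rw [hx]
  rw [e3, SchwartzMap.fourierInv_coe]
  have := VectorFourier.integral_fourierIntegral_smul_eq_flip (L := -innerₗ (Space N))
    (μ := volume) (ν := volume) Real.continuous_fourierChar continuous_neg_inner Φ.integrable h1
  rw [show (-innerₗ (Space N)).flip = -innerₗ (Space N) by
    ext x y; simp [real_inner_comm]] at this
  exact this
end
end FractionalNLS

/-! ### Translations and modulations. -/

namespace FractionalNLS
noncomputable section
variable {N : ℕ}

/-- The character `ξ ↦ exp (2πi⟨ξ, y⟩)`. -/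
def charSymbol (y ξ : Space N) : ℂ := Complex.exp (↑(2 * Real.pi * inner ℝ ξ y) * Complex.I)

lemma continuous_charSymbol (y : Space N) : Continuous (charSymbol y) := by
  unfold charSymbol; fun_prop

lemma norm_charSymbol (y ξ : Space N) : ‖charSymbol y ξ‖ = 1 :=
  Complex.norm_exp_ofReal_mul_I _

lemma memLp_charSymbol (y : Space N) : MemLp (charSymbol y) ∞ volume :=
  memLp_top_of_measurable_of_bound (continuous_charSymbol y).measurable (C := 1)
    fun ξ => (norm_charSymbol y ξ).le

/-- The translation `u ↦ u(· + y)` of `L²`. -/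
def translate (y : Space N) : L2 N →ₗᵢ[ℂ] L2 N :=
  Lp.compMeasurePreservingₗᵢ ℂ (· + y) (measurePreserving_add_right volume y)

lemma coeFn_translate (y : Space N) (u : L2 N) :
    translate y u =ᵐ[volume] fun x => u (x + y) :=
  Lp.coeFn_compMeasurePreserving u (measurePreserving_add_right volume y)

/-- Both sides are continuous in g, so it suffices to treat Schwartz functions, for which 𝓕⁻ is an
absolutely convergent integral and the identity is read off from the exponential. -/
lemma fourierInv_mulCLM_charSymbol (y : Space N) (g : L2 N) :
    (𝓕⁻ (mulCLM (charSymbol y) g) : L2 N) = translate y (𝓕⁻ g : L2 N) := by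
  refine DenseRange.induction_on
    (p := fun g : L2 N => (𝓕⁻ (mulCLM (charSymbol y) g) : L2 N) = translate y (𝓕⁻ g : L2 N))
    (SchwartzMap.denseRange_toLpCLM (p := 2) ENNReal.ofNat_ne_top) g ?_ ?_
  · apply isClosed_eq
    · exact ((fourierInvCLM ℂ (L2 N)).comp (mulCLM (charSymbol y))).continuous
    · exact (translate y).continuous.comp (fourierInvCLM ℂ (L2 N)).continuous
  intro φ
  change (𝓕⁻ (mulCLM (charSymbol y) (φ.toLp 2)) : L2 N) = translate y (𝓕⁻ (φ.toLp 2) : L2 N)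
  have hi : Integrable (fun ξ => charSymbol y ξ * φ ξ) :=
    φ.integrable.bdd_mul (c := 1) (continuous_charSymbol y).aestronglyMeasurable
      (Eventually.of_forall fun ξ => (norm_charSymbol y ξ).le)
  have hae : mulCLM (charSymbol y) (φ.toLp 2) =ᵐ[volume] fun ξ => charSymbol y ξ * φ ξ := by
    filter_upwards [coeFn_mulCLM (memLp_charSymbol y) (φ.toLp 2), φ.coeFn_toLp 2 volume]
      with ξ h1 h2
    rw [h1, h2]
  have hm : MemLp (fun ξ => charSymbol y ξ * φ ξ) 2 volume := (memLp_congr_ae hae).1 (Lp.memLp _)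
  have he : mulCLM (charSymbol y) (φ.toLp 2) = hm.toLp _ := Lp.ext (hae.trans hm.coeFn_toLp.symm)
  rw [he, SchwartzMap.toLp_fourierInv_eq]
  apply Lp.ext
  have h3 := (measurePreserving_add_right (volume : Measure (Space N)) y).quasiMeasurePreserving.ae
    ((𝓕⁻ φ).coeFn_toLp 2 volume)
  filter_upwards [coeFn_fourierInv_toLp hi hm, coeFn_translate y ((𝓕⁻ φ).toLp 2), h3]
    with x h1 h2 h3
  rw [h1, h2, h3, SchwartzMap.fourierInv_coe, Real.fourierInv_eq', Real.fourierInv_eq']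
  congr 1
  ext ξ
  simp only [charSymbol, smul_eq_mul, ← mul_assoc, ← Complex.exp_add, inner_add_right]
  congr 2
  push_cast; ring

lemma mulCLM_comm {m m' : Space N → ℂ} (hm : MemLp m ∞ volume) (hm' : MemLp m' ∞ volume)
    (f : L2 N) : mulCLM m (mulCLM m' f) = mulCLM m' (mulCLM m f) := by
  apply Lp.ext
  filter_upwards [coeFn_mulCLM hm (mulCLM m' f), coeFn_mulCLM hm' (mulCLM m f), coeFn_mulCLM hm f,
    coeFn_mulCLM hm' f] with x h1 h2 h3 h4
  rw [h1, h2, h3, h4]; ring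

/-- Multipliers commute, so a translation in H^α is the multiplication of the weight by a unimodular
function. -/
lemma ofWeight_mulCLM_charSymbol {α : ℝ} (hα : 0 ≤ α) (y : Space N) (w : L2 N) :
    ofWeight α (mulCLM (charSymbol y) w) = translate y (ofWeight α w) := by
  simp only [ofWeight, ContinuousLinearMap.comp_apply, fourierInvCLM_apply]
  rw [mulCLM_comm (memLp_besselSymbol_inv hα) (memLp_charSymbol y), fourierInv_mulCLM_charSymbol]

lemma gradOfWeight_mulCLM_charSymbol {α : ℝ} (hα : 0 ≤ α) (y : Space N) (w : L2 N) :
    gradOfWeight α (mulCLM (charSymbol y) w) = translate y (gradOfWeight α w) := by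
  simp only [gradOfWeight, ContinuousLinearMap.comp_apply, fourierInvCLM_apply]
  rw [mulCLM_comm (memLp_rieszSymbol_mul_besselSymbol_inv hα) (memLp_charSymbol y),
    fourierInv_mulCLM_charSymbol]

lemma norm_mulCLM_charSymbol (y : Space N) (w : L2 N) : ‖mulCLM (charSymbol y) w‖ = ‖w‖ := by
  rw [Lp.norm_def, Lp.norm_def]
  congr 1
  apply eLpNorm_congr_norm_ae
  filter_upwards [coeFn_mulCLM (memLp_charSymbol y) w] with x h
  rw [h, norm_mul, norm_charSymbol, one_mul]

lemma mulCLM_charSymbol_neg (y : Space N) (w : L2 N) :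
    mulCLM (charSymbol (-y)) (mulCLM (charSymbol y) w) = w := by
  apply Lp.ext
  filter_upwards [coeFn_mulCLM (memLp_charSymbol (-y)) (mulCLM (charSymbol y) w),
    coeFn_mulCLM (memLp_charSymbol y) w] with x h1 h2
  rw [h1, h2, ← mul_assoc, charSymbol, charSymbol, ← Complex.exp_add, inner_neg_right]
  have : (↑(2 * Real.pi * -inner ℝ x y) * Complex.I + ↑(2 * Real.pi * inner ℝ x y) * Complex.I)
    = 0 := by push_cast; ring
  rw [this]; simp

/-! ### Low-frequency projections. -/

/-- The indicator function of the closed ball of radius `R`. -/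
def lowSymbol (R : ℝ) : Space N → ℂ := (Metric.closedBall 0 R).indicator 1

lemma measurable_lowSymbol (R : ℝ) : Measurable (lowSymbol (N := N) R) :=
  measurable_one.indicator Metric.isClosed_closedBall.measurableSet

lemma memLp_lowSymbol (R : ℝ) : MemLp (lowSymbol (N := N) R) ∞ volume := by
  refine memLp_top_of_measurable_of_bound (measurable_lowSymbol R) (C := 1) fun ξ => ?_
  unfold lowSymbol Set.indicator
  split_ifs <;> simp

/-- The projection of `L²` to the frequencies of modulus at most `R`. -/
def lowPass (R : ℝ) : L2 N →L[ℂ] L2 N :=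
  ((fourierInvCLM ℂ (L2 N)).comp (mulCLM (lowSymbol R))).comp (fourierCLM ℂ (L2 N))

lemma fourier_lowPass (R : ℝ) (u : L2 N) :
    (𝓕 (lowPass R u) : L2 N) =ᵐ[volume] fun ξ => lowSymbol R ξ * (𝓕 u : L2 N) ξ := by
  have : (𝓕 (lowPass R u) : L2 N) = mulCLM (lowSymbol R) (𝓕 u) := by simp [lowPass]
  rw [this]
  exact coeFn_mulCLM (memLp_lowSymbol R) _

/-- The function `ξ ↦ 1_{|ξ| ≤ R} exp (-2πi⟨ξ, x⟩)`. -/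
def lowVector (R : ℝ) (x : Space N) : L2 N :=
  mulCLM (charSymbol (-x)) (indicatorConstLp 2 (s := Metric.closedBall (0 : Space N) R)
    Metric.isClosed_closedBall.measurableSet measure_closedBall_lt_top.ne 1)

lemma coeFn_lowVector (R : ℝ) (x : Space N) :
    lowVector R x =ᵐ[volume] fun ξ => charSymbol (-x) ξ * lowSymbol R ξ := by
  filter_upwards [coeFn_mulCLM (memLp_charSymbol (-x)) (indicatorConstLp 2
    (s := Metric.closedBall (0 : Space N) R) Metric.isClosed_closedBall.measurableSet
    measure_closedBall_lt_top.ne 1), indicatorConstLp_coeFn (p := 2) (μ := (volume : Measure (Space N)))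
    (s := Metric.closedBall (0 : Space N) R) (hs := Metric.isClosed_closedBall.measurableSet)
    (hμs := measure_closedBall_lt_top.ne) (c := (1 : ℂ))] with ξ h1 h2
  rw [lowVector, h1, h2]
  rfl

lemma norm_lowVector_le {R : ℝ} (hR : 0 ≤ R) (x : Space N) :
    ‖lowVector R x‖ ≤ √(volume.real (Metric.closedBall (0 : Space N) 1)) * R ^ ((N : ℝ) / 2) := by
  rw [lowVector, norm_mulCLM_charSymbol]
  refine norm_indicatorConstLp_le.trans (le_of_eq ?_)
  have : volume.real (Metric.closedBall (0 : Space N) R)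
      = R ^ N * volume.real (Metric.closedBall (0 : Space N) 1) := by
    rw [measureReal_def, Measure.addHaar_closedBall' _ _ hR, ENNReal.toReal_mul,
      ENNReal.toReal_ofReal (by positivity), finrank_euclideanSpace_fin]
    rfl
  rw [this, norm_one, one_mul]
  norm_num
  rw [← Real.sqrt_eq_rpow, Real.sqrt_mul (by positivity), mul_comm]
  congr 1
  rw [Real.sqrt_eq_rpow, ← Real.rpow_natCast, ← Real.rpow_mul hR]
  congr 1; ring

/-- The value of the low-frequency part at x is a pairing with a fixed L² vector. This turns weak
convergence into pointwise convergence, and a pointwise lower bound into a nonzero weak limit. -/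
lemma coeFn_lowPass (R : ℝ) (u : L2 N) :
    lowPass R u =ᵐ[volume] fun x => inner ℂ (lowVector R x) (𝓕 u : L2 N) := by
  have h2 : MemLp (fun ξ => lowSymbol R ξ * (𝓕 u : L2 N) ξ) 2 volume :=
    (memLp_congr_ae (coeFn_mulCLM (memLp_lowSymbol R) (𝓕 u : L2 N))).1 (Lp.memLp _)
  have h1 : Integrable (fun ξ => lowSymbol R ξ * (𝓕 u : L2 N) ξ) := by
    have hl : MemLp (lowSymbol (N := N) R) 2 volume :=
      memLp_indicator_const 2 Metric.isClosed_closedBall.measurableSet (1 : ℂ)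
        (Or.inr measure_closedBall_lt_top.ne)
    exact hl.integrable_mul (Lp.memLp (𝓕 u : L2 N))
  have he : lowPass R u = 𝓕⁻ (h2.toLp _ : L2 N) := by
    have : mulCLM (lowSymbol R) (𝓕 u : L2 N) = h2.toLp _ :=
      Lp.ext ((coeFn_mulCLM (memLp_lowSymbol R) _).trans h2.coeFn_toLp.symm)
    rw [← this]; rfl
  rw [he]
  filter_upwards [coeFn_fourierInv_toLp h1 h2] with x hx
  rw [hx, Real.fourierInv_eq', L2.inner_def]
  apply integral_congr_ae
  filter_upwards [coeFn_lowVector R x] with ξ hξ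
  rw [hξ]
  have hc : (starRingEnd ℂ) (charSymbol (-x) ξ)
      = Complex.exp (↑(2 * Real.pi * inner ℝ ξ x) * Complex.I) := by
    rw [charSymbol, ← Complex.exp_conj, map_mul, Complex.conj_ofReal, Complex.conj_I,
      inner_neg_right]
    congr 1; push_cast; ring
  have hl : (starRingEnd ℂ) (lowSymbol R ξ) = lowSymbol R ξ := by
    unfold lowSymbol Set.indicator; split_ifs <;> simp
  simp only [RCLike.inner_apply, map_mul, hc, hl, smul_eq_mul]
  ring

lemma enorm_sq_eq_lintegral (f : L2 N) : ‖f‖ₑ ^ 2 = ∫⁻ x, ‖f x‖ₑ ^ 2 := by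
  rw [Lp.enorm_def, eLpNorm_eq_lintegral_rpow_enorm_toReal (by norm_num) (by norm_num)]
  simp only [ENNReal.toReal_ofNat, ← ENNReal.rpow_natCast, ← ENNReal.rpow_mul]
  norm_num

lemma norm_sq_eq_integral (f : L2 N) : ‖f‖ ^ 2 = ∫ x, ‖f x‖ ^ 2 := by
  have hm : AEStronglyMeasurable (fun x => ‖f x‖ ^ 2) volume :=
    (Lp.aestronglyMeasurable f).norm.pow 2
  rw [integral_eq_lintegral_of_nonneg_ae (Eventually.of_forall fun x => by positivity) hm]
  have : ∀ x, ENNReal.ofReal (‖f x‖ ^ 2) = ‖f x‖ₑ ^ 2 := fun x => by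
    rw [ENNReal.ofReal_pow (norm_nonneg _), ofReal_norm]
  simp only [this, ← enorm_sq_eq_lintegral]
  simp

lemma enorm_fourier (u : L2 N) : ‖(𝓕 u : L2 N)‖ₑ = ‖u‖ₑ := by
  rw [← ofReal_norm, ← ofReal_norm, Lp.norm_fourier_eq]

lemma enorm_sub_lowPass_sq (R : ℝ) (u : L2 N) :
    ‖u - lowPass R u‖ₑ ^ 2 = ∫⁻ ξ in (Metric.closedBall 0 R)ᶜ, ‖(𝓕 u : L2 N) ξ‖ₑ ^ 2 := by
  rw [← enorm_fourier, enorm_sq_eq_lintegral,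
    ← lintegral_indicator Metric.isClosed_closedBall.measurableSet.compl]
  apply lintegral_congr_ae
  have h0 : (𝓕 (u - lowPass R u) : L2 N) = 𝓕 u - 𝓕 (lowPass R u) :=
    (fourierCLM ℂ (L2 N)).map_sub _ _
  rw [h0]
  filter_upwards [Lp.coeFn_sub (𝓕 u : L2 N) (𝓕 (lowPass R u) : L2 N), fourier_lowPass R u]
    with ξ h1 h2
  rw [h1, Pi.sub_apply, h2]
  by_cases h : ξ ∈ Metric.closedBall (0 : Space N) R
  · simp [lowSymbol, h]
  · simp [lowSymbol, h]

end
end FractionalNLS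

/-! ### Gagliardo's formula and the superposition of two functions. -/

namespace FractionalNLS
noncomputable section
variable {N : ℕ}

/-- The squared homogeneous Sobolev norm `∫ |2πξ|^{2α} |û|²`. -/
def kinetic (α : ℝ) (u : L2 N) : ℝ≥0∞ :=
  ∫⁻ ξ, ENNReal.ofReal (rieszSymbol α ξ) ^ 2 * ‖(𝓕 u : L2 N) ξ‖ₑ ^ 2

lemma enorm_gradOfWeight_sq {α : ℝ} (hα : 0 ≤ α) (w : L2 N) :
    ‖gradOfWeight α w‖ₑ ^ 2 = kinetic α (ofWeight α w) := by
  rw [← enorm_fourier, enorm_sq_eq_lintegral, kinetic]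
  apply lintegral_congr_ae
  filter_upwards [fourier_gradOfWeight hα w] with ξ h
  rw [h, enorm_mul, mul_pow]
  congr 2
  rw [← ofReal_norm, Complex.norm_real, Real.norm_of_nonneg (rieszSymbol_nonneg α ξ)]

/-- Subadditivity of t ↦ t^α for α ≤ 1. It bounds the H^α norm by mass and kinetic energy with
constant one. -/
lemma besselSymbol_sq_le {α : ℝ} (hα : 0 ≤ α) (hα1 : α ≤ 1) (ξ : Space N) :
    besselSymbol α ξ ^ 2 ≤ 1 + rieszSymbol α ξ ^ 2 := by
  have h1 : besselSymbol α ξ ^ 2 = (1 + (2 * Real.pi * ‖ξ‖) ^ 2) ^ α := by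
    rw [besselSymbol, ← Real.rpow_natCast, ← Real.rpow_mul (by positivity)]
    congr 1; push_cast; ring
  have h2 : rieszSymbol α ξ ^ 2 = ((2 * Real.pi * ‖ξ‖) ^ 2) ^ α := by
    rw [rieszSymbol, ← Real.rpow_natCast, ← Real.rpow_natCast, ← Real.rpow_mul (by positivity),
      ← Real.rpow_mul (by positivity)]
    congr 1; push_cast; ring
  rw [h1, h2]
  simpa using Real.rpow_add_le_add_rpow (a := 1) (b := (2 * Real.pi * ‖ξ‖) ^ 2) zero_le_one
    (by positivity) hα hα1

lemma normH_sq_le {α : ℝ} (hα : 0 ≤ α) (hα1 : α ≤ 1) (u : L2 N) :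
    normH α u ^ 2 ≤ ‖u‖ₑ ^ 2 + kinetic α u := by
  rw [normH, eLpNorm_eq_lintegral_rpow_enorm_toReal (by norm_num) (by norm_num),
    ← enorm_fourier, enorm_sq_eq_lintegral, kinetic, ← lintegral_add_left'
      ((Lp.aestronglyMeasurable _).enorm.pow_const 2)]
  simp only [ENNReal.toReal_ofNat, ← ENNReal.rpow_natCast, ← ENNReal.rpow_mul]
  norm_num
  refine lintegral_mono fun ξ => ?_
  have h : besselWeighted α u ξ = (besselSymbol α ξ : ℂ) * (𝓕 u : L2 N) ξ := by
    simp [besselWeighted, besselSymbol]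
  rw [h, enorm_mul, mul_pow, ← one_add_mul]
  gcongr
  rw [← ofReal_norm, Complex.norm_real, Real.norm_of_nonneg (besselSymbol_pos α ξ).le,
    ← ENNReal.ofReal_pow (besselSymbol_pos α ξ).le, ← ENNReal.ofReal_pow (rieszSymbol_nonneg α ξ),
    ← ENNReal.ofReal_one, ← ENNReal.ofReal_add zero_le_one (by positivity)]
  exact ENNReal.ofReal_le_ofReal (besselSymbol_sq_le hα hα1 ξ)

lemma memH_of_kinetic_lt_top {α : ℝ} (hα : 0 ≤ α) (hα1 : α ≤ 1) {u : L2 N}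
    (hu : kinetic α u < ∞) : MemH α u := by
  refine ⟨?_, ?_⟩
  · have := (measurable_besselSymbol (N := N) α).aestronglyMeasurable (μ := volume)
    exact this.smul (Lp.aestronglyMeasurable (𝓕 u : L2 N))
  · have h := (normH_sq_le hα hα1 u).trans_lt
      (ENNReal.add_lt_top.2 ⟨ENNReal.pow_lt_top enorm_lt_top, hu⟩)
    exact (ENNReal.pow_lt_top_iff.1 h).resolve_right (by norm_num)

lemma fourier_translate (y : Space N) (u : L2 N) :
    (𝓕 (translate y u) : L2 N) = mulCLM (charSymbol y) (𝓕 u) := by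
  have h := fourierInv_mulCLM_charSymbol y (𝓕 u : L2 N)
  rw [show (𝓕⁻ (𝓕 u : L2 N) : L2 N) = u from fourierInv_fourier_eq u] at h
  rw [← h]
  exact fourier_fourierInv_eq _

lemma enorm_translate_sub_sq (y : Space N) (u : L2 N) :
    ‖translate y u - u‖ₑ ^ 2 = ∫⁻ ξ, ‖charSymbol y ξ - 1‖ₑ ^ 2 * ‖(𝓕 u : L2 N) ξ‖ₑ ^ 2 := by
  rw [← enorm_fourier, enorm_sq_eq_lintegral]
  apply lintegral_congr_ae
  have h0 : (𝓕 (translate y u - u) : L2 N) = 𝓕 (translate y u) - 𝓕 u :=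
    (fourierCLM ℂ (L2 N)).map_sub _ _
  rw [h0, fourier_translate]
  filter_upwards [Lp.coeFn_sub (mulCLM (charSymbol y) (𝓕 u)) (𝓕 u : L2 N),
    coeFn_mulCLM (memLp_charSymbol y) (𝓕 u : L2 N)] with ξ h1 h2
  rw [h1, Pi.sub_apply, h2, ← mul_pow, ← enorm_mul, sub_mul, one_mul]

/-- The kernel `|h|^{-N-2α}`. -/
def gagliardoKernel (α : ℝ) (h : Space N) : ℝ≥0∞ := ENNReal.ofReal (‖h‖ ^ (-(N + 2 * α)))

lemma measurable_gagliardoKernel (α : ℝ) : Measurable (gagliardoKernel (N := N) α) := by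
  unfold gagliardoKernel; fun_prop

/-- The integral `∫ |exp (2πi⟨ξ, h⟩) - 1|² |h|^{-N-2α} dh`. -/
def gagliardoSymbol (α : ℝ) (ξ : Space N) : ℝ≥0∞ :=
  ∫⁻ h, gagliardoKernel α h * ‖charSymbol h ξ - 1‖ₑ ^ 2

lemma continuous_charSymbol_uncurry :
    Continuous fun p : Space N × Space N => charSymbol p.1 p.2 := by
  unfold charSymbol; fun_prop

lemma measurable_gagliardo_integrand (α : ℝ) : Measurable fun p : Space N × Space N =>
    gagliardoKernel α p.1 * ‖charSymbol p.1 p.2 - 1‖ₑ ^ 2 :=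
  ((measurable_gagliardoKernel α).comp measurable_fst).mul
    (((continuous_charSymbol_uncurry.measurable).sub_const 1).enorm.pow_const 2)

lemma continuous_charSymbol_left (ξ : Space N) : Continuous fun h => charSymbol h ξ := by
  unfold charSymbol; fun_prop

lemma measurable_gagliardo_integrand_left (α : ℝ) (ξ : Space N) : Measurable fun h =>
    gagliardoKernel α h * ‖charSymbol h ξ - 1‖ₑ ^ 2 :=
  (measurable_gagliardoKernel α).mul
    ((((continuous_charSymbol_left ξ).measurable).sub_const 1).enorm.pow_const 2)

/-- The reflection in the hyperplane orthogonal to ξ - η maps ξ to η and preserves the measure and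
the kernel. -/
lemma gagliardoSymbol_eq_of_norm_eq (α : ℝ) {ξ η : Space N} (h : ‖ξ‖ = ‖η‖) :
    gagliardoSymbol α ξ = gagliardoSymbol α η := by
  set T : Space N ≃ₗᵢ[ℝ] Space N := (ℝ ∙ (ξ - η))ᗮ.reflection
  have hT : T ξ = η := Submodule.reflection_sub h
  have hm := measurable_gagliardo_integrand_left α η
  rw [gagliardoSymbol, gagliardoSymbol, ← T.measurePreserving.lintegral_comp hm]
  refine lintegral_congr fun h => ?_
  simp only [gagliardoKernel, charSymbol, T.norm_map, ← hT, T.inner_map_map]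

/-- Substitution of c • h for h: the kernel contributes the power N + 2α of c and the measure the
power -N. -/
lemma gagliardoSymbol_smul (α : ℝ) {c : ℝ} (hc : 0 < c) (η : Space N) :
    gagliardoSymbol α (c • η) = ENNReal.ofReal (c ^ (2 * α)) * gagliardoSymbol α η := by
  have hm := measurable_gagliardo_integrand_left α η
  have hmap := Measure.map_addHaar_smul (volume : Measure (Space N)) hc.ne'
  have h1 : ∫⁻ h, gagliardoKernel α (c • h) * ‖charSymbol (c • h) η - 1‖ₑ ^ 2
      = ENNReal.ofReal (c ^ (-(N : ℝ))) * gagliardoSymbol α η := by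
    rw [← lintegral_map (f := fun h => gagliardoKernel α h * ‖charSymbol h η - 1‖ₑ ^ 2) hm
      (measurable_const_smul c), hmap, lintegral_smul_measure, gagliardoSymbol,
      finrank_euclideanSpace_fin, abs_of_pos (by positivity), Real.rpow_neg hc.le,
      Real.rpow_natCast, smul_eq_mul]
  have h2 : ∀ h : Space N, gagliardoKernel α h * ‖charSymbol h (c • η) - 1‖ₑ ^ 2
      = ENNReal.ofReal (c ^ (N + 2 * α))
        * (gagliardoKernel α (c • h) * ‖charSymbol (c • h) η - 1‖ₑ ^ 2) := by
    intro h
    rw [← mul_assoc]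
    congr 1
    · rw [gagliardoKernel, gagliardoKernel, ← ENNReal.ofReal_mul (by positivity), norm_smul,
        Real.norm_of_nonneg hc.le, Real.mul_rpow hc.le (norm_nonneg _), ← mul_assoc,
        ← Real.rpow_add hc]
      simp
    · simp only [charSymbol, inner_smul_left, inner_smul_right]; rfl
  rw [gagliardoSymbol]
  simp only [h2]
  rw [lintegral_const_mul' _ _ ENNReal.ofReal_ne_top, h1, ← mul_assoc,
    ← ENNReal.ofReal_mul (by positivity), ← Real.rpow_add hc]
  congr 3; ring

/-- In polar coordinates, |exp - 1| ≤ 2π|h| leaves the power 1 - 2α near the origin, integrable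
since α < 1, and |exp - 1| ≤ 2 leaves the power -1 - 2α at infinity, integrable since α > 0. -/
lemma gagliardoSymbol_lt_top (hN : 1 ≤ N) {α : ℝ} (hα : 0 < α) (hα1 : α < 1) (ξ : Space N) (hξ : ‖ξ‖ = 1) :
    gagliardoSymbol α ξ < ∞ := by
  have : Nonempty (Fin N) := ⟨⟨0, hN⟩⟩
  set f : ℝ → ℝ := fun y => y ^ (-(N + 2 * α)) * min 4 ((2 * Real.pi * y) ^ 2) with hf
  have hint : Integrable (fun h : Space N => f ‖h‖) := by
    rw [integrable_fun_norm_addHaar volume, finrank_euclideanSpace_fin]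
    have hm : Measurable fun y => y ^ (N - 1) • f y := by
      simp only [hf]; fun_prop
    rw [← Set.Ioc_union_Ioi_eq_Ioi (zero_le_one' ℝ)]
    apply IntegrableOn.union
    · have h1 : IntegrableOn (fun y : ℝ => (2 * Real.pi) ^ 2 * y ^ (1 - 2 * α)) (Set.Ioc 0 1) := by
        have := (intervalIntegral.intervalIntegrable_rpow' (a := 0) (b := 1) (r := 1 - 2 * α)
          (by linarith)).1
        exact this.const_mul _
      refine h1.mono' hm.aestronglyMeasurable ?_
      filter_upwards [ae_restrict_mem measurableSet_Ioc] with y hy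
      have hy0 := hy.1
      rw [Real.norm_of_nonneg (by positivity), smul_eq_mul]
      calc y ^ (N - 1) * (y ^ (-(N + 2 * α)) * min 4 ((2 * Real.pi * y) ^ 2))
          ≤ y ^ (N - 1) * (y ^ (-(N + 2 * α)) * (2 * Real.pi * y) ^ 2) := by
            gcongr; exact min_le_right _ _
        _ = (2 * Real.pi) ^ 2 * (y ^ ((N - 1 : ℕ) : ℝ) * y ^ (-(N + 2 * α)) * y ^ (2 : ℝ)) := by
            rw [Real.rpow_natCast, Real.rpow_two]; ring
        _ = _ := by
            rw [← Real.rpow_add hy0, ← Real.rpow_add hy0, Nat.cast_sub hN]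
            congr 2; push_cast; ring
    · have h1 : IntegrableOn (fun y : ℝ => 4 * y ^ (-1 - 2 * α)) (Set.Ioi 1) :=
        (integrableOn_Ioi_rpow_of_lt (by linarith) one_pos).const_mul _
      refine h1.mono' hm.aestronglyMeasurable ?_
      filter_upwards [ae_restrict_mem measurableSet_Ioi] with y hy
      have hy0 : 0 < y := one_pos.trans hy
      rw [Real.norm_of_nonneg (by positivity), smul_eq_mul]
      calc y ^ (N - 1) * (y ^ (-(N + 2 * α)) * min 4 ((2 * Real.pi * y) ^ 2))
          ≤ y ^ (N - 1) * (y ^ (-(N + 2 * α)) * 4) := by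
            gcongr; exact min_le_left _ _
        _ = 4 * (y ^ ((N - 1 : ℕ) : ℝ) * y ^ (-(N + 2 * α))) := by
            rw [Real.rpow_natCast]; ring
        _ = _ := by
            rw [← Real.rpow_add hy0, Nat.cast_sub hN]
            congr 2; push_cast; ring
  refine lt_of_le_of_lt (lintegral_mono fun h => ?_) hint.lintegral_lt_top
  rw [gagliardoKernel, ← ofReal_norm, ← ENNReal.ofReal_pow (norm_nonneg _),
    ← ENNReal.ofReal_mul (by positivity)]
  apply ENNReal.ofReal_le_ofReal
  simp only [hf]
  gcongr
  apply le_min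
  · have : ‖charSymbol h ξ - 1‖ ≤ 2 := by
      refine (norm_sub_le _ _).trans ?_
      rw [norm_charSymbol, norm_one]; norm_num
    nlinarith [norm_nonneg (charSymbol h ξ - 1)]
  · gcongr
    have h1 : ‖charSymbol h ξ - 1‖ ≤ ‖2 * Real.pi * inner ℝ ξ h‖ := by
      rw [charSymbol, mul_comm]
      exact Real.norm_exp_I_mul_ofReal_sub_one_le
    refine h1.trans ?_
    have h2 := abs_real_inner_le_norm ξ h
    rw [hξ, one_mul] at h2
    rw [norm_mul, Real.norm_of_nonneg (by positivity)]
    gcongr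
    exact h2

/-- Otherwise the character would be identically 1 by continuity, but at h = ξ/2 it equals exp(πi) =
-1. The constant in Gagliardo's formula must be nonzero because it is cancelled later. -/
lemma gagliardoSymbol_ne_zero (hN : 1 ≤ N) (α : ℝ) (ξ : Space N) (hξ : ‖ξ‖ = 1) :
    gagliardoSymbol α ξ ≠ 0 := by
  have : Nonempty (Fin N) := ⟨⟨0, hN⟩⟩
  intro h0
  have hm := measurable_gagliardo_integrand_left α ξ
  rw [gagliardoSymbol, lintegral_eq_zero_iff hm] at h0
  have h1 : (fun h : Space N => charSymbol h ξ) =ᵐ[volume] fun _ => 1 := by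
    have hne : ∀ᵐ h : Space N, h ≠ 0 := by simp [ae_iff]
    filter_upwards [h0, hne] with h hh hne
    have hk : gagliardoKernel α h ≠ 0 := by
      rw [gagliardoKernel, Ne, ENNReal.ofReal_eq_zero, not_le]
      have := norm_pos_iff.2 hne
      positivity
    simpa [hk, sub_eq_zero] using hh
  have hc := continuous_charSymbol_left ξ
  have h2 := congrFun ((hc.ae_eq_iff_eq _ continuous_const).1 h1) ((1 / 2 : ℝ) • ξ)
  simp only [charSymbol, inner_smul_right, real_inner_self_eq_norm_sq, hξ] at h2
  have h3 : (((2 * Real.pi * (1 / 2 * 1 ^ 2) : ℝ) : ℂ)) * Complex.I = Real.pi * Complex.I := by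
    push_cast; ring
  rw [h3, Complex.exp_pi_mul_I] at h2
  norm_num at h2

/-- Gagliardo's formula for the homogeneous Sobolev norm. -/
lemma exists_gagliardo (hN : 1 ≤ N) {α : ℝ} (hα : 0 < α) (hα1 : α < 1) :
    ∃ C : ℝ≥0∞, C ≠ 0 ∧ C ≠ ∞ ∧ ∀ u : L2 N,
      ∫⁻ h, gagliardoKernel α h * ‖translate h u - u‖ₑ ^ 2 = C * kinetic α u := by
  have : Nonempty (Fin N) := ⟨⟨0, hN⟩⟩
  obtain ⟨e, he⟩ : ∃ e : Space N, ‖e‖ = 1 := exists_norm_eq _ zero_le_one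
  -- Compensates the factor 2π in `rieszSymbol`, since the scaling law yields |ξ|^{2α} rather than
  -- |2πξ|^{2α}.
  set c : ℝ := (2 * Real.pi) ^ (-(2 * α)) with hc
  have hcpos : 0 < c := by positivity
  refine ⟨ENNReal.ofReal c * gagliardoSymbol α e, mul_ne_zero (by simpa using hcpos)
    (gagliardoSymbol_ne_zero hN α e he),
    ENNReal.mul_ne_top ENNReal.ofReal_ne_top (gagliardoSymbol_lt_top hN hα hα1 e he).ne, fun u => ?_⟩
  have hsym : ∀ ξ : Space N, gagliardoSymbol α ξ
      = ENNReal.ofReal c * gagliardoSymbol α e * ENNReal.ofReal (rieszSymbol α ξ) ^ 2 := by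
    intro ξ
    by_cases hξ : ξ = 0
    · subst hξ
      have h1 : rieszSymbol α (0 : Space N) = 0 := by simp [rieszSymbol, hα.ne']
      have h2 : gagliardoSymbol α (0 : Space N) = 0 := by simp [gagliardoSymbol, charSymbol]
      simp [h1, h2]
    · have hpos : 0 < ‖ξ‖ := norm_pos_iff.2 hξ
      have h1 : gagliardoSymbol α ξ = gagliardoSymbol α (‖ξ‖ • e) :=
        gagliardoSymbol_eq_of_norm_eq α (by rw [norm_smul, he]; simp)
      rw [h1, gagliardoSymbol_smul α hpos, mul_comm (ENNReal.ofReal c), mul_comm, mul_assoc,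
        ← ENNReal.ofReal_pow (rieszSymbol_nonneg α ξ), ← ENNReal.ofReal_mul hcpos.le]
      congr 2
      rw [rieszSymbol, hc, ← Real.rpow_natCast, ← Real.rpow_mul (by positivity),
        Real.mul_rpow (x := 2 * Real.pi) (y := ‖ξ‖) (by positivity) (by positivity), ← mul_assoc,
        ← Real.rpow_add (by positivity)]
      have : -(2 * α) + α * ((2 : ℕ) : ℝ) = 0 := by push_cast; ring
      rw [this, Real.rpow_zero, one_mul]
      congr 1; push_cast; ring
  have hmeas : AEMeasurable (fun ξ => ‖(𝓕 u : L2 N) ξ‖ₑ ^ 2) :=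
    (Lp.aestronglyMeasurable _).enorm.pow_const 2
  calc ∫⁻ h, gagliardoKernel α h * ‖translate h u - u‖ₑ ^ 2
      = ∫⁻ h, ∫⁻ ξ, gagliardoKernel α h * ‖charSymbol h ξ - 1‖ₑ ^ 2 * ‖(𝓕 u : L2 N) ξ‖ₑ ^ 2 := by
        refine lintegral_congr fun h => ?_
        rw [enorm_translate_sub_sq, ← lintegral_const_mul' _ _
          (show gagliardoKernel α h ≠ ∞ from ENNReal.ofReal_ne_top)]
        simp only [mul_assoc]
    _ = ∫⁻ ξ, ∫⁻ h, gagliardoKernel α h * ‖charSymbol h ξ - 1‖ₑ ^ 2 * ‖(𝓕 u : L2 N) ξ‖ₑ ^ 2 := by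
        apply lintegral_lintegral_swap
        exact (measurable_gagliardo_integrand α).aemeasurable.mul (hmeas.comp_snd)
    _ = ∫⁻ ξ, gagliardoSymbol α ξ * ‖(𝓕 u : L2 N) ξ‖ₑ ^ 2 := by
        refine lintegral_congr fun ξ => ?_
        rw [lintegral_mul_const']
        · rfl
        · exact ENNReal.pow_ne_top enorm_ne_top
    _ = _ := by
        rw [kinetic, ← lintegral_const_mul']
        · exact lintegral_congr fun ξ => by rw [hsym ξ, mul_assoc]
        · exact ENNReal.mul_ne_top ENNReal.ofReal_ne_top (gagliardoSymbol_lt_top hN hα hα1 e he).ne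

/-- Superposition of two functions: the fractional Dirichlet energy of `(|u|² + |v|²)^{1/2}`. -/
lemma exists_superposition (hN : 1 ≤ N) {α : ℝ} (hα : 0 < α) (hα1 : α < 1) (u v : L2 N) :
    ∃ w : L2 N, (∀ᵐ x, w x = (√(‖u x‖ ^ 2 + ‖v x‖ ^ 2) : ℝ)) ∧
      kinetic α w ≤ kinetic α u + kinetic α v := by
  set W : Space N → ℂ := fun x => (√(‖u x‖ ^ 2 + ‖v x‖ ^ 2) : ℝ) with hW
  have hWm : MemLp W 2 volume := by
    have h1 := (Lp.memLp u).norm.add (Lp.memLp v).norm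
    refine h1.of_le ?_ (Eventually.of_forall fun x => ?_)
    · have hu := (Lp.aestronglyMeasurable u).norm.aemeasurable
      have hv := (Lp.aestronglyMeasurable v).norm.aemeasurable
      exact (Complex.measurable_ofReal.comp_aemeasurable
        (((hu.pow_const 2).add (hv.pow_const 2)).sqrt)).aestronglyMeasurable
    · simp only [hW, Pi.add_apply]
      rw [Complex.norm_real, Real.norm_of_nonneg (Real.sqrt_nonneg _),
        Real.norm_of_nonneg (by positivity)]
      apply Real.sqrt_le_iff.2 ⟨by positivity, ?_⟩
      nlinarith [norm_nonneg (u x), norm_nonneg (v x)]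
  refine ⟨hWm.toLp W, hWm.coeFn_toLp, ?_⟩
  obtain ⟨C, hC0, hC1, hC⟩ := exists_gagliardo hN hα hα1
  rw [← ENNReal.mul_le_mul_iff_right hC0 hC1, mul_add, ← hC, ← hC, ← hC]
  -- Measurability of one summand is needed to add the integrals; it is read off from the Fourier
  -- side, where the translate enters only through the character.
  have hmeas : Measurable fun h => gagliardoKernel α h * ‖translate h u - u‖ₑ ^ 2 := by
    have : Measurable fun h : Space N => ‖translate h u - u‖ₑ ^ 2 := by
      simp only [enorm_translate_sub_sq]
      exact Measurable.lintegral_prod_right' (f := fun p : Space N × Space N =>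
        ‖charSymbol p.1 p.2 - 1‖ₑ ^ 2 * ‖(𝓕 u : L2 N) p.2‖ₑ ^ 2)
        ((((continuous_charSymbol_uncurry.measurable).sub_const 1).enorm.pow_const 2).mul
          (((Lp.stronglyMeasurable (𝓕 u : L2 N)).measurable.comp measurable_snd).enorm.pow_const 2))
    exact (measurable_gagliardoKernel α).mul this
  rw [← lintegral_add_left hmeas]
  refine lintegral_mono fun h => ?_
  simp only [← mul_add]
  gcongr
  rw [enorm_sq_eq_lintegral, enorm_sq_eq_lintegral, enorm_sq_eq_lintegral,
    ← lintegral_add_left' ((Lp.aestronglyMeasurable _).enorm.pow_const 2)]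
  apply lintegral_mono_ae
  have hq := (measurePreserving_add_right (volume : Measure (Space N)) h).quasiMeasurePreserving.ae
    hWm.coeFn_toLp
  filter_upwards [Lp.coeFn_sub (translate h u) u, Lp.coeFn_sub (translate h v) v,
    Lp.coeFn_sub (translate h (hWm.toLp W)) (hWm.toLp W), hq, hWm.coeFn_toLp, coeFn_translate h u,
    coeFn_translate h v, coeFn_translate h (hWm.toLp W)] with x h1 h2 h3 h4 h5 h6 h7 h8
  rw [h1, h2, h3, Pi.sub_apply, Pi.sub_apply, Pi.sub_apply, h6, h7, h8, h4, h5]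
  simp only [← ofReal_norm]
  rw [← ENNReal.ofReal_pow (norm_nonneg _), ← ENNReal.ofReal_pow (norm_nonneg _),
    ← ENNReal.ofReal_pow (norm_nonneg _), ← ENNReal.ofReal_add (by positivity) (by positivity)]
  apply ENNReal.ofReal_le_ofReal
  simp only [hW]
  rw [← Complex.ofReal_sub, Complex.norm_real, Real.norm_eq_abs, sq_abs]
  have ha := abs_norm_sub_norm_le (u (x + h)) (u x)
  have hb := abs_norm_sub_norm_le (v (x + h)) (v x)
  have ha' := sq_le_sq' (by linarith [abs_nonneg (‖u (x + h)‖ - ‖u x‖), norm_nonneg (u (x+h) - u x)]) ha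
  have hb' := sq_le_sq' (by linarith [abs_nonneg (‖v (x + h)‖ - ‖v x‖), norm_nonneg (v (x+h) - v x)]) hb
  rw [sq_abs] at ha' hb'
  set a := ‖u (x + h)‖
  set b := ‖v (x + h)‖
  set c := ‖u x‖
  set d := ‖v x‖
  have s1 := Real.sq_sqrt (show 0 ≤ a ^ 2 + b ^ 2 by positivity)
  have s2 := Real.sq_sqrt (show 0 ≤ c ^ 2 + d ^ 2 by positivity)
  -- Cauchy–Schwarz. It gives the reverse triangle inequality for the vectors (a, b) and (c, d) of
  -- ℝ², so that the increment of W is at most the combined increments of |u| and |v|, hence of u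
  -- and v.
  have s3 : a * c + b * d ≤ √(a ^ 2 + b ^ 2) * √(c ^ 2 + d ^ 2) := by
    rw [← Real.sqrt_mul (by positivity)]
    apply Real.le_sqrt_of_sq_le
    nlinarith [sq_nonneg (a * d - b * c)]
  nlinarith
end
end FractionalNLS

/-! ### Subcritical Gagliardo–Nirenberg inequalities by frequency truncation. -/

namespace FractionalNLS
noncomputable section
variable {N : ℕ}

lemma enorm_rpow_eq {E : Type*} [NormedAddCommGroup E] (z : E) {q : ℝ} (hq : 0 ≤ q) : ‖z‖ₑ ^ q = ENNReal.ofReal (‖z‖ ^ q) := by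
  rw [← ofReal_norm, ENNReal.ofReal_rpow_of_nonneg (norm_nonneg _) hq]

/-- The constant in the bound of the low frequency part. -/
def lowConst (N : ℕ) : ℝ := √(volume.real (Metric.closedBall (0 : Space N) 1))

lemma lowConst_pos (N : ℕ) : 0 < lowConst N :=
  Real.sqrt_pos.2 (ENNReal.toReal_pos (Metric.measure_closedBall_pos _ _ one_pos).ne'
    measure_closedBall_lt_top.ne)

lemma norm_inner_lowVector_le {R : ℝ} (hR : 0 ≤ R) (x : Space N) (u : L2 N) :
    ‖inner ℂ (lowVector R x) (𝓕 u : L2 N)‖ ≤ lowConst N * R ^ ((N : ℝ) / 2) * ‖u‖ := by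
  refine (norm_inner_le_norm _ _).trans ?_
  rw [Lp.norm_fourier_eq]
  gcongr
  exact norm_lowVector_le hR x

/-- The hypothesis makes the frequencies up to R contribute at most t/2 pointwise, so |u| > t forces
the high-frequency part above t/2, and Chebyshev's inequality with Plancherel's theorem applies. -/
lemma measure_lt_norm_le (u : L2 N) {t R : ℝ} (ht : 0 < t) (hR : 0 ≤ R)
    (h : lowConst N * R ^ ((N : ℝ) / 2) * ‖u‖ ≤ t / 2) :
    volume {x | t < ‖u x‖} ≤ ENNReal.ofReal (4 * t ^ (-2 : ℝ)) *
      ∫⁻ ξ in (Metric.closedBall 0 R)ᶜ, ‖(𝓕 u : L2 N) ξ‖ₑ ^ 2 := by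
  rw [← enorm_sub_lowPass_sq, enorm_sq_eq_lintegral]
  have h1 : volume {x | t < ‖u x‖}
      ≤ volume {x | ENNReal.ofReal ((t / 2) ^ 2) ≤ ‖(u - lowPass R u) x‖ₑ ^ 2} := by
    apply measure_mono_ae
    filter_upwards [coeFn_lowPass R u, Lp.coeFn_sub u (lowPass R u)] with x h1 h2 h3
    change t < ‖u x‖ at h3
    change ENNReal.ofReal _ ≤ _
    rw [h2, Pi.sub_apply, ← ofReal_norm, ← ENNReal.ofReal_pow (norm_nonneg _)]
    apply ENNReal.ofReal_le_ofReal
    have h4 : ‖lowPass R u x‖ ≤ t / 2 := by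
      rw [h1]; exact (norm_inner_lowVector_le hR x u).trans h
    have h5 : t / 2 ≤ ‖u x - lowPass R u x‖ := by
      have := norm_sub_norm_le (u x) (lowPass R u x)
      linarith
    gcongr
  have hm : AEMeasurable (fun x => ‖(u - lowPass R u) x‖ₑ ^ 2) volume :=
    (Lp.aestronglyMeasurable _).enorm.pow_const 2
  have h2 := mul_meas_ge_le_lintegral₀ hm (ENNReal.ofReal ((t / 2) ^ 2))
  refine h1.trans ?_
  calc volume {x | ENNReal.ofReal ((t / 2) ^ 2) ≤ ‖(u - lowPass R u) x‖ₑ ^ 2}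
      = ENNReal.ofReal (4 * t ^ (-2 : ℝ)) * (ENNReal.ofReal ((t / 2) ^ 2) *
        volume {x | ENNReal.ofReal ((t / 2) ^ 2) ≤ ‖(u - lowPass R u) x‖ₑ ^ 2}) := by
        rw [← mul_assoc, ← ENNReal.ofReal_mul (by positivity)]
        have : 4 * t ^ (-2 : ℝ) * (t / 2) ^ 2 = 1 := by
          rw [Real.rpow_neg ht.le, Real.rpow_two]; field_simp; ring
        rw [this]; simp
    _ ≤ _ := by gcongr

lemma lintegral_rpow_Ioo_le {s L : ℝ} (hs : -1 < s) (hL : 0 ≤ L) :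
    ∫⁻ t in Set.Ioi 0, (Set.Iio L).indicator (fun t : ℝ => ENNReal.ofReal (t ^ s)) t
      ≤ ENNReal.ofReal (L ^ (s + 1) / (s + 1)) := by
  rw [lintegral_indicator measurableSet_Iio, Measure.restrict_restrict measurableSet_Iio]
  have h1 : Set.Iio L ∩ Set.Ioi 0 ⊆ Set.Ioc 0 L := fun x hx => ⟨hx.2, le_of_lt hx.1⟩
  refine (lintegral_mono_set h1).trans ?_
  have hi := (intervalIntegral.intervalIntegrable_rpow' (a := 0) (b := L) hs).1
  rw [← ofReal_integral_eq_lintegral_ofReal hi]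
  · rw [← intervalIntegral.integral_of_le hL, integral_rpow (Or.inl hs),
      Real.zero_rpow (by linarith), sub_zero]
  · filter_upwards [ae_restrict_mem measurableSet_Ioc] with t ht
    exact Real.rpow_nonneg ht.1.le _

/-- A Gagliardo–Nirenberg inequality. -/
lemma exists_lintegral_rpow_le (hN : 1 ≤ N) {q : ℝ} (hq : 2 < q) :
    ∃ C : ℝ≥0∞, C ≠ ∞ ∧ ∀ u : L2 N, ∫⁻ x, ‖u x‖ₑ ^ q ≤ C * ‖u‖ₑ ^ (q - 2) *
      ∫⁻ ξ, ENNReal.ofReal (‖ξ‖ ^ (N * (q - 2) / 2)) * ‖(𝓕 u : L2 N) ξ‖ₑ ^ 2 := by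
  have hN0 : (0 : ℝ) < N := by exact_mod_cast hN
  have hκ := lowConst_pos N
  refine ⟨ENNReal.ofReal (q * 4 * ((2 * lowConst N) ^ (q - 2) / (q - 2))), ENNReal.ofReal_ne_top,
    fun u => ?_⟩
  rcases (norm_nonneg u).eq_or_lt with hA | hA
  · have hu : u = 0 := norm_eq_zero.1 hA.symm
    have h0 : ∫⁻ x, ‖u x‖ₑ ^ q = 0 := by
      rw [lintegral_eq_zero_iff' ((Lp.aestronglyMeasurable u).enorm.pow_const q)]
      rw [hu]
      filter_upwards [Lp.coeFn_zero ℂ 2 (volume : Measure (Space N))] with x hx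
      rw [hx]
      simp [show 0 < q by linarith]
    rw [h0]; exact zero_le
  set A := ‖u‖ with hAdef
  -- The level at which the truncation radius R(t) chosen below equals |ξ|. After Tonelli the
  -- frequency ξ contributes only for t < Λ ξ, and the integral of t^{q-3}, convergent at 0 because
  -- q > 2, produces the power |ξ|^{N(q-2)/2}.
  set Λ : Space N → ℝ := fun ξ => 2 * lowConst N * A * ‖ξ‖ ^ ((N : ℝ) / 2) with hΛ
  have hΛm : Measurable Λ := by simp only [hΛ]; fun_prop
  have hû : Measurable fun ξ => ‖(𝓕 u : L2 N) ξ‖ₑ ^ 2 :=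
    (Lp.stronglyMeasurable _).measurable.enorm.pow_const 2
  have key : ∀ t ∈ Set.Ioi (0 : ℝ), volume {x | t < ‖u x‖} * ENNReal.ofReal (t ^ (q - 1))
      ≤ ∫⁻ ξ, ENNReal.ofReal 4 * ((Set.Iio (Λ ξ)).indicator (fun t => ENNReal.ofReal (t ^ (q - 3))) t
        * ‖(𝓕 u : L2 N) ξ‖ₑ ^ 2) := by
    intro t ht
    have ht : 0 < t := ht
    -- The largest radius for which the low frequencies contribute at most t/2.
    set R : ℝ := (t / (2 * lowConst N * A)) ^ (2 / (N : ℝ)) with hR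
    have hR0 : 0 ≤ R := by positivity
    have hRN : R ^ ((N : ℝ) / 2) = t / (2 * lowConst N * A) := by
      rw [hR, ← Real.rpow_mul (by positivity)]
      have : 2 / (N : ℝ) * (N / 2) = 1 := by field_simp
      rw [this, Real.rpow_one]
    have h1 := measure_lt_norm_le u ht hR0 (by rw [hRN, ← hAdef]; apply le_of_eq; field_simp)
    calc volume {x | t < ‖u x‖} * ENNReal.ofReal (t ^ (q - 1))
        ≤ ENNReal.ofReal (4 * t ^ (-2 : ℝ)) *
          (∫⁻ ξ in (Metric.closedBall 0 R)ᶜ, ‖(𝓕 u : L2 N) ξ‖ₑ ^ 2)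
            * ENNReal.ofReal (t ^ (q - 1)) := by gcongr
      _ = ∫⁻ ξ in (Metric.closedBall 0 R)ᶜ,
            ENNReal.ofReal (4 * t ^ (q - 3)) * ‖(𝓕 u : L2 N) ξ‖ₑ ^ 2 := by
          rw [lintegral_const_mul' _ _ ENNReal.ofReal_ne_top, mul_right_comm,
            ← ENNReal.ofReal_mul (by positivity)]
          congr 2
          rw [mul_assoc, ← Real.rpow_add ht]; ring_nf
      _ ≤ _ := by
          rw [← lintegral_indicator Metric.isClosed_closedBall.measurableSet.compl]
          refine lintegral_mono fun ξ => ?_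
          by_cases hξ : ξ ∈ (Metric.closedBall (0 : Space N) R)ᶜ
          · have hlt : R < ‖ξ‖ := by simpa using hξ
            have hmem : t ∈ Set.Iio (Λ ξ) := by
              have h2 : R ^ ((N : ℝ) / 2) < ‖ξ‖ ^ ((N : ℝ) / 2) :=
                Real.rpow_lt_rpow hR0 hlt (by positivity)
              rw [hRN, div_lt_iff₀ (by positivity)] at h2
              simp only [hΛ, Set.mem_Iio]; linarith
            rw [Set.indicator_of_mem hξ, Set.indicator_of_mem hmem, ← mul_assoc,
              ENNReal.ofReal_mul (by norm_num)]
          · rw [Set.indicator_of_notMem hξ]; exact zero_le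
  have hjm : Measurable fun p : ℝ × Space N => ENNReal.ofReal 4 *
      ((Set.Iio (Λ p.2)).indicator (fun t => ENNReal.ofReal (t ^ (q - 3))) p.1
        * ‖(𝓕 u : L2 N) p.2‖ₑ ^ 2) := by
    have hs : MeasurableSet {p : ℝ × Space N | p.1 < Λ p.2} :=
      measurableSet_lt measurable_fst (hΛm.comp measurable_snd)
    have h1 : Measurable fun p : ℝ × Space N => ENNReal.ofReal (p.1 ^ (q - 3)) := by fun_prop
    have h2 := h1.indicator hs
    refine Measurable.const_mul (Measurable.mul ?_ (hû.comp measurable_snd)) _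
    exact h2
  calc ∫⁻ x, ‖u x‖ₑ ^ q = ∫⁻ x, ENNReal.ofReal (‖u x‖ ^ q) := by
        simp only [enorm_rpow_eq _ (show 0 ≤ q by linarith)]
    _ = ENNReal.ofReal q * ∫⁻ t in Set.Ioi 0,
          volume {x | t < ‖u x‖} * ENNReal.ofReal (t ^ (q - 1)) :=
        lintegral_rpow_eq_lintegral_meas_lt_mul volume
          (Eventually.of_forall fun x => norm_nonneg _)
          (Lp.aestronglyMeasurable u).norm.aemeasurable (by linarith)
    _ ≤ ENNReal.ofReal q * ∫⁻ t in Set.Ioi 0, ∫⁻ ξ, ENNReal.ofReal 4 *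
          ((Set.Iio (Λ ξ)).indicator (fun t => ENNReal.ofReal (t ^ (q - 3))) t
            * ‖(𝓕 u : L2 N) ξ‖ₑ ^ 2) :=
        mul_le_mul_right (setLIntegral_mono' measurableSet_Ioi key) _
    _ = ENNReal.ofReal q * ∫⁻ ξ, ∫⁻ t in Set.Ioi 0, ENNReal.ofReal 4 *
          ((Set.Iio (Λ ξ)).indicator (fun t => ENNReal.ofReal (t ^ (q - 3))) t
            * ‖(𝓕 u : L2 N) ξ‖ₑ ^ 2) := by
        rw [lintegral_lintegral_swap hjm.aemeasurable]
    _ ≤ ENNReal.ofReal q * ∫⁻ ξ, ENNReal.ofReal 4 *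
          (ENNReal.ofReal ((Λ ξ) ^ (q - 2) / (q - 2)) * ‖(𝓕 u : L2 N) ξ‖ₑ ^ 2) := by
        gcongr with ξ
        rw [lintegral_const_mul' _ _ ENNReal.ofReal_ne_top,
          lintegral_mul_const' _ _ (ENNReal.pow_ne_top enorm_ne_top)]
        gcongr
        have := lintegral_rpow_Ioo_le (s := q - 3) (L := Λ ξ) (by linarith) (by positivity)
        rwa [show q - 3 + 1 = q - 2 by ring] at this
    _ = _ := by
        have he : ‖u‖ₑ ^ (q - 2) = ENNReal.ofReal (A ^ (q - 2)) := by
          rw [← ofReal_norm, ENNReal.ofReal_rpow_of_nonneg (norm_nonneg _) (by linarith)]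
        rw [he, ← ENNReal.ofReal_mul (by have : 0 < q - 2 := by linarith
                                         positivity),
          ← lintegral_const_mul' _ _ ENNReal.ofReal_ne_top,
          ← lintegral_const_mul' _ _ ENNReal.ofReal_ne_top]
        refine lintegral_congr fun ξ => ?_
        rw [← mul_assoc, ← mul_assoc, ← mul_assoc]
        congr 1
        have hq2 : 0 < q - 2 := by linarith
        rw [← ENNReal.ofReal_mul (by positivity), ← ENNReal.ofReal_mul (by positivity),
          ← ENNReal.ofReal_mul (by positivity)]
        congr 1
        simp only [hΛ]
        rw [Real.mul_rpow (by positivity) (by positivity), Real.mul_rpow (by positivity) hA.le,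
          ← Real.rpow_mul (norm_nonneg _)]
        have : (N : ℝ) / 2 * (q - 2) = N * (q - 2) / 2 := by ring
        rw [this]; ring

lemma exists_rpow_le_add {s t : ℝ} (hs : 0 ≤ s) (hst : s < t) {ε : ℝ} (hε : 0 < ε) :
    ∃ C : ℝ, 0 ≤ C ∧ ∀ x : ℝ, 0 ≤ x → x ^ s ≤ ε * x ^ t + C := by
  -- The point where ε x^t = x^s; beyond it the first term dominates, and before it T^s does.
  set T : ℝ := (1 / ε) ^ (1 / (t - s)) with hT
  have hT0 : 0 < T := by positivity
  have hd : 0 < t - s := by linarith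
  refine ⟨T ^ s, by positivity, fun x hx => ?_⟩
  rcases le_total x T with h | h
  · have := Real.rpow_le_rpow hx h hs
    have h2 : 0 ≤ ε * x ^ t := by positivity
    linarith
  · have hx0 : 0 < x := hT0.trans_le h
    have h1 : 1 / ε ≤ x ^ (t - s) := by
      calc 1 / ε = T ^ (t - s) := by
            rw [hT, ← Real.rpow_mul (by positivity), one_div_mul_cancel hd.ne', Real.rpow_one]
        _ ≤ _ := Real.rpow_le_rpow hT0.le h hd.le
    have h2 : x ^ t = x ^ (t - s) * x ^ s := by rw [← Real.rpow_add hx0]; ring_nf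
    have h3 : 0 < x ^ s := by positivity
    have h4 : 1 ≤ ε * x ^ (t - s) := by
      rw [div_le_iff₀ hε] at h1; linarith
    have h5 : 0 ≤ T ^ s := by positivity
    rw [h2]
    nlinarith

/-- The subcritical Sobolev inequality, with an arbitrarily small multiple of the kinetic
energy. -/
lemma exists_lintegral_rpow_le_kinetic (hN : 1 ≤ N) {α q : ℝ} (hq : 2 < q)
    (hq' : q < 2 + 4 * α / N) {ε : ℝ} (hε : 0 < ε) :
    ∃ C : ℝ≥0∞, C ≠ ∞ ∧ ∀ u : L2 N, ∫⁻ x, ‖u x‖ₑ ^ q ≤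
      ‖u‖ₑ ^ (q - 2) * (ENNReal.ofReal ε * kinetic α u + C * ‖u‖ₑ ^ 2) := by
  have hN0 : (0 : ℝ) < N := by exact_mod_cast hN
  obtain ⟨C, hC, h⟩ := exists_lintegral_rpow_le hN hq
  -- This is the mass-subcritical condition q < 2 + 4α/N. It makes the frequency weight a lower
  -- power than the kinetic one, hence bounded by a small multiple of it plus a constant.
  have hs : (N : ℝ) * (q - 2) / 2 < 2 * α := by
    have : q - 2 < 4 * α / N := by linarith
    rw [lt_div_iff₀ hN0] at this
    linarith
  have hs0 : 0 ≤ (N : ℝ) * (q - 2) / 2 := by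
    have : 0 < q - 2 := by linarith
    positivity
  obtain ⟨D, hD0, hD⟩ := exists_rpow_le_add hs0 hs (ε := ε / (C.toReal + 1)) (by positivity)
  refine ⟨C * ENNReal.ofReal D, ENNReal.mul_ne_top hC ENNReal.ofReal_ne_top, fun u => ?_⟩
  refine (h u).trans ?_
  have hpt : ∀ ξ : Space N, ENNReal.ofReal (‖ξ‖ ^ (N * (q - 2) / 2)) * ‖(𝓕 u : L2 N) ξ‖ₑ ^ 2
      ≤ ENNReal.ofReal (ε / (C.toReal + 1)) *
        (ENNReal.ofReal (rieszSymbol α ξ) ^ 2 * ‖(𝓕 u : L2 N) ξ‖ₑ ^ 2)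
        + ENNReal.ofReal D * ‖(𝓕 u : L2 N) ξ‖ₑ ^ 2 := by
    intro ξ
    rw [← mul_assoc, ← add_mul, ← ENNReal.ofReal_pow (rieszSymbol_nonneg α ξ),
      ← ENNReal.ofReal_mul (by positivity), ← ENNReal.ofReal_add
        (mul_nonneg (by positivity) (by positivity)) hD0]
    gcongr
    have h1 : ‖ξ‖ ≤ 2 * Real.pi * ‖ξ‖ := by
      nlinarith [norm_nonneg ξ, Real.pi_gt_three]
    have h2 : rieszSymbol α ξ ^ 2 = (2 * Real.pi * ‖ξ‖) ^ (2 * α) := by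
      rw [rieszSymbol, ← Real.rpow_natCast, ← Real.rpow_mul (by positivity)]
      congr 1; push_cast; ring
    rw [h2]
    exact (Real.rpow_le_rpow (norm_nonneg _) h1 hs0).trans (hD _ (by positivity))
  have hint : ∫⁻ ξ, ENNReal.ofReal (‖ξ‖ ^ (N * (q - 2) / 2)) * ‖(𝓕 u : L2 N) ξ‖ₑ ^ 2
      ≤ ENNReal.ofReal (ε / (C.toReal + 1)) * kinetic α u + ENNReal.ofReal D * ‖u‖ₑ ^ 2 := by
    refine (lintegral_mono hpt).trans (le_of_eq ?_)
    rw [lintegral_add_right' _ (((Lp.aestronglyMeasurable _).enorm.pow_const 2).const_mul _),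
      lintegral_const_mul' _ _ ENNReal.ofReal_ne_top,
      lintegral_const_mul' _ _ ENNReal.ofReal_ne_top, ← enorm_sq_eq_lintegral, enorm_fourier,
      kinetic]
  have hCε : C * ENNReal.ofReal (ε / (C.toReal + 1)) ≤ ENNReal.ofReal ε := by
    nth_rewrite 1 [← ENNReal.ofReal_toReal hC]
    rw [← ENNReal.ofReal_mul ENNReal.toReal_nonneg]
    apply ENNReal.ofReal_le_ofReal
    rw [← mul_div_assoc, div_le_iff₀ (by positivity)]
    nlinarith
  calc C * ‖u‖ₑ ^ (q - 2) * _
      ≤ C * ‖u‖ₑ ^ (q - 2) * (ENNReal.ofReal (ε / (C.toReal + 1)) * kinetic α u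
          + ENNReal.ofReal D * ‖u‖ₑ ^ 2) := by gcongr
    _ = ‖u‖ₑ ^ (q - 2) * (C * ENNReal.ofReal (ε / (C.toReal + 1)) * kinetic α u
          + C * ENNReal.ofReal D * ‖u‖ₑ ^ 2) := by ring
    _ ≤ _ := by gcongr
end
end FractionalNLS

/-! ### Nonvanishing at low frequencies. -/

namespace FractionalNLS
noncomputable section
variable {N : ℕ}

lemma norm_ofWeight_le {α : ℝ} (hα : 0 ≤ α) (w : L2 N) : ‖ofWeight α w‖ ≤ ‖w‖ := by
  rw [← Lp.norm_fourier_eq]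
  apply Lp.norm_le_norm_of_ae_le
  filter_upwards [fourier_ofWeight hα w] with ξ h
  rw [h, norm_mul, Complex.norm_real, norm_inv, Real.norm_of_nonneg (besselSymbol_pos α ξ).le]
  exact mul_le_of_le_one_left (norm_nonneg _) (inv_le_one_of_one_le₀ (one_le_besselSymbol hα ξ))

lemma norm_gradOfWeight_le {α : ℝ} (hα : 0 ≤ α) (w : L2 N) : ‖gradOfWeight α w‖ ≤ ‖w‖ := by
  rw [← Lp.norm_fourier_eq]
  apply Lp.norm_le_norm_of_ae_le
  filter_upwards [fourier_gradOfWeight hα w, fourier_ofWeight hα w] with ξ h h'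
  rw [h, h', norm_mul, norm_mul, Complex.norm_real, Complex.norm_real, norm_inv,
    Real.norm_of_nonneg (besselSymbol_pos α ξ).le, Real.norm_of_nonneg (rieszSymbol_nonneg α ξ),
    ← mul_assoc, ← div_eq_mul_inv]
  exact mul_le_of_le_one_left (norm_nonneg _)
    ((div_le_one (besselSymbol_pos α ξ)).2 (rieszSymbol_le_besselSymbol hα ξ))

lemma norm_lowPass_le (R : ℝ) (u : L2 N) : ‖lowPass R u‖ ≤ ‖u‖ := by
  rw [← Lp.norm_fourier_eq, ← Lp.norm_fourier_eq u]
  apply Lp.norm_le_norm_of_ae_le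
  filter_upwards [fourier_lowPass R u] with ξ h
  rw [h, norm_mul]
  apply mul_le_of_le_one_left (norm_nonneg _)
  unfold lowSymbol Set.indicator
  split_ifs <;> simp

lemma kinetic_sub_lowPass_le (α R : ℝ) (u : L2 N) :
    kinetic α (u - lowPass R u) ≤ kinetic α u := by
  apply lintegral_mono_ae
  have h0 : (𝓕 (u - lowPass R u) : L2 N) = 𝓕 u - 𝓕 (lowPass R u) :=
    (fourierCLM ℂ (L2 N)).map_sub _ _
  rw [h0]
  filter_upwards [Lp.coeFn_sub (𝓕 u : L2 N) (𝓕 (lowPass R u) : L2 N), fourier_lowPass R u]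
    with ξ h1 h2
  gcongr
  rw [h1, Pi.sub_apply, h2]
  unfold lowSymbol Set.indicator
  split_ifs <;> simp

lemma norm_sub_lowPass_le {α R : ℝ} (hα : 0 ≤ α) (hR : 0 < R) (w : L2 N) :
    ‖ofWeight α w - lowPass R (ofWeight α w)‖ ≤ R ^ (-α) * ‖w‖ := by
  have hK := enorm_gradOfWeight_sq hα w
  have h1 : ENNReal.ofReal (R ^ α) ^ 2 * ‖ofWeight α w - lowPass R (ofWeight α w)‖ₑ ^ 2
      ≤ ‖gradOfWeight α w‖ₑ ^ 2 := by
    rw [hK, enorm_sub_lowPass_sq, ← lintegral_const_mul' _ _ (by simp), kinetic,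
      ← lintegral_indicator Metric.isClosed_closedBall.measurableSet.compl]
    refine lintegral_mono fun ξ => ?_
    by_cases h : ξ ∈ (Metric.closedBall (0 : Space N) R)ᶜ
    · have hlt : R < ‖ξ‖ := by simpa using h
      rw [Set.indicator_of_mem h]
      gcongr
      apply Real.rpow_le_rpow hR.le _ hα
      nlinarith [Real.pi_gt_three]
    · rw [Set.indicator_of_notMem h]; exact zero_le
  rw [← mul_pow] at h1
  have h2 : ENNReal.ofReal (R ^ α) * ‖ofWeight α w - lowPass R (ofWeight α w)‖ₑ
      ≤ ‖gradOfWeight α w‖ₑ := (ENNReal.pow_le_pow_left_iff (by norm_num)).1 h1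
  rw [← ofReal_norm, ← ofReal_norm, ← ENNReal.ofReal_mul (by positivity),
    ENNReal.ofReal_le_ofReal_iff (norm_nonneg _)] at h2
  rw [Real.rpow_neg hR.le, inv_mul_eq_div, le_div_iff₀ (by positivity), mul_comm]
  exact h2.trans (norm_gradOfWeight_le hα w)

lemma lintegral_rpow_le_of_norm_le {q δ : ℝ} (hq : 2 < q) (hδ : 0 ≤ δ) (f : L2 N)
    (hf : ∀ᵐ x, ‖f x‖ ≤ δ) : ∫⁻ x, ‖f x‖ₑ ^ q ≤ ENNReal.ofReal (δ ^ (q - 2) * ‖f‖ ^ 2) := by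
  rw [ENNReal.ofReal_mul (by positivity), ENNReal.ofReal_pow (norm_nonneg _), ofReal_norm,
    enorm_sq_eq_lintegral, ← lintegral_const_mul' _ _ ENNReal.ofReal_ne_top]
  apply lintegral_mono_ae
  filter_upwards [hf] with x hx
  rw [enorm_rpow_eq _ (by linarith), ← ofReal_norm, ← ENNReal.ofReal_pow (norm_nonneg _),
    ← ENNReal.ofReal_mul (by positivity)]
  apply ENNReal.ofReal_le_ofReal
  rcases (norm_nonneg (f x)).eq_or_lt with h | h
  · rw [← h, Real.zero_rpow (by linarith)]; simp
  · calc ‖f x‖ ^ q = ‖f x‖ ^ (q - 2) * ‖f x‖ ^ 2 := by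
          rw [← Real.rpow_two, ← Real.rpow_add h]; ring_nf
      _ ≤ _ := by gcongr

/-- A bounded subset of `H^α` whose elements are not small in `L^q` does not vanish at low
frequencies. -/
lemma exists_le_norm_inner_lowVector (hN : 1 ≤ N) {α q : ℝ} (hα : 0 < α) (hq : 2 < q)
    (hq' : q < 2 + 4 * α / N) {M c : ℝ} (hM : 0 ≤ M) (hc : 0 < c) :
    ∃ R δ : ℝ, 0 < δ ∧ ∀ w : L2 N, ‖w‖ ≤ M → ENNReal.ofReal c ≤ ∫⁻ x, ‖ofWeight α w x‖ₑ ^ q →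
      ∃ x, δ ≤ ‖inner ℂ (lowVector R x) (𝓕 (ofWeight α w) : L2 N)‖ := by
  obtain ⟨C, hC, hGN⟩ := exists_lintegral_rpow_le_kinetic hN hq hq' one_pos
  have hq2 : 0 < q - 2 := by linarith
  -- The constant in (a + b)^q ≤ K(a^q + b^q). It suffices to bring the low and the high part each
  -- below c' = c/(2K) in L^q.
  set K : ℝ := 2 ^ (q - 1) with hK
  have hK0 : 0 < K := by positivity
  set c' := c / (2 * K) with hc'
  have hc'0 : 0 < c' := by positivity
  set B : ℝ := (1 + C.toReal) * M ^ 2 + 1 with hB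
  have hB0 : 0 < B := by positivity
  -- One number serves as the pointwise bound of the low part and as the L² bound of the high part;
  -- in both estimates it enters with the power q - 2. The summand 1 in B makes the inequality
  -- strict.
  set η : ℝ := (c' / B) ^ (1 / (q - 2)) with hη
  have hη0 : 0 < η := by positivity
  have hηq : η ^ (q - 2) = c' / B := by
    rw [hη, ← Real.rpow_mul (by positivity), one_div_mul_cancel hq2.ne', Real.rpow_one]
  have hηB : η ^ (q - 2) * ((1 + C.toReal) * M ^ 2) < c' := by
    rw [hηq, div_mul_eq_mul_div, div_lt_iff₀ hB0]; nlinarith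
  have hηM : η ^ (q - 2) * M ^ 2 < c' := by
    refine lt_of_le_of_lt ?_ hηB
    gcongr
    nlinarith [sq_nonneg M, ENNReal.toReal_nonneg (a := C)]
  set R : ℝ := ((M + 1) / η) ^ (1 / α) with hR
  have hR0 : 0 < R := by positivity
  have hRα : R ^ (-α) * M ≤ η := by
    rw [Real.rpow_neg hR0.le, hR, ← Real.rpow_mul (by positivity), one_div_mul_cancel hα.ne',
      Real.rpow_one, inv_div, div_mul_eq_mul_div, div_le_iff₀ (by positivity)]
    nlinarith
  refine ⟨R, η, hη0, fun w hw hcw => ?_⟩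
  -- If all pairings are below η, the low part is small in L^q by interpolation between L² and L^∞.
  -- The high part is small by Gagliardo–Nirenberg, its L² norm being at most R^{-α} M ≤ η.
  by_contra! hlt
  set u := ofWeight α w with hu
  set v := u - lowPass R u with hv
  have hlow : ∫⁻ x, ‖lowPass R u x‖ₑ ^ q < ENNReal.ofReal c' := by
    refine (lintegral_rpow_le_of_norm_le hq hη0.le (lowPass R u) ?_).trans_lt ?_
    · filter_upwards [coeFn_lowPass R u] with x hx
      rw [hx]; exact (hlt x).le
    · rw [ENNReal.ofReal_lt_ofReal_iff hc'0]
      refine lt_of_le_of_lt ?_ hηM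
      have := ((norm_lowPass_le R u).trans (norm_ofWeight_le hα.le w)).trans hw
      gcongr
  have hhigh : ∫⁻ x, ‖v x‖ₑ ^ q < ENNReal.ofReal c' := by
    have hvn : ‖v‖ ≤ η :=
      (norm_sub_lowPass_le hα.le hR0 w).trans (le_trans (by gcongr) hRα)
    have hvM : ‖v‖ₑ ≤ ENNReal.ofReal M := by
      rw [← enorm_fourier, ← ofReal_norm]
      apply ENNReal.ofReal_le_ofReal
      refine le_trans ?_ ((norm_ofWeight_le hα.le w).trans hw)
      rw [← Lp.norm_fourier_eq (ofWeight α w)]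
      apply Lp.norm_le_norm_of_ae_le
      have h0 : (𝓕 v : L2 N) = 𝓕 u - 𝓕 (lowPass R u) := (fourierCLM ℂ (L2 N)).map_sub _ _
      rw [h0]
      filter_upwards [Lp.coeFn_sub (𝓕 u : L2 N) (𝓕 (lowPass R u) : L2 N), fourier_lowPass R u]
        with ξ h1 h2
      rw [h1, Pi.sub_apply, h2]
      unfold lowSymbol Set.indicator
      split_ifs <;> simp [hu]
    have hkin : kinetic α v ≤ ENNReal.ofReal M ^ 2 := by
      refine (kinetic_sub_lowPass_le α R u).trans ?_
      rw [hu, ← enorm_gradOfWeight_sq hα.le, ← ofReal_norm]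
      gcongr
      exact (norm_gradOfWeight_le hα.le w).trans hw
    calc ∫⁻ x, ‖v x‖ₑ ^ q
        ≤ ‖v‖ₑ ^ (q - 2) * (ENNReal.ofReal 1 * kinetic α v + C * ‖v‖ₑ ^ 2) := hGN v
      _ ≤ ENNReal.ofReal η ^ (q - 2) *
          (ENNReal.ofReal 1 * ENNReal.ofReal M ^ 2 + C * ENNReal.ofReal M ^ 2) := by
          gcongr
          rw [← ofReal_norm]
          exact ENNReal.ofReal_le_ofReal hvn
      _ = ENNReal.ofReal (η ^ (q - 2) * ((1 + C.toReal) * M ^ 2)) := by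
          rw [← add_mul, ENNReal.ofReal_mul (by positivity), ENNReal.ofReal_mul (by positivity),
            ENNReal.ofReal_add (by norm_num) ENNReal.toReal_nonneg, ENNReal.ofReal_toReal hC,
            ENNReal.ofReal_rpow_of_nonneg hη0.le hq2.le, ENNReal.ofReal_pow hM]
      _ < _ := (ENNReal.ofReal_lt_ofReal_iff hc'0).2 hηB
  have hsum : ∫⁻ x, ‖u x‖ₑ ^ q
      ≤ ENNReal.ofReal K * ((∫⁻ x, ‖lowPass R u x‖ₑ ^ q) + ∫⁻ x, ‖v x‖ₑ ^ q) := by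
    rw [← lintegral_add_left' ((Lp.aestronglyMeasurable _).enorm.pow_const q),
      ← lintegral_const_mul' _ _ ENNReal.ofReal_ne_top]
    apply lintegral_mono_ae
    filter_upwards [Lp.coeFn_sub u (lowPass R u)] with x hx
    have h1 : ‖u x‖ₑ ≤ ‖lowPass R u x‖ₑ + ‖v x‖ₑ := by
      have : u x = lowPass R u x + v x := by rw [hv, hx, Pi.sub_apply]; ring
      rw [this]; exact enorm_add_le _ _
    calc ‖u x‖ₑ ^ q ≤ (‖lowPass R u x‖ₑ + ‖v x‖ₑ) ^ q :=
          ENNReal.rpow_le_rpow h1 (by linarith)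
      _ ≤ 2 ^ (q - 1) * (‖lowPass R u x‖ₑ ^ q + ‖v x‖ₑ ^ q) :=
          ENNReal.rpow_add_le_mul_rpow_add_rpow _ _ (by linarith)
      _ = _ := by
          rw [hK, ← ENNReal.ofReal_rpow_of_pos two_pos]; simp
  have hfin := hcw.trans hsum
  have hlt2 : ENNReal.ofReal K * ((∫⁻ x, ‖lowPass R u x‖ₑ ^ q) + ∫⁻ x, ‖v x‖ₑ ^ q)
      < ENNReal.ofReal c := by
    have h1 : ENNReal.ofReal c = ENNReal.ofReal K * (ENNReal.ofReal c' + ENNReal.ofReal c') := by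
      rw [← ENNReal.ofReal_add hc'0.le hc'0.le, ← ENNReal.ofReal_mul hK0.le]
      congr 1
      rw [hc']; field_simp; ring
    rw [h1]
    exact ENNReal.mul_lt_mul_right (by simpa using hK0) ENNReal.ofReal_ne_top
      (ENNReal.add_lt_add hlow hhigh)
  exact absurd hfin (not_le.2 hlt2)

/-! ### Weak convergence and local compactness. -/

section Weak

variable {H H' : Type*} [NormedAddCommGroup H] [InnerProductSpace ℂ H]
  [NormedAddCommGroup H'] [InnerProductSpace ℂ H']

/-- Weak convergence of a sequence in a Hilbert space. -/
def WeakTendsto (x : ℕ → H) (x₀ : H) : Prop :=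
  ∀ y, Tendsto (fun n => inner ℂ y (x n)) atTop (𝓝 (inner ℂ y x₀))

lemma WeakTendsto.comp {x : ℕ → H} {x₀ : H} (h : WeakTendsto x x₀) {φ : ℕ → ℕ}
    (hφ : StrictMono φ) : WeakTendsto (x ∘ φ) x₀ :=
  fun y => (h y).comp hφ.tendsto_atTop

lemma WeakTendsto.map [CompleteSpace H] [CompleteSpace H'] {x : ℕ → H} {x₀ : H} (h : WeakTendsto x x₀) (T : H →L[ℂ] H') :
    WeakTendsto (fun n => T (x n)) (T x₀) := by
  intro y
  simp only [← ContinuousLinearMap.adjoint_inner_left]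
  exact h _

lemma WeakTendsto.sub_const {x : ℕ → H} {x₀ : H} (h : WeakTendsto x x₀) :
    WeakTendsto (fun n => x n - x₀) 0 := by
  intro y
  simpa [inner_sub_right] using (h y).sub_const (inner ℂ y x₀)

/-- The cross term in the expansion of the square is twice the real part of a pairing with x₀, which
tends to 0. This splits masses and kinetic energies. -/
lemma WeakTendsto.norm_sq {x : ℕ → H} {x₀ : H} (h : WeakTendsto x x₀) :
    Tendsto (fun n => ‖x n‖ ^ 2 - ‖x n - x₀‖ ^ 2) atTop (𝓝 (‖x₀‖ ^ 2)) := by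
  have h1 : ∀ n, ‖x n‖ ^ 2 - ‖x n - x₀‖ ^ 2
      = ‖x₀‖ ^ 2 + 2 * RCLike.re (inner ℂ x₀ (x n - x₀)) := by
    intro n
    have := norm_add_sq (𝕜 := ℂ) x₀ (x n - x₀)
    rw [add_sub_cancel] at this
    rw [this]; ring
  simp only [h1]
  have h2 := (Complex.continuous_re.tendsto _).comp (h.sub_const x₀)
  simpa using (h2.const_mul 2).const_add (‖x₀‖ ^ 2)

/-- Sequential Banach–Alaoglu in the dual. The Riesz isomorphism is conjugate linear, hence the
complex conjugations. -/
lemma exists_weakTendsto_subseq [CompleteSpace H] [TopologicalSpace.SeparableSpace H] {x : ℕ → H} {M : ℝ}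
    (hx : ∀ n, ‖x n‖ ≤ M) : ∃ (x₀ : H) (φ : ℕ → ℕ), StrictMono φ ∧ WeakTendsto (x ∘ φ) x₀ := by
  obtain ⟨a, -, φ, hφ, ha⟩ := WeakDual.isSeqCompact_closedBall ℂ H 0 M
    (x := fun n => StrongDual.toWeakDual (InnerProductSpace.toDual ℂ H (x n)))
    (fun n => by
      rw [Set.mem_preimage, mem_closedBall_zero_iff]
      exact ((InnerProductSpace.toDual ℂ H).norm_map (x n)).le.trans (hx n))
  refine ⟨(InnerProductSpace.toDual ℂ H).symm (WeakDual.toStrongDual a), φ, hφ, fun y => ?_⟩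
  have h1 := (tendsto_iff_forall_eval_tendsto_topDualPairing.1 ha) y
  have h2 := (Complex.continuous_conj.tendsto _).comp h1
  have h3 : inner ℂ y ((InnerProductSpace.toDual ℂ H).symm (WeakDual.toStrongDual a))
      = (starRingEnd ℂ) (a y) := by
    rw [← inner_conj_symm, InnerProductSpace.toDual_symm_apply]; rfl
  rw [h3]
  refine h2.congr fun n => ?_
  exact inner_conj_symm _ _
end Weak

/-- Weak convergence in `H^α` implies convergence almost everywhere of a subsequence. -/
lemma WeakTendsto.exists_subseq_ae {α : ℝ} (hα : 0 < α) {w : ℕ → L2 N} {w₀ : L2 N}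
    (h : WeakTendsto w w₀) {M : ℝ} (hM : ∀ n, ‖w n - w₀‖ ≤ M) :
    ∃ φ : ℕ → ℕ, StrictMono φ ∧
      ∀ᵐ x, Tendsto (fun n => ofWeight α (w (φ n)) x) atTop (𝓝 (ofWeight α w₀ x)) := by
  have hM0 : 0 ≤ M := (norm_nonneg _).trans (hM 0)
  -- A positive integrable density gives a finite measure ν with the same null sets as Lebesgue
  -- measure. Convergence in L²(ν) then replaces local convergence on a sequence of balls.
  set g : Space N → ℝ≥0∞ := fun x => ENNReal.ofReal ((1 + ‖x‖) ^ (-(N + 1 : ℝ))) with hg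
  have hgm : Measurable g := by simp only [hg]; fun_prop
  have hgfin : ∫⁻ x, g x < ∞ := finite_integral_one_add_norm (by simp)
  have hg1 : ∀ x, g x ≤ 1 := fun x => by
    simp only [hg]
    rw [← ENNReal.ofReal_one]
    apply ENNReal.ofReal_le_ofReal
    exact Real.rpow_le_one_of_one_le_of_nonpos (by linarith [norm_nonneg x])
      (by have : (0 : ℝ) ≤ N := Nat.cast_nonneg N
          linarith)
  have hg0 : ∀ x, g x ≠ 0 := fun x => by
    simp only [hg, Ne, ENNReal.ofReal_eq_zero, not_le]
    positivity
  set ν : Measure (Space N) := volume.withDensity g with hν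
  have hac : (volume : Measure (Space N)) ≪ ν :=
    withDensity_absolutelyContinuous' hgm.aemeasurable (Eventually.of_forall hg0)
  have hca : ν ≪ volume := withDensity_absolutelyContinuous _ _
  set z : ℕ → L2 N := fun n => ofWeight α (w n - w₀) with hz
  have hzw : WeakTendsto (fun n => (𝓕 (z n) : L2 N)) 0 := by
    have := h.sub_const.map ((fourierCLM ℂ (L2 N)).comp (ofWeight α))
    simpa only [map_zero, ContinuousLinearMap.comp_apply, fourierCLM_apply] using this
  -- The low-frequency part tends to 0 pointwise, being a pairing of a weakly null sequence with a
  -- fixed vector, and it is uniformly bounded, so dominated convergence against g applies.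
  have hlow : ∀ R, 0 ≤ R → Tendsto (fun n => ∫⁻ x, g x * ‖lowPass R (z n) x‖ₑ ^ 2) atTop (𝓝 0) := by
    intro R hR
    have h1 := tendsto_lintegral_of_dominated_convergence' (μ := (volume : Measure (Space N)))
      (F := fun n x => g x * ‖lowPass R (z n) x‖ₑ ^ 2) (f := fun _ => 0)
      (fun x => g x * ENNReal.ofReal (lowConst N * R ^ ((N : ℝ) / 2) * M) ^ 2)
      (fun n => hgm.aemeasurable.mul ((Lp.aestronglyMeasurable _).enorm.pow_const 2))
      (fun n => by
        filter_upwards [coeFn_lowPass R (z n)] with x hx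
        rw [hx, ← ofReal_norm]
        gcongr
        refine (norm_inner_lowVector_le hR x (z n)).trans ?_
        have := lowConst_pos N
        gcongr
        exact (norm_ofWeight_le hα.le _).trans (hM n))
      (by
        rw [lintegral_mul_const' _ _ (by simp)]
        exact ENNReal.mul_ne_top hgfin.ne (by simp))
      (by
        filter_upwards [ae_all_iff.2 fun n => coeFn_lowPass R (z n)] with x hx
        simp only [hx]
        have h2 := hzw (lowVector R x)
        rw [inner_zero_right] at h2
        have h3 := h2.enorm
        simp only [enorm_zero] at h3
        have h4 := ENNReal.Tendsto.const_mul (a := g x) (ENNReal.Tendsto.pow (n := 2) h3)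
          (Or.inr ENNReal.ofReal_ne_top)
        simpa using h4)
    simpa using h1
  have hmain : Tendsto (fun n => ∫⁻ x, g x * ‖z n x‖ₑ ^ 2) atTop (𝓝 0) := by
    rw [ENNReal.tendsto_atTop_zero]
    intro ε hε
    -- The high-frequency part is at most R^{-α} M in L², uniformly in n, so R can be fixed before
    -- n.
    obtain ⟨R, hR, hRε⟩ : ∃ R : ℝ, 0 < R ∧ 2 * ENNReal.ofReal (R ^ (-α) * M) ^ 2 < ε / 2 := by
      have h1 : Tendsto (fun R : ℝ => 2 * ENNReal.ofReal (R ^ (-α) * M) ^ 2) atTop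
          (𝓝 (2 * ENNReal.ofReal (0 * M) ^ 2)) :=
        ENNReal.Tendsto.const_mul (ENNReal.Tendsto.pow (ENNReal.tendsto_ofReal
          ((tendsto_rpow_neg_atTop hα).mul_const M))) (Or.inr (by simp))
      have h2 : 2 * ENNReal.ofReal (0 * M) ^ 2 < ε / 2 := by
        simpa using hε.ne'
      obtain ⟨R, hR⟩ := ((h1.eventually (gt_mem_nhds h2)).and (eventually_gt_atTop 0)).exists
      exact ⟨R, hR.2, hR.1⟩
    have h2 := (ENNReal.tendsto_atTop_zero.1 (hlow R hR.le)) (ε / 4)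
      (ENNReal.div_pos hε.ne' (by norm_num))
    obtain ⟨n₀, hn₀⟩ := h2
    refine ⟨n₀, fun n hn => ?_⟩
    have hhigh : ∫⁻ x, g x * ‖(z n - lowPass R (z n)) x‖ₑ ^ 2
        ≤ ENNReal.ofReal (R ^ (-α) * M) ^ 2 := by
      calc ∫⁻ x, g x * ‖(z n - lowPass R (z n)) x‖ₑ ^ 2
          ≤ ∫⁻ x, 1 * ‖(z n - lowPass R (z n)) x‖ₑ ^ 2 := by
            gcongr with x; exact hg1 x
        _ = ‖z n - lowPass R (z n)‖ₑ ^ 2 := by simp [enorm_sq_eq_lintegral]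
        _ ≤ _ := by
            rw [← ofReal_norm]
            gcongr
            refine (norm_sub_lowPass_le hα.le hR _).trans ?_
            have := hM n
            gcongr
    calc ∫⁻ x, g x * ‖z n x‖ₑ ^ 2
        ≤ ∫⁻ x, (2 * (g x * ‖lowPass R (z n) x‖ₑ ^ 2)
            + 2 * (g x * ‖(z n - lowPass R (z n)) x‖ₑ ^ 2)) := by
          apply lintegral_mono_ae
          filter_upwards [Lp.coeFn_sub (z n) (lowPass R (z n))] with x hx
          have h3 : ‖z n x‖ₑ ≤ ‖lowPass R (z n) x‖ₑ + ‖(z n - lowPass R (z n)) x‖ₑ := by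
            have : z n x = lowPass R (z n) x + (z n - lowPass R (z n)) x := by
              rw [hx, Pi.sub_apply]; ring
            nth_rewrite 1 [this]; exact enorm_add_le _ _
          calc g x * ‖z n x‖ₑ ^ 2
              ≤ g x * (2 * (‖lowPass R (z n) x‖ₑ ^ 2 + ‖(z n - lowPass R (z n)) x‖ₑ ^ 2)) := by
                gcongr
                refine (pow_le_pow_left' h3 2).trans ?_
                have := ENNReal.rpow_add_le_mul_rpow_add_rpow ‖lowPass R (z n) x‖ₑ
                  ‖(z n - lowPass R (z n)) x‖ₑ (p := 2) (by norm_num)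
                norm_num at this
                exact this
            _ = _ := by ring
      _ = 2 * (∫⁻ x, g x * ‖lowPass R (z n) x‖ₑ ^ 2)
            + 2 * (∫⁻ x, g x * ‖(z n - lowPass R (z n)) x‖ₑ ^ 2) := by
          have hm : AEMeasurable (fun x => 2 * (g x * ‖lowPass R (z n) x‖ₑ ^ 2)) volume :=
            (hgm.aemeasurable.mul ((Lp.aestronglyMeasurable _).enorm.pow_const 2)).const_mul _
          rw [lintegral_add_left' hm, lintegral_const_mul' _ _ (by simp), lintegral_const_mul' _ _ (by simp)]
      _ ≤ 2 * (ε / 4) + 2 * ENNReal.ofReal (R ^ (-α) * M) ^ 2 := by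
          gcongr
          exact hn₀ n hn
      _ ≤ ε / 2 + ε / 2 := by
          gcongr
          rw [← mul_div_assoc, show (4 : ℝ≥0∞) = 2 * 2 by norm_num,
            ENNReal.mul_div_mul_left _ _ (by norm_num) (by norm_num)]
      _ = ε := ENNReal.add_halves ε
  have hmeas : TendstoInMeasure ν (fun n => (ofWeight α (w n) : Space N → ℂ)) atTop
      (ofWeight α w₀) := by
    refine tendstoInMeasure_of_tendsto_eLpNorm (p := 2) (by norm_num)
      (fun n => (Lp.aestronglyMeasurable _).mono_ac hca)
      ((Lp.aestronglyMeasurable _).mono_ac hca) ?_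
    have h1 : ∀ n, eLpNorm ((ofWeight α (w n) : Space N → ℂ) - (ofWeight α w₀ : Space N → ℂ)) 2 ν
        = (∫⁻ x, g x * ‖z n x‖ₑ ^ 2) ^ (1 / 2 : ℝ) := by
      intro n
      rw [eLpNorm_eq_lintegral_rpow_enorm_toReal (by norm_num) (by norm_num), hν,
        lintegral_withDensity_eq_lintegral_mul₀ hgm.aemeasurable]
      · congr 1
        apply lintegral_congr_ae
        have hzn : z n = ofWeight α (w n) - ofWeight α w₀ := map_sub _ _ _
        rw [hzn]
        filter_upwards [Lp.coeFn_sub (ofWeight α (w n)) (ofWeight α w₀)] with x hx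
        rw [hx]; simp
      · exact (((Lp.aestronglyMeasurable _).sub (Lp.aestronglyMeasurable _)).enorm.pow_const _)
    simp only [h1]
    have h2 := hmain.ennrpow_const (1 / 2 : ℝ)
    simpa using h2
  obtain ⟨φ, hφ, hae⟩ := hmeas.exists_seq_tendsto_ae
  exact ⟨φ, hφ, hac.ae_le hae⟩
end
end FractionalNLS

/-! ### Integral bounds for the sum of subcritical powers. -/

namespace FractionalNLS
noncomputable section
variable {N : ℕ}

lemma lintegral_ofReal_norm_rpow (f : L2 N) {q : ℝ} (hq : 0 ≤ q) :
    ∫⁻ x, ENNReal.ofReal (‖f x‖ ^ q) = ∫⁻ x, ‖f x‖ₑ ^ q := by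
  simp only [enorm_rpow_eq _ hq]

lemma aestronglyMeasurable_norm_rpow (f : L2 N) (q : ℝ) :
    AEStronglyMeasurable (fun x => ‖f x‖ ^ q) volume :=
  ((Lp.aestronglyMeasurable f).norm.aemeasurable.pow_const q).aestronglyMeasurable

lemma exists_integral_rpow_le (hN : 1 ≤ N) {α q : ℝ} (hα : 0 < α) (hq : 2 < q)
    (hq' : q < 2 + 4 * α / N) {ε : ℝ} (hε : 0 < ε) :
    ∃ C : ℝ, 0 ≤ C ∧ ∀ w : L2 N, Integrable (fun x => ‖ofWeight α w x‖ ^ q) ∧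
      ∫ x, ‖ofWeight α w x‖ ^ q ≤ ‖ofWeight α w‖ ^ (q - 2) *
        (ε * ‖gradOfWeight α w‖ ^ 2 + C * ‖ofWeight α w‖ ^ 2) := by
  obtain ⟨C, hC, h⟩ := exists_lintegral_rpow_le_kinetic hN hq hq' hε
  have hq2 : 0 ≤ q - 2 := by linarith
  refine ⟨C.toReal, ENNReal.toReal_nonneg, fun w => ?_⟩
  have h1 := h (ofWeight α w)
  rw [← enorm_gradOfWeight_sq hα.le, ← lintegral_ofReal_norm_rpow _ (by linarith)] at h1
  have h2 : ‖ofWeight α w‖ₑ ^ (q - 2) * (ENNReal.ofReal ε * ‖gradOfWeight α w‖ₑ ^ 2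
      + C * ‖ofWeight α w‖ₑ ^ 2) = ENNReal.ofReal (‖ofWeight α w‖ ^ (q - 2) *
        (ε * ‖gradOfWeight α w‖ ^ 2 + C.toReal * ‖ofWeight α w‖ ^ 2)) := by
    rw [ENNReal.ofReal_mul (by positivity), ENNReal.ofReal_add (by positivity) (by positivity),
      ENNReal.ofReal_mul hε.le, ENNReal.ofReal_mul ENNReal.toReal_nonneg, ENNReal.ofReal_toReal hC,
      ENNReal.ofReal_pow (norm_nonneg _), ENNReal.ofReal_pow (norm_nonneg _), ofReal_norm,
      ofReal_norm, enorm_rpow_eq _ hq2]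
  rw [h2] at h1
  have hnn : ∀ x, 0 ≤ ‖ofWeight α w x‖ ^ q := fun x => by positivity
  have hi : Integrable (fun x => ‖ofWeight α w x‖ ^ q) := by
    refine ⟨aestronglyMeasurable_norm_rpow _ q, ?_⟩
    rw [hasFiniteIntegral_iff_ofReal (Eventually.of_forall hnn)]
    exact h1.trans_lt ENNReal.ofReal_lt_top
  refine ⟨hi, ?_⟩
  rw [← ofReal_integral_eq_lintegral_ofReal hi (Eventually.of_forall hnn)] at h1
  rwa [ENNReal.ofReal_le_ofReal_iff (by positivity)] at h1

/-- The sum of the powers `|zⱼ|^{qᵢ}`. -/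
def powerSum (q : Fin 3 → ℝ) (z : Fin 2 → ℂ) : ℝ := ∑ i, ∑ j, ‖z j‖ ^ q i

lemma powerSum_nonneg (q : Fin 3 → ℝ) (z : Fin 2 → ℂ) : 0 ≤ powerSum q z :=
  Finset.sum_nonneg fun i _ => Finset.sum_nonneg fun j _ => by positivity

/-- The function `x ↦ (u₁(x), u₂(x))` of the pair with weights `w₁`, `w₂`. -/
def pairVal (α : ℝ) (w : Fin 2 → L2 N) (x : Space N) : Fin 2 → ℂ := fun j => ofWeight α (w j) x

lemma aestronglyMeasurable_pairVal (α : ℝ) (w : Fin 2 → L2 N) :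
    AEStronglyMeasurable (pairVal α w) volume :=
  (aemeasurable_pi_lambda _ fun _ => (Lp.aestronglyMeasurable _).aemeasurable).aestronglyMeasurable

lemma pairVal_sub (α : ℝ) (w v : Fin 2 → L2 N) :
    pairVal α (w - v) =ᵐ[volume] fun x => pairVal α w x - pairVal α v x := by
  have h : ∀ j, ∀ᵐ x, ofWeight α ((w - v) j) x = ofWeight α (w j) x - ofWeight α (v j) x := by
    intro j
    rw [Pi.sub_apply, map_sub]
    exact Lp.coeFn_sub _ _
  filter_upwards [ae_all_iff.2 h] with x hx
  ext j
  exact hx j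

/-- Exponents in the subcritical range. -/
def Subcritical (N : ℕ) (α : ℝ) (q : Fin 3 → ℝ) : Prop :=
  ∀ i, 2 < q i ∧ q i < 2 + 4 * α / N

section

variable {α : ℝ} {q : Fin 3 → ℝ}

lemma integrable_powerSum (hN : 1 ≤ N) (hα : 0 < α) (hq : Subcritical N α q)
    (w : Fin 2 → L2 N) : Integrable (fun x => powerSum q (pairVal α w x)) := by
  refine integrable_finsetSum _ fun i _ => integrable_finsetSum _ fun j _ => ?_
  obtain ⟨C, -, hC⟩ := exists_integral_rpow_le hN hα (hq i).1 (hq i).2 one_pos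
  exact (hC (w j)).1

lemma integral_powerSum (hN : 1 ≤ N) (hα : 0 < α) (hq : Subcritical N α q)
    (w : Fin 2 → L2 N) : ∫ x, powerSum q (pairVal α w x)
      = ∑ i, ∑ j, ∫ x, ‖ofWeight α (w j) x‖ ^ q i := by
  have h : ∀ i j, Integrable (fun x => ‖ofWeight α (w j) x‖ ^ q i) := fun i j => by
    obtain ⟨C, -, hC⟩ := exists_integral_rpow_le hN hα (hq i).1 (hq i).2 one_pos
    exact (hC (w j)).1
  simp only [powerSum, pairVal]
  rw [integral_finsetSum _ fun i _ => integrable_finsetSum _ fun j _ => h i j]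
  exact Finset.sum_congr rfl fun i _ => integral_finsetSum _ fun j _ => h i j

/-- For bounded masses the powers cost only a small multiple of the kinetic energy; this is the
source of coercivity. The smallness is divided among the three exponents and absorbs the mass factor
A^(q i - 2). -/
lemma exists_integral_powerSum_le_kinetic (hN : 1 ≤ N) (hα : 0 < α) (hq : Subcritical N α q)
    {A ε : ℝ} (hA : 0 ≤ A) (hε : 0 < ε) : ∃ C : ℝ, 0 ≤ C ∧ ∀ w : Fin 2 → L2 N,
      (∀ j, ‖ofWeight α (w j)‖ ≤ A) →
      ∫ x, powerSum q (pairVal α w x) ≤ ε * ∑ j, ‖gradOfWeight α (w j)‖ ^ 2 + C := by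
  have hq2 : ∀ i, 0 ≤ q i - 2 := fun i => by linarith [(hq i).1]
  have hε' : ∀ i, 0 < ε / (3 * (A ^ (q i - 2) + 1)) := fun i => by positivity
  choose C hC0 hC using fun i =>
    exists_integral_rpow_le hN hα (hq i).1 (hq i).2 (hε' i)
  refine ⟨∑ i, ∑ _j : Fin 2, A ^ (q i - 2) * (C i * A ^ 2),
    Finset.sum_nonneg fun i _ => Finset.sum_nonneg fun j _ => by have := hC0 i; positivity,
    fun w hw => ?_⟩
  rw [integral_powerSum hN hα hq]
  have key : ∀ i j, ∫ x, ‖ofWeight α (w j) x‖ ^ q i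
      ≤ ε / 3 * ‖gradOfWeight α (w j)‖ ^ 2 + A ^ (q i - 2) * (C i * A ^ 2) := by
    intro i j
    refine ((hC i) (w j)).2.trans ?_
    have := hC0 i
    have h1 : ‖ofWeight α (w j)‖ ^ (q i - 2) ≤ A ^ (q i - 2) :=
      Real.rpow_le_rpow (norm_nonneg _) (hw j) (hq2 i)
    have h2 : A ^ (q i - 2) * (ε / (3 * (A ^ (q i - 2) + 1))) ≤ ε / 3 := by
      rw [mul_div_assoc', div_le_div_iff₀ (by positivity) (by positivity)]
      nlinarith [show 0 ≤ A ^ (q i - 2) by positivity]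
    calc ‖ofWeight α (w j)‖ ^ (q i - 2) * (ε / (3 * (A ^ (q i - 2) + 1))
          * ‖gradOfWeight α (w j)‖ ^ 2 + C i * ‖ofWeight α (w j)‖ ^ 2)
        ≤ A ^ (q i - 2) * (ε / (3 * (A ^ (q i - 2) + 1))
          * ‖gradOfWeight α (w j)‖ ^ 2 + C i * A ^ 2) := by
          gcongr
          exact hw j
      _ = A ^ (q i - 2) * (ε / (3 * (A ^ (q i - 2) + 1))) * ‖gradOfWeight α (w j)‖ ^ 2
          + A ^ (q i - 2) * (C i * A ^ 2) := by ring
      _ ≤ _ := by gcongr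
  refine (Finset.sum_le_sum fun i _ => Finset.sum_le_sum fun j _ => key i j).trans (le_of_eq ?_)
  simp only [Finset.sum_add_distrib, ← Finset.mul_sum]
  simp
  ring

/-- On a bounded set of H^α the powers are controlled by a positive power of the L² norms, so
smallness in L² already implies smallness in L^q. -/
lemma exists_integral_powerSum_le (hN : 1 ≤ N) (hα : 0 < α) (hq : Subcritical N α q)
    {M : ℝ} : ∃ C : ℝ, 0 ≤ C ∧ ∀ w : Fin 2 → L2 N, (∀ j, ‖w j‖ ≤ M) →
      ∫ x, powerSum q (pairVal α w x) ≤ C * ∑ i, ∑ j, ‖ofWeight α (w j)‖ ^ (q i - 2) := by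
  choose C hC0 hC using fun i =>
    exists_integral_rpow_le hN hα (hq i).1 (hq i).2 one_pos
  refine ⟨∑ i, (1 * M ^ 2 + C i * M ^ 2),
    Finset.sum_nonneg fun i _ => by have := hC0 i; positivity, fun w hw => ?_⟩
  rw [integral_powerSum hN hα hq, Finset.mul_sum]
  refine Finset.sum_le_sum fun i _ => ?_
  rw [Finset.mul_sum]
  refine Finset.sum_le_sum fun j _ => ?_
  refine ((hC i) (w j)).2.trans ?_
  rw [mul_comm]
  have := hC0 i
  have h1 : 1 * ‖gradOfWeight α (w j)‖ ^ 2 + C i * ‖ofWeight α (w j)‖ ^ 2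
      ≤ 1 * M ^ 2 + C i * M ^ 2 := by
    gcongr
    · exact (norm_gradOfWeight_le hα.le _).trans (hw j)
    · exact (norm_ofWeight_le hα.le _).trans (hw j)
  have h2 : 1 * M ^ 2 + C i * M ^ 2 ≤ ∑ i, (1 * M ^ 2 + C i * M ^ 2) :=
    Finset.single_le_sum (f := fun i => 1 * M ^ 2 + C i * M ^ 2)
      (fun i _ => by have := hC0 i; positivity) (Finset.mem_univ i)
  gcongr
  exact h1.trans h2

lemma tendsto_integral_powerSum (hN : 1 ≤ N) (hα : 0 < α) (hq : Subcritical N α q)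
    {M : ℝ} {w : ℕ → Fin 2 → L2 N} (hw : ∀ n j, ‖w n j‖ ≤ M)
    (h0 : ∀ j, Tendsto (fun n => ‖ofWeight α (w n j)‖) atTop (𝓝 0)) :
    Tendsto (fun n => ∫ x, powerSum q (pairVal α (w n) x)) atTop (𝓝 0) := by
  obtain ⟨C, hC0, hC⟩ := exists_integral_powerSum_le hN hα hq (M := M)
  refine squeeze_zero (fun n => integral_nonneg fun x => powerSum_nonneg _ _)
    (fun n => hC (w n) (hw n)) ?_
  have h1 : Tendsto (fun n => C * ∑ i, ∑ j, ‖ofWeight α (w n j)‖ ^ (q i - 2)) atTop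
      (𝓝 (C * ∑ i : Fin 3, ∑ _j : Fin 2, (0 : ℝ) ^ (q i - 2))) := by
    refine Tendsto.const_mul _ (tendsto_finsetSum _ fun i _ => tendsto_finsetSum _ fun j _ => ?_)
    exact (h0 j).rpow_const (Or.inr (by linarith [(hq i).1]))
  have h2 : ∑ i : Fin 3, ∑ _j : Fin 2, (0 : ℝ) ^ (q i - 2) = 0 :=
    Finset.sum_eq_zero fun i _ => Finset.sum_eq_zero fun j _ =>
      Real.zero_rpow (by linarith [(hq i).1])
  rwa [h2, mul_zero] at h1

lemma exists_integral_powerSum_bound (hN : 1 ≤ N) (hα : 0 < α) (hq : Subcritical N α q)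
    (M : ℝ) : ∃ C : ℝ, 0 ≤ C ∧ ∀ w : Fin 2 → L2 N, (∀ j, ‖w j‖ ≤ M) →
      ∫ x, powerSum q (pairVal α w x) ≤ C := by
  obtain ⟨C, hC0, hC⟩ := exists_integral_powerSum_le hN hα hq (M := M)
  by_cases hM : 0 ≤ M
  · refine ⟨C * ∑ i, ∑ _j : Fin 2, M ^ (q i - 2), mul_nonneg hC0 (Finset.sum_nonneg fun i _ =>
      Finset.sum_nonneg fun j _ => by positivity), fun w hw => (hC w hw).trans ?_⟩
    gcongr with i _ j _
    · linarith [(hq i).1]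
    · exact (norm_ofWeight_le hα.le _).trans (hw j)
  · exact ⟨0, le_rfl, fun w hw => absurd ((norm_nonneg _).trans (hw 0)) hM⟩

/-! ### Controlled nonlinearities and the Brezis–Lieb lemma. -/

/-- A continuous nonlinearity which is controlled by `powerSum q`. -/
structure IsControlled (q : Fin 3 → ℝ) (G : (Fin 2 → ℂ) → ℝ) : Prop where
  continuous : Continuous G
  map_zero : G 0 = 0
  bound : ∀ ε : ℝ, 0 < ε → ∃ C : ℝ, 0 ≤ C ∧ ∀ a b,
    |G (a + b) - G a| ≤ ε * powerSum q a + C * powerSum q b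

variable {G : (Fin 2 → ℂ) → ℝ}

lemma powerSum_zero (hq : Subcritical N α q) : powerSum q 0 = 0 :=
  Finset.sum_eq_zero fun i _ => Finset.sum_eq_zero fun j _ => by
    simpa using Real.zero_rpow (by linarith [(hq i).1] : q i ≠ 0)

/-- The case a = 0 of the increment bound. -/
lemma IsControlled.exists_abs_le (hG : IsControlled q G) (hq : Subcritical N α q) :
    ∃ C : ℝ, 0 ≤ C ∧ ∀ a, |G a| ≤ C * powerSum q a := by
  obtain ⟨C, hC0, hC⟩ := hG.bound 1 one_pos
  refine ⟨C, hC0, fun a => ?_⟩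
  simpa [hG.map_zero, powerSum_zero hq] using hC 0 a

lemma IsControlled.integrable (hG : IsControlled q G) (hN : 1 ≤ N) (hα : 0 < α)
    (hq : Subcritical N α q) (w : Fin 2 → L2 N) : Integrable (fun x => G (pairVal α w x)) := by
  obtain ⟨C, hC0, hC⟩ := hG.exists_abs_le hq
  exact ((integrable_powerSum hN hα hq w).const_mul C).mono'
    (hG.continuous.comp_aestronglyMeasurable (aestronglyMeasurable_pairVal α w))
    (Eventually.of_forall fun x => hC _)

/-- The small constant falls on the bounded sequence v and the large one on the difference, whose
integral tends to 0. -/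
lemma IsControlled.tendsto_sub (hG : IsControlled q G) (hN : 1 ≤ N) (hα : 0 < α)
    (hq : Subcritical N α q) {M : ℝ} {w v : ℕ → Fin 2 → L2 N} (hv : ∀ n j, ‖v n j‖ ≤ M)
    (h : Tendsto (fun n => ∫ x, powerSum q (pairVal α (w n - v n) x)) atTop (𝓝 0)) :
    Tendsto (fun n => (∫ x, G (pairVal α (w n) x)) - ∫ x, G (pairVal α (v n) x)) atTop (𝓝 0) := by
  obtain ⟨B, hB0, hB⟩ := exists_integral_powerSum_bound hN hα hq M
  rw [Metric.tendsto_atTop]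
  intro ε hε
  obtain ⟨C, hC0, hC⟩ := hG.bound (ε / (2 * (B + 1))) (by positivity)
  have h2 : Tendsto (fun n => C * ∫ x, powerSum q (pairVal α (w n - v n) x)) atTop (𝓝 0) := by
    simpa using h.const_mul C
  obtain ⟨n₀, hn₀⟩ := eventually_atTop.1 (h2.eventually (gt_mem_nhds (half_pos hε)))
  refine ⟨n₀, fun n hn => ?_⟩
  rw [dist_zero_right, ← integral_sub (hG.integrable hN hα hq _) (hG.integrable hN hα hq _)]
  have h3 : ‖∫ x, (G (pairVal α (w n) x) - G (pairVal α (v n) x))‖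
      ≤ ∫ x, (ε / (2 * (B + 1)) * powerSum q (pairVal α (v n) x)
          + C * powerSum q (pairVal α (w n - v n) x)) := by
    refine norm_integral_le_of_norm_le (((integrable_powerSum hN hα hq _).const_mul _).add
      ((integrable_powerSum hN hα hq _).const_mul _)) ?_
    filter_upwards [pairVal_sub α (w n) (v n)] with x hx
    have h4 := hC (pairVal α (v n) x) (pairVal α (w n - v n) x)
    rw [hx, add_sub_cancel] at h4
    rw [hx]
    exact h4
  rw [integral_add ((integrable_powerSum hN hα hq _).const_mul _)
      ((integrable_powerSum hN hα hq _).const_mul _), integral_const_mul, integral_const_mul] at h3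
  have h5 : ε / (2 * (B + 1)) * ∫ x, powerSum q (pairVal α (v n) x) ≤ ε / 2 := by
    calc ε / (2 * (B + 1)) * ∫ x, powerSum q (pairVal α (v n) x)
        ≤ ε / (2 * (B + 1)) * B := by gcongr; exact hB _ (hv n)
      _ ≤ _ := by
        rw [div_mul_eq_mul_div, div_le_div_iff₀ (by positivity) (by positivity)]
        nlinarith
  linarith [hn₀ n hn]

/-- The Brezis–Lieb lemma. -/
lemma IsControlled.brezis_lieb (hG : IsControlled q G) (hN : 1 ≤ N) (hα : 0 < α)
    (hq : Subcritical N α q) {M : ℝ} {w : ℕ → Fin 2 → L2 N} {w₀ : Fin 2 → L2 N}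
    (hM : ∀ n j, ‖w n j - w₀ j‖ ≤ M)
    (hae : ∀ j, ∀ᵐ x, Tendsto (fun n => ofWeight α (w n j) x) atTop (𝓝 (ofWeight α (w₀ j) x))) :
    Tendsto (fun n => (∫ x, G (pairVal α (w n) x)) - ∫ x, G (pairVal α (w n - w₀) x)) atTop
      (𝓝 (∫ x, G (pairVal α w₀ x))) := by
  obtain ⟨B, hB0, hB⟩ := exists_integral_powerSum_bound hN hα hq M
  obtain ⟨K, hK0, hK⟩ := hG.exists_abs_le hq
  rw [Metric.tendsto_atTop]
  intro ε hε
  set η : ℝ := ε / (2 * (B + 1)) with hη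
  have hη0 : 0 < η := by positivity
  obtain ⟨C, hC0, hC⟩ := hG.bound η hη0
  set D : ℕ → Space N → ℝ := fun n x =>
    |G (pairVal α (w n) x) - G (pairVal α (w n - w₀) x) - G (pairVal α w₀ x)| with hD
  -- After removal of η times the powers of the remainder, the increment bound dominates the defect
  -- D by a fixed integrable multiple of the powers of w₀. Hence Z tends to 0 in L¹, and the removed
  -- part is at most η B.
  set Z : ℕ → Space N → ℝ := fun n x => max (D n x - η * powerSum q (pairVal α (w n - w₀) x)) 0
    with hZ
  have hP : ∀ v : Fin 2 → L2 N, Integrable (fun x => powerSum q (pairVal α v x)) :=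
    integrable_powerSum hN hα hq
  have hGi : ∀ v : Fin 2 → L2 N, Integrable (fun x => G (pairVal α v x)) :=
    hG.integrable hN hα hq
  have hDi : ∀ n, Integrable (D n) := fun n => (((hGi _).sub (hGi _)).sub (hGi _)).abs
  have hsub : ∀ n, ∀ᵐ x, pairVal α (w n - w₀) x = pairVal α (w n) x - pairVal α w₀ x :=
    fun n => pairVal_sub α (w n) w₀
  have hZi : ∀ n, Integrable (Z n) := fun n => ((hDi n).sub ((hP _).const_mul η)).pos_part
  have hZ0 : Tendsto (fun n => ∫ x, Z n x) atTop (𝓝 (∫ _x : Space N, (0 : ℝ))) := by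
    refine tendsto_integral_of_dominated_convergence
      (fun x => (C + K) * powerSum q (pairVal α w₀ x))
      (fun n => (hZi n).aestronglyMeasurable) ((hP w₀).const_mul _) ?_ ?_
    · intro n
      filter_upwards [hsub n] with x hx
      have h1 := hC (pairVal α (w n - w₀) x) (pairVal α w₀ x)
      have h2 := hK (pairVal α w₀ x)
      rw [hx, sub_add_cancel] at h1
      have h3 : D n x ≤ |G (pairVal α (w n) x) - G (pairVal α (w n) x - pairVal α w₀ x)|
          + |G (pairVal α w₀ x)| := by
        simp only [hD]
        rw [hx]
        exact abs_sub _ _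
      simp only [hZ]
      rw [Real.norm_of_nonneg (le_max_right _ _), hx]
      have h4 := powerSum_nonneg q (pairVal α w₀ x)
      exact max_le (by linarith) (by positivity)
    · filter_upwards [ae_all_iff.2 hae, ae_all_iff.2 hsub] with x hx hs
      have h1 : Tendsto (fun n => pairVal α (w n) x) atTop (𝓝 (pairVal α w₀ x)) :=
        tendsto_pi_nhds.2 hx
      have h2 : Tendsto (fun n => pairVal α (w n - w₀) x) atTop (𝓝 0) := by
        simp only [hs]
        simpa using h1.sub_const (pairVal α w₀ x)
      have h3 : Tendsto (fun n => D n x) atTop (𝓝 0) := by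
        have := (((hG.continuous.tendsto _).comp h1).sub ((hG.continuous.tendsto _).comp h2)).sub_const
          (G (pairVal α w₀ x))
        rw [hG.map_zero, sub_zero, sub_self] at this
        simpa [hD] using this.abs
      refine squeeze_zero (fun n => le_max_right _ _) (fun n => ?_) h3
      have h4 := powerSum_nonneg q (pairVal α (w n - w₀) x)
      exact max_le (by nlinarith) (abs_nonneg _)
  simp only [integral_zero] at hZ0
  obtain ⟨n₀, hn₀⟩ := eventually_atTop.1 (hZ0.eventually (gt_mem_nhds (half_pos hε)))
  refine ⟨n₀, fun n hn => ?_⟩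
  have hi : Integrable (fun x => G (pairVal α (w n) x) - G (pairVal α (w n - w₀) x)) :=
    (hGi _).sub (hGi _)
  rw [Real.dist_eq, ← integral_sub (hGi _) (hGi _), ← integral_sub hi (hGi _)]
  calc |∫ x, (G (pairVal α (w n) x) - G (pairVal α (w n - w₀) x) - G (pairVal α w₀ x))|
      ≤ ∫ x, D n x := abs_integral_le_integral_abs
    _ ≤ ∫ x, (Z n x + η * powerSum q (pairVal α (w n - w₀) x)) := by
        refine integral_mono (hDi n) ((hZi n).add ((hP _).const_mul η)) fun x => ?_
        have := le_max_left (D n x - η * powerSum q (pairVal α (w n - w₀) x)) 0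
        simp only [hZ]
        linarith
    _ = (∫ x, Z n x) + η * ∫ x, powerSum q (pairVal α (w n - w₀) x) := by
        rw [integral_add (hZi n) ((hP _).const_mul η), integral_const_mul]
    _ < ε / 2 + ε / 2 := by
        apply add_lt_add_of_lt_of_le (hn₀ n hn)
        calc η * ∫ x, powerSum q (pairVal α (w n - w₀) x) ≤ η * B := by
              gcongr; exact hB _ (hM n)
          _ ≤ _ := by
            rw [hη, div_mul_eq_mul_div, div_le_div_iff₀ (by positivity) (by positivity)]
            nlinarith
    _ = ε := add_halves ε

/-! ### Extraction of a nonzero profile. -/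

/-- Translation of a pair, on the level of the weights. -/
def shift (y : Space N) (w : Fin 2 → L2 N) : Fin 2 → L2 N := fun j => mulCLM (charSymbol y) (w j)

/-- A bounded sequence which does not vanish in `L^q` has a nonzero weak limit after
translation. -/
lemma exists_shift_weakTendsto (hN : 1 ≤ N) (hα : 0 < α) (hq : Subcritical N α q) {M c : ℝ}
    {w : ℕ → Fin 2 → L2 N} (hM : ∀ n j, ‖w n j‖ ≤ M) (hc : 0 < c)
    (h : ∀ n, c ≤ ∫ x, powerSum q (pairVal α (w n) x)) :
    ∃ (φ : ℕ → ℕ) (y : ℕ → Space N) (w₀ : Fin 2 → L2 N), StrictMono φ ∧ w₀ ≠ 0 ∧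
      (∀ j, WeakTendsto (fun n => shift (y n) (w (φ n)) j) (w₀ j)) ∧
      (∀ j, ∀ᵐ x, Tendsto (fun n => ofWeight α (shift (y n) (w (φ n)) j) x) atTop
        (𝓝 (ofWeight α (w₀ j) x))) := by
  have hM0 : 0 ≤ M := (norm_nonneg _).trans (hM 0 0)
  -- Pigeonhole: one of the six powers carries at least a sixth of the integral infinitely often.
  have hpig : ∃ ij : Fin 3 × Fin 2, ∃ᶠ n in atTop,
      c / 6 ≤ ∫ x, ‖ofWeight α (w n ij.2) x‖ ^ q ij.1 := by
    by_contra! hcon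
    have hcon' : ∀ᶠ n in atTop, ∀ ij : Fin 3 × Fin 2,
        ∫ x, ‖ofWeight α (w n ij.2) x‖ ^ q ij.1 < c / 6 := by
      refine eventually_all.2 fun ij => ?_
      simpa using! hcon ij
    obtain ⟨n, hn⟩ := hcon'.exists
    have h1 := h n
    rw [integral_powerSum hN hα hq, ← Finset.sum_product'] at h1
    have h2 := Finset.sum_lt_sum_of_nonempty (s := (Finset.univ : Finset (Fin 3 × Fin 2)))
      (by simp) (fun ij _ => hn ij)
    simp at h2
    simp at h1
    linarith
  obtain ⟨⟨i, j⟩, hij⟩ := hpig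
  obtain ⟨φ₁, hφ₁, h1⟩ := extraction_of_frequently_atTop hij
  obtain ⟨R, δ, hδ, hR⟩ := exists_le_norm_inner_lowVector hN hα (hq i).1 (hq i).2 hM0
    (c := c / 6) (by positivity)
  have h2 : ∀ n, ∃ x, δ ≤ ‖inner ℂ (lowVector R x) (𝓕 (ofWeight α (w (φ₁ n) j)) : L2 N)‖ := by
    intro n
    refine hR _ (hM _ _) ?_
    obtain ⟨C, -, hC⟩ := exists_integral_rpow_le hN hα (hq i).1 (hq i).2 one_pos
    rw [← lintegral_ofReal_norm_rpow _ (by linarith [(hq i).1]),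
      ← ofReal_integral_eq_lintegral_ofReal (hC _).1 (Eventually.of_forall fun x => by positivity)]
    exact ENNReal.ofReal_le_ofReal (h1 n)
  -- The points where the low-frequency part has modulus at least δ; translation by y n moves them
  -- to the origin.
  choose y hy using h2
  have hb : ∀ n k, ‖shift (y n) (w (φ₁ n)) k‖ ≤ M := fun n k => by
    rw [shift, norm_mulCLM_charSymbol]; exact hM _ _
  have : Fact ((2 : ℝ≥0∞) ≠ ∞) := ⟨by norm_num⟩
  obtain ⟨a, φ₂, hφ₂, ha⟩ := exists_weakTendsto_subseq (fun n => hb n 0)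
  obtain ⟨b, φ₃, hφ₃, hb'⟩ := exists_weakTendsto_subseq (fun n => hb (φ₂ n) 1)
  have hw1 : ∀ k, WeakTendsto (fun n => shift (y (φ₂ (φ₃ n))) (w (φ₁ (φ₂ (φ₃ n)))) k)
      ((![a, b] : Fin 2 → L2 N) k) := by
    intro k
    fin_cases k
    · exact ha.comp hφ₃
    · exact hb'
  have hbd : ∀ n k, ‖shift (y (φ₂ (φ₃ n))) (w (φ₁ (φ₂ (φ₃ n)))) k - (![a, b] : Fin 2 → L2 N) k‖
      ≤ M + ‖(![a, b] : Fin 2 → L2 N) k‖ := fun n k =>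
    (norm_sub_le _ _).trans (by gcongr; exact hb _ _)
  obtain ⟨φ₄, hφ₄, h4⟩ := (hw1 0).exists_subseq_ae hα (fun n => hbd n 0)
  obtain ⟨φ₅, hφ₅, h5⟩ := ((hw1 1).comp hφ₄).exists_subseq_ae hα (fun n => hbd (φ₄ n) 1)
  refine ⟨φ₁ ∘ φ₂ ∘ φ₃ ∘ φ₄ ∘ φ₅, y ∘ φ₂ ∘ φ₃ ∘ φ₄ ∘ φ₅, ![a, b],
    hφ₁.comp (hφ₂.comp (hφ₃.comp (hφ₄.comp hφ₅))), ?_, ?_, ?_⟩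
  -- The pairing of the translated function with `lowVector R 0` equals the pairing of the original
  -- one with `lowVector R (y n)`. Its modulus is at least δ and passes to the weak limit, which is
  -- therefore nonzero.
  · intro h0
    have h6 := (((hw1 j).map ((fourierCLM ℂ (L2 N)).comp (ofWeight α)))) (lowVector R 0)
    rw [h0] at h6
    simp only [Pi.zero_apply, map_zero, inner_zero_right] at h6
    have h7 : ∀ n, δ ≤ ‖inner ℂ (lowVector R 0) (((fourierCLM ℂ (L2 N)).comp (ofWeight α))
        (shift (y (φ₂ (φ₃ n))) (w (φ₁ (φ₂ (φ₃ n)))) j))‖ := by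
      intro n
      refine (hy (φ₂ (φ₃ n))).trans (le_of_eq ?_)
      congr 1
      simp only [shift, ContinuousLinearMap.comp_apply, fourierCLM_apply,
        ofWeight_mulCLM_charSymbol hα.le, fourier_translate, L2.inner_def]
      apply integral_congr_ae
      filter_upwards [coeFn_lowVector R (y (φ₂ (φ₃ n))), coeFn_lowVector R (0 : Space N),
        coeFn_mulCLM (memLp_charSymbol (y (φ₂ (φ₃ n))))
          (𝓕 (ofWeight α (w (φ₁ (φ₂ (φ₃ n))) j)) : L2 N)] with ξ g1 g2 g3
      rw [g1, g2, g3]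
      simp only [RCLike.inner_apply, map_mul, charSymbol, ← Complex.exp_conj, Complex.conj_ofReal,
        Complex.conj_I, inner_neg_right, neg_zero, inner_zero_right, mul_zero, Complex.ofReal_zero,
        zero_mul, Complex.exp_zero, one_mul]
      have : Complex.exp (((2 * Real.pi * -inner ℝ ξ (y (φ₂ (φ₃ n))) : ℝ) : ℂ) * -Complex.I)
          = Complex.exp (((2 * Real.pi * inner ℝ ξ (y (φ₂ (φ₃ n))) : ℝ) : ℂ) * Complex.I) := by
        congr 1; push_cast; ring
      rw [this]; ring
    have h8 := ge_of_tendsto h6.norm (Eventually.of_forall h7)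
    rw [norm_zero] at h8
    linarith
  · intro k
    exact ((hw1 k).comp hφ₄).comp hφ₅
  · intro k
    fin_cases k
    · filter_upwards [h4] with x hx
      exact hx.comp hφ₅.tendsto_atTop
    · exact h5
end
end
end FractionalNLS

/-! ### The potential density: homogeneity and superadditivity. -/

namespace FractionalNLS
noncomputable section
variable {N : ℕ}

/-- If b is small relative to a, scaling to |a| = 1 and uniform continuity on a compact ball give
the ε term. Otherwise |a| and |a + b| are bounded by multiples of |b|, and homogeneity suffices. No
differentiability is used. -/
lemma exists_abs_sub_le_of_homogeneous {E : Type*} [NormedAddCommGroup E] [NormedSpace ℝ E]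
    [ProperSpace E] {T : E → ℝ} {s : ℝ} (hs : 0 < s) (hT : Continuous T)
    (hom : ∀ t : ℝ, 0 ≤ t → ∀ z, T (t • z) = t ^ s * T z) {ε : ℝ} (hε : 0 < ε) :
    ∃ C : ℝ, 0 ≤ C ∧ ∀ a b, |T (a + b) - T a| ≤ ε * ‖a‖ ^ s + C * ‖b‖ ^ s := by
  obtain ⟨M, hM⟩ := (isCompact_closedBall (0 : E) 1).exists_bound_of_continuousOn hT.continuousOn
  have hM0 : 0 ≤ M := (norm_nonneg _).trans (hM 0 (by simp))
  have hbd : ∀ z, |T z| ≤ M * ‖z‖ ^ s := by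
    intro z
    rcases eq_or_ne z 0 with rfl | hz
    · have h0 := hom 0 le_rfl (0 : E)
      rw [smul_zero, Real.zero_rpow hs.ne', zero_mul] at h0
      simp [h0, Real.zero_rpow hs.ne']
    · have hz' := norm_pos_iff.2 hz
      have h1 := hom ‖z‖ (norm_nonneg z) (‖z‖⁻¹ • z)
      rw [smul_inv_smul₀ hz'.ne'] at h1
      rw [h1, abs_mul, abs_of_nonneg (by positivity), mul_comm]
      gcongr
      refine hM _ ?_
      simp [norm_smul, hz'.ne']
  have huc := (isCompact_closedBall (0 : E) 2).uniformContinuousOn_of_continuous hT.continuousOn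
  obtain ⟨δ, hδ, hδT⟩ := Metric.uniformContinuousOn_iff.1 huc ε hε
  set η := min δ 1 with hη
  have hη0 : 0 < η := lt_min hδ one_pos
  refine ⟨M * (1 / η + 1) ^ s + M * (1 / η) ^ s, by positivity, fun a b => ?_⟩
  rcases lt_or_ge ‖b‖ (η * ‖a‖) with h | h
  · have ha : 0 < ‖a‖ := by
      by_contra h0
      have : ‖a‖ = 0 := le_antisymm (not_lt.1 h0) (norm_nonneg a)
      rw [this, mul_zero] at h
      exact absurd h (not_lt.2 (norm_nonneg b))
    set a' := ‖a‖⁻¹ • a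
    set b' := ‖a‖⁻¹ • b
    have ha' : ‖a‖ • a' = a := smul_inv_smul₀ ha.ne' a
    have hb' : ‖a‖ • b' = b := smul_inv_smul₀ ha.ne' b
    have na : ‖a'‖ = 1 := by simp [a', norm_smul, ha.ne']
    have nb : ‖b'‖ < η := by
      simp only [b', norm_smul, norm_inv, norm_norm]
      rw [inv_mul_lt_iff₀ ha, mul_comm]; exact h
    have h1 := hδT (a' + b') (by
        rw [mem_closedBall_zero_iff]
        have := norm_add_le a' b'
        have := min_le_right δ 1
        linarith) a' (by rw [mem_closedBall_zero_iff]; linarith) (by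
        rw [dist_eq_norm, add_sub_cancel_left]
        exact nb.trans_le (min_le_left _ _))
    have h2 : T (a + b) - T a = ‖a‖ ^ s * (T (a' + b') - T a') := by
      nth_rewrite 1 [← ha', ← hb']
      rw [← smul_add, hom _ ha.le, mul_sub, ← hom _ ha.le a', ha']
    rw [h2, abs_mul, abs_of_nonneg (by positivity)]
    rw [Real.dist_eq] at h1
    have h3 : 0 ≤ (M * (1 / η + 1) ^ s + M * (1 / η) ^ s) * ‖b‖ ^ s := by positivity
    have h4 : 0 ≤ ‖a‖ ^ s := by positivity
    nlinarith
  · have h1 : ‖a‖ ≤ 1 / η * ‖b‖ := by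
      rw [one_div, ← div_eq_inv_mul, le_div_iff₀ hη0, mul_comm]; exact h
    have h2 : ‖a + b‖ ≤ (1 / η + 1) * ‖b‖ := by
      have := norm_add_le a b; linarith
    have h3 : |T (a + b)| ≤ M * (1 / η + 1) ^ s * ‖b‖ ^ s := by
      refine (hbd _).trans ?_
      rw [mul_assoc, ← Real.mul_rpow (by positivity) (norm_nonneg b)]
      gcongr
    have h4 : |T a| ≤ M * (1 / η) ^ s * ‖b‖ ^ s := by
      refine (hbd _).trans ?_
      rw [mul_assoc, ← Real.mul_rpow (by positivity) (norm_nonneg b)]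
      gcongr
    have h5 : 0 ≤ ε * ‖a‖ ^ s := by positivity
    have h6 := abs_sub (T (a + b)) (T a)
    linarith

/-- The density of the potential energy. -/
def density (β : ℝ) (μ p r : Fin 2 → ℝ) (z : Fin 2 → ℂ) : ℝ :=
  μ 0 / p 0 * ‖z 0‖ ^ p 0 + μ 1 / p 1 * ‖z 1‖ ^ p 1 + coupling β r z

/-- The exponents of the three terms of the potential energy. -/
def exponents (p r : Fin 2 → ℝ) : Fin 3 → ℝ := ![p 0, p 1, r 0 + r 1]

lemma norm_rpow_le_powerSum (q : Fin 3 → ℝ) (i : Fin 3) (z : Fin 2 → ℂ) :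
    ‖z‖ ^ q i ≤ powerSum q z := by
  have h1 : ‖z‖ ^ q i ≤ ∑ j, ‖z j‖ ^ q i := by
    obtain ⟨j, hj⟩ : ∃ j, ‖z‖ = ‖z j‖ := by
      obtain ⟨j, -, hj⟩ := Finset.exists_mem_eq_sup' Finset.univ_nonempty (fun j => ‖z j‖₊)
      refine ⟨j, ?_⟩
      rw [Pi.norm_def, ← coe_nnnorm, ← hj, Finset.sup'_eq_sup]
    rw [hj]
    exact Finset.single_le_sum (f := fun j => ‖z j‖ ^ q i) (fun j _ => by positivity)
      (Finset.mem_univ j)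
  exact h1.trans (Finset.single_le_sum (f := fun i => ∑ j, ‖z j‖ ^ q i)
    (fun i _ => Finset.sum_nonneg fun j _ => by positivity) (Finset.mem_univ i))

lemma isControlled_of_homogeneous {q : Fin 3 → ℝ} (i : Fin 3) (hq : 0 < q i)
    {T : (Fin 2 → ℂ) → ℝ} (hT : Continuous T)
    (hom : ∀ t : ℝ, 0 ≤ t → ∀ z, T (t • z) = t ^ q i * T z) : IsControlled q T := by
  refine ⟨hT, ?_, fun ε hε => ?_⟩
  · have h0 := hom 0 le_rfl 0
    rwa [smul_zero, Real.zero_rpow hq.ne', zero_mul] at h0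
  · obtain ⟨C, hC0, hC⟩ := exists_abs_sub_le_of_homogeneous hq hT hom hε
    refine ⟨C, hC0, fun a b => (hC a b).trans ?_⟩
    gcongr
    · exact norm_rpow_le_powerSum q i a
    · exact norm_rpow_le_powerSum q i b

lemma IsControlled.add {q : Fin 3 → ℝ} {F G : (Fin 2 → ℂ) → ℝ} (hF : IsControlled q F)
    (hG : IsControlled q G) : IsControlled q (fun z => F z + G z) := by
  refine ⟨hF.continuous.add hG.continuous, by simp [hF.map_zero, hG.map_zero], fun ε hε => ?_⟩
  obtain ⟨C, hC0, hC⟩ := hF.bound (ε / 2) (half_pos hε)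
  obtain ⟨D, hD0, hD⟩ := hG.bound (ε / 2) (half_pos hε)
  refine ⟨C + D, add_nonneg hC0 hD0, fun a b => ?_⟩
  have h1 := abs_add_le (F (a + b) - F a) (G (a + b) - G a)
  have h2 : F (a + b) + G (a + b) - (F a + G a) = F (a + b) - F a + (G (a + b) - G a) := by ring
  rw [h2]
  linarith [hC a b, hD a b]

section

variable {β : ℝ} {μ p r : Fin 2 → ℝ}

/-- The density is a sum of three continuous homogeneous functions, whose degrees are the three
entries of `exponents p r`. -/
lemma isControlled_density (hp : ∀ j, 0 < p j) (hr : ∀ j, 0 < r j) :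
    IsControlled (exponents p r) (density β μ p r) := by
  have hpow : ∀ (j : Fin 2) (c : ℝ), Continuous fun z : Fin 2 → ℂ => c * ‖z j‖ ^ p j := fun j c =>
    continuous_const.mul (((continuous_apply j).norm).rpow_const fun _ => Or.inr (hp j).le)
  have hcoup : Continuous fun z : Fin 2 → ℂ => coupling β r z := by
    unfold coupling
    exact (continuous_const.mul ((continuous_apply 0).norm.rpow_const fun _ => Or.inr (hr 0).le)).mul
      ((continuous_apply 1).norm.rpow_const fun _ => Or.inr (hr 1).le)
  refine (IsControlled.add (isControlled_of_homogeneous 0 (hp 0) (hpow 0 _) ?_)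
    (isControlled_of_homogeneous 1 (hp 1) (hpow 1 _) ?_)).add
    (isControlled_of_homogeneous 2 (add_pos (hr 0) (hr 1)) hcoup ?_)
  · intro t ht z
    simp only [Pi.smul_apply, norm_smul, Real.norm_of_nonneg ht,
      Real.mul_rpow ht (norm_nonneg _)]
    simp [exponents]; ring
  · intro t ht z
    simp only [Pi.smul_apply, norm_smul, Real.norm_of_nonneg ht,
      Real.mul_rpow ht (norm_nonneg _)]
    simp [exponents]; ring
  · intro t ht z
    rcases ht.eq_or_lt with rfl | ht
    · simp [coupling, exponents, Real.zero_rpow (hr 0).ne',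
        Real.zero_rpow (add_pos (hr 0) (hr 1)).ne']
    · simp only [coupling, Pi.smul_apply, norm_smul, Real.norm_of_nonneg ht.le,
        Real.mul_rpow ht.le (norm_nonneg _)]
      simp [exponents, Real.rpow_add ht]; ring

lemma density_nonneg (hβ : 0 < β) (hμ : ∀ j, 0 < μ j) (hp : ∀ j, 0 < p j) (z : Fin 2 → ℂ) :
    0 ≤ density β μ p r z := by
  have := hμ 0; have := hμ 1; have := hp 0; have := hp 1
  unfold density coupling
  positivity

/-- Write x^s = x² x^{s-2} and replace the second factor by the power of √(x² + y²); the squares add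
up. If both numbers are positive, x is strictly below the root. -/
lemma rpow_add_rpow_le_sqrt {x y s : ℝ} (hx : 0 ≤ x) (hy : 0 ≤ y) (hs : 2 < s) :
    x ^ s + y ^ s ≤ √(x ^ 2 + y ^ 2) ^ s ∧
      (0 < x → 0 < y → x ^ s + y ^ s < √(x ^ 2 + y ^ 2) ^ s) := by
  have hs2 : 0 < s - 2 := by linarith
  have hs0 : 2 + (s - 2) ≠ 0 := by linarith
  have hxc : x ≤ √(x ^ 2 + y ^ 2) := Real.le_sqrt_of_sq_le (by nlinarith)
  have hyc : y ≤ √(x ^ 2 + y ^ 2) := Real.le_sqrt_of_sq_le (by nlinarith)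
  have hcc : √(x ^ 2 + y ^ 2) ^ 2 = x ^ 2 + y ^ 2 := Real.sq_sqrt (by positivity)
  have split : ∀ t : ℝ, 0 ≤ t → t ^ s = t ^ 2 * t ^ (s - 2) := fun t ht => by
    rw [← Real.rpow_two, ← Real.rpow_add' ht hs0]; ring_nf
  set c := √(x ^ 2 + y ^ 2)
  have hc : 0 ≤ c := Real.sqrt_nonneg _
  rw [split x hx, split y hy, split c hc]
  have h2 := Real.rpow_le_rpow hy hyc hs2.le
  constructor
  · have h1 := Real.rpow_le_rpow hx hxc hs2.le
    rw [hcc, add_mul]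
    exact add_le_add (mul_le_mul_of_nonneg_left h1 (sq_nonneg x))
      (mul_le_mul_of_nonneg_left h2 (sq_nonneg y))
  · intro hx0 hy0
    have hxc' : x < c := Real.lt_sqrt_of_sq_lt (by nlinarith)
    have h1 := Real.rpow_lt_rpow hx hxc' hs2
    rw [hcc, add_mul]
    exact add_lt_add_of_lt_of_le (mul_lt_mul_of_pos_left h1 (pow_pos hx0 2))
      (mul_le_mul_of_nonneg_left h2 (sq_nonneg y))

/-- One factor of each power is kept for the Cauchy–Schwarz inequality; the remaining powers,
nonnegative because s, t > 1, are bounded by those of the roots. -/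
lemma rpow_mul_rpow_add_le_sqrt {x y x' y' s t : ℝ} (hx : 0 ≤ x) (hy : 0 ≤ y) (hx' : 0 ≤ x')
    (hy' : 0 ≤ y') (hs : 1 < s) (ht : 1 < t) : x ^ s * x' ^ t + y ^ s * y' ^ t
      ≤ √(x ^ 2 + y ^ 2) ^ s * √(x' ^ 2 + y' ^ 2) ^ t := by
  have split : ∀ (e z : ℝ), 1 < e → 0 ≤ z → z ^ e = z * z ^ (e - 1) := fun e z he hz => by
    rw [← Real.rpow_one_add' hz (by linarith)]; ring_nf
  have hxc : x ≤ √(x ^ 2 + y ^ 2) := Real.le_sqrt_of_sq_le (by nlinarith)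
  have hyc : y ≤ √(x ^ 2 + y ^ 2) := Real.le_sqrt_of_sq_le (by nlinarith)
  have hxc' : x' ≤ √(x' ^ 2 + y' ^ 2) := Real.le_sqrt_of_sq_le (by nlinarith)
  have hyc' : y' ≤ √(x' ^ 2 + y' ^ 2) := Real.le_sqrt_of_sq_le (by nlinarith)
  have hcs : x * x' + y * y' ≤ √(x ^ 2 + y ^ 2) * √(x' ^ 2 + y' ^ 2) := by
    rw [← Real.sqrt_mul (by positivity)]
    apply Real.le_sqrt_of_sq_le
    nlinarith [sq_nonneg (x * y' - y * x')]
  set c := √(x ^ 2 + y ^ 2)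
  set c' := √(x' ^ 2 + y' ^ 2)
  have hc : 0 ≤ c := Real.sqrt_nonneg _
  have hc' : 0 ≤ c' := Real.sqrt_nonneg _
  rw [split s x hs hx, split s y hs hy, split s c hs hc, split t x' ht hx', split t y' ht hy',
    split t c' ht hc']
  have hs1 : 0 ≤ s - 1 := by linarith
  have ht1 : 0 ≤ t - 1 := by linarith
  calc x * x ^ (s - 1) * (x' * x' ^ (t - 1)) + y * y ^ (s - 1) * (y' * y' ^ (t - 1))
      ≤ x * c ^ (s - 1) * (x' * c' ^ (t - 1)) + y * c ^ (s - 1) * (y' * c' ^ (t - 1)) := by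
        gcongr
    _ = (x * x' + y * y') * (c ^ (s - 1) * c' ^ (t - 1)) := by ring
    _ ≤ (c * c') * (c ^ (s - 1) * c' ^ (t - 1)) := by gcongr
    _ = _ := by ring

/-- The pair of functions `(|aⱼ|² + |bⱼ|²)^{1/2}`. -/
def superpose (a b : Fin 2 → ℂ) : Fin 2 → ℂ := fun j => (√(‖a j‖ ^ 2 + ‖b j‖ ^ 2) : ℝ)

lemma norm_superpose (a b : Fin 2 → ℂ) (j : Fin 2) :
    ‖superpose a b j‖ = √(‖a j‖ ^ 2 + ‖b j‖ ^ 2) := by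
  rw [superpose, Complex.norm_real, Real.norm_of_nonneg (Real.sqrt_nonneg _)]

lemma density_add_le (hβ : 0 < β) (hμ : ∀ j, 0 < μ j) (hp : ∀ j, 2 < p j) (hr : ∀ j, 1 < r j)
    (a b : Fin 2 → ℂ) :
    density β μ p r a + density β μ p r b ≤ density β μ p r (superpose a b) := by
  have h0 := (rpow_add_rpow_le_sqrt (norm_nonneg (a 0)) (norm_nonneg (b 0)) (hp 0)).1
  have h1 := (rpow_add_rpow_le_sqrt (norm_nonneg (a 1)) (norm_nonneg (b 1)) (hp 1)).1
  have h2 := rpow_mul_rpow_add_le_sqrt (norm_nonneg (a 0)) (norm_nonneg (b 0))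
    (norm_nonneg (a 1)) (norm_nonneg (b 1)) (hr 0) (hr 1)
  have c0 : 0 ≤ μ 0 / p 0 := div_nonneg (hμ 0).le (by linarith [hp 0])
  have c1 : 0 ≤ μ 1 / p 1 := div_nonneg (hμ 1).le (by linarith [hp 1])
  simp only [density, coupling, norm_superpose]
  nlinarith [mul_le_mul_of_nonneg_left h0 c0, mul_le_mul_of_nonneg_left h1 c1,
    mul_le_mul_of_nonneg_left h2 hβ.le]

/-- If a component is nonzero in both pairs, its own power term is strictly superadditive. Otherwise
the pairs live in different components: both couplings vanish, whereas the coupling of the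
superposition is positive because β > 0. -/
lemma density_add_lt (hβ : 0 < β) (hμ : ∀ j, 0 < μ j) (hp : ∀ j, 2 < p j) (hr : ∀ j, 1 < r j)
    {a b : Fin 2 → ℂ} {j k : Fin 2} (ha : a j ≠ 0) (hb : b k ≠ 0) :
    density β μ p r a + density β μ p r b < density β μ p r (superpose a b) := by
  have h0 := rpow_add_rpow_le_sqrt (norm_nonneg (a 0)) (norm_nonneg (b 0)) (hp 0)
  have h1 := rpow_add_rpow_le_sqrt (norm_nonneg (a 1)) (norm_nonneg (b 1)) (hp 1)
  have h2 := rpow_mul_rpow_add_le_sqrt (norm_nonneg (a 0)) (norm_nonneg (b 0))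
    (norm_nonneg (a 1)) (norm_nonneg (b 1)) (hr 0) (hr 1)
  have c0 : 0 < μ 0 / p 0 := div_pos (hμ 0) (by linarith [hp 0])
  have c1 : 0 < μ 1 / p 1 := div_pos (hμ 1) (by linarith [hp 1])
  have m0 := mul_le_mul_of_nonneg_left h0.1 c0.le
  have m1 := mul_le_mul_of_nonneg_left h1.1 c1.le
  have m2 := mul_le_mul_of_nonneg_left h2 hβ.le
  simp only [density, coupling, norm_superpose]
  by_cases s0 : a 0 ≠ 0 ∧ b 0 ≠ 0
  · have := mul_lt_mul_of_pos_left (h0.2 (norm_pos_iff.2 s0.1) (norm_pos_iff.2 s0.2)) c0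
    nlinarith
  by_cases s1 : a 1 ≠ 0 ∧ b 1 ≠ 0
  · have := mul_lt_mul_of_pos_left (h1.2 (norm_pos_iff.2 s1.1) (norm_pos_iff.2 s1.2)) c1
    nlinarith
  have hr0 : r 0 ≠ 0 := by linarith [hr 0]
  have hr1 : r 1 ≠ 0 := by linarith [hr 1]
  have key : ‖a 0‖ ^ r 0 * ‖a 1‖ ^ r 1 = 0 ∧ ‖b 0‖ ^ r 0 * ‖b 1‖ ^ r 1 = 0 ∧
      0 < √(‖a 0‖ ^ 2 + ‖b 0‖ ^ 2) ∧ 0 < √(‖a 1‖ ^ 2 + ‖b 1‖ ^ 2) := by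
    simp only [Real.sqrt_pos]
    fin_cases j <;> fin_cases k <;> simp only [Fin.zero_eta, Fin.mk_one] at ha hb
    · exact absurd ⟨ha, hb⟩ s0
    · have hb0 : b 0 = 0 := by tauto
      have ha1 : a 1 = 0 := by tauto
      have := norm_pos_iff.2 ha
      have := norm_pos_iff.2 hb
      refine ⟨by simp [ha1, hr1], by simp [hb0, hr0], by positivity, by positivity⟩
    · have hb1 : b 1 = 0 := by tauto
      have ha0 : a 0 = 0 := by tauto
      have := norm_pos_iff.2 ha
      have := norm_pos_iff.2 hb
      refine ⟨by simp [ha0, hr0], by simp [hb1, hr1], by positivity, by positivity⟩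
    · exact absurd ⟨ha, hb⟩ s1
  obtain ⟨k1, k2, k3, k4⟩ := key
  have m3 : 0 < β * (√(‖a 0‖ ^ 2 + ‖b 0‖ ^ 2) ^ r 0 * √(‖a 1‖ ^ 2 + ‖b 1‖ ^ 2) ^ r 1) := by
    positivity
  have k1' : β * ‖a 0‖ ^ r 0 * ‖a 1‖ ^ r 1 = 0 := by rw [mul_assoc, k1, mul_zero]
  have k2' : β * ‖b 0‖ ^ r 0 * ‖b 1‖ ^ r 1 = 0 := by rw [mul_assoc, k2, mul_zero]
  nlinarith
end
end
end FractionalNLS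

/-! ### Gaussians of negative energy. -/

namespace FractionalNLS
noncomputable section
variable {N : ℕ}

lemma integral_exp_neg_mul_sq_norm {b : ℝ} (hb : 0 < b) :
    ∫ x : Space N, Real.exp (-b * ‖x‖ ^ 2) = (Real.pi / b) ^ ((N : ℝ) / 2) := by
  have := GaussianFourier.integral_rexp_neg_mul_sq_norm (V := Space N) hb
  rwa [finrank_euclideanSpace_fin] at this

lemma integrable_exp_neg_mul_sq_norm {b : ℝ} (hb : 0 < b) :
    Integrable fun x : Space N => Real.exp (-b * ‖x‖ ^ 2) := by
  by_contra h
  have h1 := integral_exp_neg_mul_sq_norm (N := N) hb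
  rw [integral_undef h] at h1
  have : 0 < (Real.pi / b) ^ ((N : ℝ) / 2) := by positivity
  linarith

lemma rpow_le_exp {α t : ℝ} (hα : 0 ≤ α) (hα1 : α ≤ 1) (ht : 0 ≤ t) : t ^ α ≤ Real.exp t := by
  refine le_trans ?_ (Real.add_one_le_exp t)
  rcases le_total t 1 with h | h
  · have := Real.rpow_le_one ht h hα
    linarith
  · have := Real.rpow_le_rpow_of_exponent_le h hα1
    rw [Real.rpow_one] at this
    linarith

/-- A Gaussian of mass `ρ` at the frequency scale `c^{1/2}`. -/
lemma exists_gaussian {α ρ : ℝ} (hα : 0 < α) (hα1 : α < 1) (hρ : 0 < ρ) {c : ℝ} (hc : 0 < c) :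
    ∃ w : L2 N, ‖ofWeight α w‖ ^ 2 = ρ ∧
      ‖gradOfWeight α w‖ ^ 2 ≤ (4 * Real.pi ^ 2) ^ α * ρ * 2 ^ ((N : ℝ) / 2) * c ^ (-α) ∧
      ∀ p : ℝ, 0 < p → ∫ x, ‖ofWeight α w x‖ ^ p = ρ ^ (p / 2) * (2 / Real.pi) ^ ((N : ℝ) / 2 * (p / 2))
        * Real.pi ^ ((N : ℝ) / 2 * p) * (p * Real.pi) ^ (-((N : ℝ) / 2))
        * c ^ (-((N : ℝ) / 2 * (p - 2) / 2)) := by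
  have hπ := Real.pi_pos
  set L : ℝ := (N : ℝ) / 2 with hL
  -- The amplitude normalises the mass to ρ.
  set A : ℝ := √(ρ * (2 * c / Real.pi) ^ L) with hA
  have hA2 : A ^ 2 = ρ * (2 * c / Real.pi) ^ L := Real.sq_sqrt (by positivity)
  have hA0 : 0 < A := Real.sqrt_pos.2 (by positivity)
  set h : Space N → ℂ := fun ξ => A * Complex.exp (-(c : ℂ) * ‖ξ‖ ^ 2) with hh
  have hexp : ∀ (b : ℝ) (ξ : Space N), Complex.exp (-(b : ℂ) * ‖ξ‖ ^ 2)
      = (Real.exp (-b * ‖ξ‖ ^ 2) : ℝ) := fun b ξ => by push_cast; rfl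
  have hnorm : ∀ ξ, ‖h ξ‖ = A * Real.exp (-c * ‖ξ‖ ^ 2) := fun ξ => by
    simp only [hh]
    rw [hexp, norm_mul, Complex.norm_real, Complex.norm_real, Real.norm_of_nonneg hA0.le,
      Real.norm_of_nonneg (Real.exp_pos _).le]
  have hcont : Continuous h := by simp only [hh]; fun_prop
  have hint : Integrable h := by
    refine ((integrable_exp_neg_mul_sq_norm (N := N) hc).const_mul A).mono'
      hcont.aestronglyMeasurable (Eventually.of_forall fun ξ => (hnorm ξ).le)
  have hsq : ∀ ξ, ‖h ξ‖ ^ 2 = A ^ 2 * Real.exp (-(2 * c) * ‖ξ‖ ^ 2) := fun ξ => by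
    rw [hnorm, mul_pow, ← Real.exp_nat_mul]; congr 2; push_cast; ring
  have hmem : MemLp h 2 volume := by
    rw [memLp_two_iff_integrable_sq_norm hcont.aestronglyMeasurable]
    simp only [hsq]
    exact (integrable_exp_neg_mul_sq_norm (by positivity)).const_mul _
  set u : L2 N := 𝓕⁻ (hmem.toLp h : L2 N) with hu
  have hFu : (𝓕 u : L2 N) = hmem.toLp h := fourier_fourierInv_eq _
  have hmass : ‖u‖ ^ 2 = ρ := by
    rw [← Lp.norm_fourier_eq, hFu, norm_sq_eq_integral]
    have : ∫ ξ, ‖hmem.toLp h ξ‖ ^ 2 = ∫ ξ, ‖h ξ‖ ^ 2 := by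
      apply integral_congr_ae
      filter_upwards [hmem.coeFn_toLp] with ξ hξ
      rw [hξ]
    rw [this]
    simp only [hsq]
    rw [integral_const_mul, integral_exp_neg_mul_sq_norm (by positivity), hA2, mul_assoc,
      ← Real.mul_rpow (by positivity) (by positivity)]
    have : 2 * c / Real.pi * (Real.pi / (2 * c)) = 1 := by field_simp
    rw [this, Real.one_rpow, mul_one]
  have hkin : kinetic α u
      ≤ ENNReal.ofReal ((4 * Real.pi ^ 2) ^ α * ρ * 2 ^ L * c ^ (-α)) := by
    -- The factor |ξ|^{2α} is absorbed by half of the Gaussian exponent, which avoids Gamma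
    -- integrals and costs only the factor 2^L.
    have hpt : ∀ ξ : Space N, rieszSymbol α ξ ^ 2 * ‖h ξ‖ ^ 2
        ≤ (4 * Real.pi ^ 2 / c) ^ α * A ^ 2 * Real.exp (-c * ‖ξ‖ ^ 2) := by
      intro ξ
      have h1 : rieszSymbol α ξ ^ 2 = (4 * Real.pi ^ 2 / c) ^ α * (c * ‖ξ‖ ^ 2) ^ α := by
        rw [rieszSymbol, ← Real.mul_rpow (by positivity) (by positivity), ← Real.rpow_natCast,
          ← Real.rpow_mul (by positivity), mul_comm α, Real.rpow_mul (by positivity),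
          Real.rpow_natCast]
        congr 1
        field_simp; ring
      have h2 := rpow_le_exp hα.le hα1.le (show 0 ≤ c * ‖ξ‖ ^ 2 by positivity)
      have h3 : Real.exp (-c * ‖ξ‖ ^ 2)
          = Real.exp (c * ‖ξ‖ ^ 2) * Real.exp (-(2 * c) * ‖ξ‖ ^ 2) := by
        rw [← Real.exp_add]; congr 1; ring
      rw [h1, hsq, h3]
      calc (4 * Real.pi ^ 2 / c) ^ α * (c * ‖ξ‖ ^ 2) ^ α * (A ^ 2 * Real.exp (-(2 * c) * ‖ξ‖ ^ 2))
          ≤ (4 * Real.pi ^ 2 / c) ^ α * Real.exp (c * ‖ξ‖ ^ 2)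
            * (A ^ 2 * Real.exp (-(2 * c) * ‖ξ‖ ^ 2)) := by gcongr
        _ = _ := by ring
    calc kinetic α u = ∫⁻ ξ, ENNReal.ofReal (rieszSymbol α ξ ^ 2 * ‖h ξ‖ ^ 2) := by
          rw [kinetic, hFu]
          apply lintegral_congr_ae
          filter_upwards [hmem.coeFn_toLp] with ξ hξ
          rw [hξ, ENNReal.ofReal_mul (by positivity),
            ENNReal.ofReal_pow (rieszSymbol_nonneg α ξ), ENNReal.ofReal_pow (norm_nonneg _),
            ofReal_norm]
      _ ≤ ∫⁻ ξ : Space N,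
            ENNReal.ofReal ((4 * Real.pi ^ 2 / c) ^ α * A ^ 2 * Real.exp (-c * ‖ξ‖ ^ 2)) :=
          lintegral_mono fun ξ => ENNReal.ofReal_le_ofReal (hpt ξ)
      _ = ENNReal.ofReal ((4 * Real.pi ^ 2) ^ α * ρ * 2 ^ L * c ^ (-α)) := by
          rw [← ofReal_integral_eq_lintegral_ofReal
            ((integrable_exp_neg_mul_sq_norm hc).const_mul _)
            (Eventually.of_forall fun ξ => by positivity), integral_const_mul,
            integral_exp_neg_mul_sq_norm hc, ← hL, hA2]
          congr 1
          rw [Real.div_rpow (by positivity) hc.le, Real.rpow_neg hc.le,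
            Real.div_rpow (by positivity) hπ.le, Real.div_rpow hπ.le hc.le,
            Real.mul_rpow (by norm_num) hc.le]
          have := Real.rpow_pos_of_pos hπ L
          have := Real.rpow_pos_of_pos hc L
          field_simp
  obtain ⟨w, hw⟩ := (memH_of_kinetic_lt_top hα.le hα1.le
    (hkin.trans_lt ENNReal.ofReal_lt_top)).exists_ofWeight_eq hα.le
  refine ⟨w, by rw [hw, hmass], ?_, fun p hp => ?_⟩
  · rw [← hw, ← enorm_gradOfWeight_sq hα.le, ← ofReal_norm, ← ENNReal.ofReal_pow (norm_nonneg _),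
      ENNReal.ofReal_le_ofReal_iff (by positivity)] at hkin
    exact hkin
  · have hval : ∀ᵐ x, ‖u x‖ ^ p = (A * (Real.pi / c) ^ L) ^ p
        * Real.exp (-(p * Real.pi ^ 2 / c) * ‖x‖ ^ 2) := by
      filter_upwards [coeFn_fourierInv_toLp hint hmem] with x hx
      have h1 : 𝓕⁻ h x = A * 𝓕 (fun v : Space N => Complex.exp (-(c : ℂ) * ‖v‖ ^ 2)) (-x) := by
        rw [Real.fourierInv_eq_fourier_neg, Real.fourier_eq, Real.fourier_eq,
          ← integral_const_mul]
        congr 1; ext v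
        simp only [hh, Circle.smul_def, smul_eq_mul]; ring
      rw [hx, h1, fourier_gaussian_innerProductSpace (by simpa using hc), norm_mul, norm_mul,
        Complex.norm_real, Real.norm_of_nonneg hA0.le, finrank_euclideanSpace_fin, norm_neg]
      have h2 : ((Real.pi : ℂ) / c) ^ ((N : ℂ) / 2) = (((Real.pi / c) ^ L : ℝ) : ℂ) := by
        rw [Complex.ofReal_cpow (by positivity), hL]; push_cast; rfl
      have h3 : Complex.exp (-(Real.pi : ℂ) ^ 2 * ‖x‖ ^ 2 / c)
          = (Real.exp (-(Real.pi ^ 2) * ‖x‖ ^ 2 / c) : ℝ) := by push_cast; rfl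
      rw [h2, h3, Complex.norm_real, Complex.norm_real, Real.norm_of_nonneg (by positivity),
        Real.norm_of_nonneg (Real.exp_pos _).le, ← mul_assoc,
        Real.mul_rpow (by positivity) (Real.exp_pos _).le, ← Real.exp_mul]
      congr 2; ring
    rw [hw, integral_congr_ae hval, integral_const_mul,
      integral_exp_neg_mul_sq_norm (by positivity), ← hL]
    have hAp : A ^ p = ρ ^ (p / 2) * (2 / Real.pi) ^ (L * (p / 2)) * c ^ (L * (p / 2)) := by
      have : A ^ p = (A ^ 2) ^ (p / 2) := by
        rw [← Real.rpow_natCast, ← Real.rpow_mul hA0.le]; congr 1; push_cast; ring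
      rw [this, hA2, Real.mul_rpow hρ.le (by positivity), ← Real.rpow_mul (by positivity),
        mul_assoc, ← Real.mul_rpow (by positivity) hc.le]
      congr 2; ring
    have h4 : Real.pi / (p * Real.pi ^ 2 / c) = (p * Real.pi)⁻¹ * c := by field_simp
    have h5 : c ^ (-(L * (p - 2) / 2)) = c ^ (L * (p / 2)) * c ^ (-(L * p)) * c ^ L := by
      rw [← Real.rpow_add hc, ← Real.rpow_add hc]; congr 1; ring
    rw [Real.mul_rpow hA0.le (by positivity), hAp, h4, Real.mul_rpow (by positivity) hc.le,
      Real.inv_rpow (by positivity), ← Real.rpow_neg (by positivity), ← Real.rpow_mul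
      (by positivity), Real.div_rpow hπ.le hc.le, h5, Real.rpow_neg hc.le]
    ring

/-- Each positive mass is attained by a function of negative energy. -/
lemma exists_energy_neg (hN : 1 ≤ N) {α ρ p μ : ℝ} (hα : 0 < α) (hα1 : α < 1) (hρ : 0 < ρ)
    (hμ : 0 < μ) (hp : 2 < p) (hp' : p < 2 + 4 * α / N) :
    ∃ w : L2 N, ‖ofWeight α w‖ ^ 2 = ρ ∧
      1 / 2 * ‖gradOfWeight α w‖ ^ 2 - μ / p * ∫ x, ‖ofWeight α w x‖ ^ p < 0 := by
  have hN0 : (0 : ℝ) < N := by exact_mod_cast hN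
  set K₁ : ℝ := (4 * Real.pi ^ 2) ^ α * ρ * 2 ^ ((N : ℝ) / 2) with hK₁
  set K₂ : ℝ := ρ ^ (p / 2) * (2 / Real.pi) ^ ((N : ℝ) / 2 * (p / 2))
        * Real.pi ^ ((N : ℝ) / 2 * p) * (p * Real.pi) ^ (-((N : ℝ) / 2)) with hK₂
  have hπ := Real.pi_pos
  have hp0 : 0 < p := by linarith
  have hK₁0 : 0 < K₁ := by positivity
  have hK₂0 : 0 < K₂ := by positivity
  -- As c → ∞ the Gaussian spreads out in space: its kinetic energy is O(c^{-α}), while the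
  -- potential term is a constant times c^{-γ}. Subcriticality is exactly γ < α, so the potential
  -- term wins.
  set γ : ℝ := (N : ℝ) / 2 * (p - 2) / 2 with hγ
  have hγα : 0 < α - γ := by
    have : p - 2 < 4 * α / N := by linarith
    rw [lt_div_iff₀ hN0] at this
    rw [hγ]; linarith
  have hlim := tendsto_rpow_atTop hγα
  obtain ⟨c, hc, hc0⟩ := ((hlim.eventually (eventually_gt_atTop (K₁ / (2 * (μ / p * K₂))))).and
    (eventually_gt_atTop 0)).exists
  obtain ⟨w, h1, h2, h3⟩ := exists_gaussian (N := N) hα hα1 hρ hc0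
  refine ⟨w, h1, ?_⟩
  rw [h3 p hp0]
  have h4 : c ^ (-γ) = c ^ (α - γ) * c ^ (-α) := by rw [← Real.rpow_add hc0]; congr 1; ring
  have h5 : 0 < c ^ (-α) := by positivity
  have h6 : 0 < μ / p * K₂ := by positivity
  rw [div_lt_iff₀ (by positivity)] at hc
  have h7 : K₁ * c ^ (-α) < c ^ (α - γ) * (2 * (μ / p * K₂)) * c ^ (-α) :=
    mul_lt_mul_of_pos_right hc h5
  rw [← hK₂, ← hγ, h4]
  rw [← hK₁] at h2
  nlinarith
end
end FractionalNLS

/-! ### The energy on weights: coercivity, superposition and splitting. -/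

namespace FractionalNLS
noncomputable section
variable {N : ℕ}

/-- The assumptions on the parameters of the system. -/
structure Admissible (N : ℕ) (α β : ℝ) (μ p r : Fin 2 → ℝ) : Prop where
  dim_pos : 1 ≤ N
  α_pos : 0 < α
  α_lt : α < 1
  β_pos : 0 < β
  μ_pos : ∀ j, 0 < μ j
  p_mem : ∀ j, 2 < p j ∧ p j < 2 + 4 * α / N
  r_gt : ∀ j, 1 < r j
  r_add : r 0 + r 1 < 2 + 4 * α / N

/-- The kinetic energy in terms of the weights. -/
def kineticW (α : ℝ) (w : Fin 2 → L2 N) : ℝ := ∑ j, ‖gradOfWeight α (w j)‖ ^ 2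

/-- The potential energy in terms of the weights. -/
def potentialW (α β : ℝ) (μ p r : Fin 2 → ℝ) (w : Fin 2 → L2 N) : ℝ :=
  ∫ x, density β μ p r (pairVal α w x)

/-- The energy in terms of the weights. -/
def energyW (α β : ℝ) (μ p r : Fin 2 → ℝ) (w : Fin 2 → L2 N) : ℝ :=
  1 / 2 * kineticW α w - potentialW α β μ p r w

lemma kineticW_nonneg (α : ℝ) (w : Fin 2 → L2 N) : 0 ≤ kineticW α w :=
  Finset.sum_nonneg fun j _ => by positivity

lemma norm_sq_le_add {α : ℝ} (hα : 0 ≤ α) (hα1 : α ≤ 1) (w : L2 N) :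
    ‖w‖ ^ 2 ≤ ‖ofWeight α w‖ ^ 2 + ‖gradOfWeight α w‖ ^ 2 := by
  have h := normH_sq_le hα hα1 (ofWeight α w)
  rw [normH_ofWeight hα, ← enorm_gradOfWeight_sq hα, ← ofReal_norm, ← ofReal_norm, ← ofReal_norm,
    ← ENNReal.ofReal_pow (norm_nonneg _), ← ENNReal.ofReal_pow (norm_nonneg _),
    ← ENNReal.ofReal_pow (norm_nonneg _), ← ENNReal.ofReal_add (by positivity) (by positivity),
    ENNReal.ofReal_le_ofReal_iff (by positivity)] at h
  exact h

lemma shift_sub (y : Space N) (w v : Fin 2 → L2 N) : shift y (w - v) = shift y w - shift y v := by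
  ext1 j; simp [shift]

lemma shift_neg_shift (y : Space N) (w : Fin 2 → L2 N) : shift (-y) (shift y w) = w := by
  ext1 j; exact mulCLM_charSymbol_neg y (w j)

lemma norm_shift (y : Space N) (w : Fin 2 → L2 N) (j : Fin 2) : ‖shift y w j‖ = ‖w j‖ :=
  norm_mulCLM_charSymbol y (w j)

lemma norm_ofWeight_shift {α : ℝ} (hα : 0 ≤ α) (y : Space N) (w : Fin 2 → L2 N) (j : Fin 2) :
    ‖ofWeight α (shift y w j)‖ = ‖ofWeight α (w j)‖ := by
  rw [shift, ofWeight_mulCLM_charSymbol hα, LinearIsometry.norm_map]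

lemma pairVal_shift {α : ℝ} (hα : 0 ≤ α) (y : Space N) (w : Fin 2 → L2 N) :
    pairVal α (shift y w) =ᵐ[volume] fun x => pairVal α w (x + y) := by
  have h : ∀ j, ∀ᵐ x, ofWeight α (shift y w j) x = ofWeight α (w j) (x + y) := fun j => by
    rw [shift, ofWeight_mulCLM_charSymbol hα]
    exact coeFn_translate y _
  filter_upwards [ae_all_iff.2 h] with x hx
  ext j
  exact hx j

lemma energyW_shift {α β : ℝ} {μ p r : Fin 2 → ℝ} (hα : 0 ≤ α) (y : Space N)
    (w : Fin 2 → L2 N) : energyW α β μ p r (shift y w) = energyW α β μ p r w := by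
  have h1 : kineticW α (shift y w) = kineticW α w := by
    refine Finset.sum_congr rfl fun j _ => ?_
    rw [shift, gradOfWeight_mulCLM_charSymbol hα, LinearIsometry.norm_map]
  have h2 : potentialW α β μ p r (shift y w) = potentialW α β μ p r w := by
    have : ∫ x, density β μ p r (pairVal α (shift y w) x)
        = ∫ x, density β μ p r (pairVal α w (x + y)) := by
      apply integral_congr_ae
      filter_upwards [pairVal_shift hα y w] with x hx
      rw [hx]
    rw [potentialW, this, integral_add_right_eq_self fun x => density β μ p r (pairVal α w x)]
    rfl
  rw [energyW, energyW, h1, h2]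

/-- Otherwise Tonelli gives, for almost every x, that f(x + y) g(x) = 0 for almost every y; one such
x with g(x) ≠ 0 forces f = 0. -/
lemma exists_translate_overlap {f g : L2 N} (hf : f ≠ 0) (hg : g ≠ 0) :
    ∃ y : Space N, ¬ ∀ᵐ x, f (x + y) = 0 ∨ g x = 0 := by
  by_contra! h
  have hfm := (Lp.stronglyMeasurable f).measurable
  have hgm := (Lp.stronglyMeasurable g).measurable
  have hs : MeasurableSet {q : Space N × Space N | f (q.2 + q.1) = 0 ∨ g q.2 = 0} :=
    ((hfm.comp (measurable_snd.add measurable_fst)) (measurableSet_singleton 0)).union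
      ((hgm.comp measurable_snd) (measurableSet_singleton 0))
  have h1 := (Measure.ae_ae_comm (μ := (volume : Measure (Space N)))
    (ν := (volume : Measure (Space N))) hs).1 (Eventually.of_forall h)
  have h2 : ∃ᵐ x, g x ≠ 0 := by
    intro h3
    apply hg
    rw [Lp.eq_zero_iff_ae_eq_zero]
    filter_upwards [h3] with x hx
    simpa using hx
  obtain ⟨x, hx1, hx2⟩ := (h2.and_eventually h1).exists
  apply hf
  rw [Lp.eq_zero_iff_ae_eq_zero]
  have h4 := (measurePreserving_add_left (volume : Measure (Space N)) (-x)).quasiMeasurePreserving.ae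
    hx2
  filter_upwards [h4] with y hy
  simpa [hx1] using hy

namespace Admissible

variable {α β : ℝ} {μ p r : Fin 2 → ℝ}

lemma subcritical (H : Admissible N α β μ p r) : Subcritical N α (exponents p r) := by
  intro i
  fin_cases i
  · exact H.p_mem 0
  · exact H.p_mem 1
  · exact ⟨by have := H.r_gt 0; have := H.r_gt 1; simp [exponents]; linarith, H.r_add⟩

lemma controlled (H : Admissible N α β μ p r) :
    IsControlled (exponents p r) (density β μ p r) :=
  isControlled_density (fun j => by linarith [(H.p_mem j).1]) (fun j => by linarith [H.r_gt j])

lemma integrable_density (H : Admissible N α β μ p r) (w : Fin 2 → L2 N) :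
    Integrable (fun x => density β μ p r (pairVal α w x)) :=
  H.controlled.integrable H.dim_pos H.α_pos H.subcritical w

lemma potentialW_nonneg (H : Admissible N α β μ p r) (w : Fin 2 → L2 N) :
    0 ≤ potentialW α β μ p r w :=
  integral_nonneg fun x => density_nonneg H.β_pos H.μ_pos (fun j => by linarith [(H.p_mem j).1]) _

lemma exists_potentialW_le (H : Admissible N α β μ p r) : ∃ K : ℝ, 0 < K ∧ ∀ w : Fin 2 → L2 N,
    potentialW α β μ p r w ≤ K * ∫ x, powerSum (exponents p r) (pairVal α w x) := by
  obtain ⟨K, hK0, hK⟩ := H.controlled.exists_abs_le H.subcritical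
  refine ⟨K + 1, by linarith, fun w => ?_⟩
  rw [← integral_const_mul]
  refine integral_mono (H.integrable_density w)
    ((integrable_powerSum H.dim_pos H.α_pos H.subcritical w).const_mul _) fun x => ?_
  have h1 := (le_abs_self _).trans (hK (pairVal α w x))
  have h2 := powerSum_nonneg (exponents p r) (pairVal α w x)
  simp only
  linarith

lemma energy_ofWeight (H : Admissible N α β μ p r) (w : Fin 2 → L2 N) :
    energy α β μ p r (fun j => ofWeight α (w j)) = energyW α β μ p r w := by
  rw [energy, energyW, kineticW, Fin.sum_univ_two, fracLaplacian_ofWeight H.α_pos.le,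
    fracLaplacian_ofWeight H.α_pos.le, integral_add, ← norm_sq_eq_integral, ← norm_sq_eq_integral]
  · rfl
  · exact (Lp.memLp (gradOfWeight α (w 0))).integrable_norm_pow (by norm_num)
  · exact (Lp.memLp (gradOfWeight α (w 1))).integrable_norm_pow (by norm_num)

/-- Coercivity. The constant 1/(4K) lets the potential use up only half of the kinetic term 1/2, so
energy and mass bounds control the full H^α norm. -/
lemma exists_bound (H : Admissible N α β μ p r) {A : ℝ} (hA : 0 ≤ A) (B : ℝ) :
    ∃ M : ℝ, ∀ w : Fin 2 → L2 N, (∀ j, ‖ofWeight α (w j)‖ ≤ A) → energyW α β μ p r w ≤ B →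
      ∀ j, ‖w j‖ ≤ M := by
  obtain ⟨K, hK0, hK⟩ := H.exists_potentialW_le (N := N)
  obtain ⟨C, hC0, hC⟩ := exists_integral_powerSum_le_kinetic H.dim_pos H.α_pos H.subcritical hA
    (ε := 1 / (4 * K)) (by positivity)
  refine ⟨√(A ^ 2 + 4 * (B + K * C)), fun w hw hE j => ?_⟩
  have h1 := hC w hw
  have h2 := (hK w).trans (mul_le_mul_of_nonneg_left h1 hK0.le)
  have h3 : K * (1 / (4 * K) * ∑ j, ‖gradOfWeight α (w j)‖ ^ 2 + C)
      = 1 / 4 * kineticW α w + K * C := by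
    rw [kineticW]; field_simp
  rw [h3] at h2
  rw [energyW] at hE
  have h4 : ‖gradOfWeight α (w j)‖ ^ 2 ≤ kineticW α w :=
    Finset.single_le_sum (f := fun j => ‖gradOfWeight α (w j)‖ ^ 2)
      (fun j _ => by positivity) (Finset.mem_univ j)
  apply Real.le_sqrt_of_sq_le
  have h5 := norm_sq_le_add H.α_pos.le H.α_lt.le (w j)
  have h6 : ‖ofWeight α (w j)‖ ^ 2 ≤ A ^ 2 := by have := hw j; gcongr
  linarith

/-- Uniform continuity of the energy on bounded sets: the kinetic part is quadratic, and the
potential part follows from the increment bound. -/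
lemma tendsto_energyW_sub (H : Admissible N α β μ p r) {M : ℝ} {w v : ℕ → Fin 2 → L2 N}
    (hv : ∀ n j, ‖v n j‖ ≤ M) (h : ∀ j, Tendsto (fun n => ‖w n j - v n j‖) atTop (𝓝 0)) :
    Tendsto (fun n => energyW α β μ p r (w n) - energyW α β μ p r (v n)) atTop (𝓝 0) := by
  choose C hC using fun j => (h j).bddAbove_range
  have hC' : ∀ n j, ‖w n j - v n j‖ ≤ C 0 + C 1 := by
    have h0 : ∀ j n, ‖w n j - v n j‖ ≤ C j := fun j n => hC j ⟨n, rfl⟩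
    have hp0 := (norm_nonneg _).trans (h0 0 0)
    have hp1 := (norm_nonneg _).trans (h0 1 0)
    intro n j
    fin_cases j
    · have := h0 0 n; simp only [Fin.zero_eta]; linarith
    · have := h0 1 n; simp only [Fin.mk_one]; linarith
  have h1 : Tendsto (fun n => ∫ x, powerSum (exponents p r) (pairVal α (w n - v n) x)) atTop
      (𝓝 0) := by
    refine tendsto_integral_powerSum H.dim_pos H.α_pos H.subcritical (M := C 0 + C 1) hC' fun j => ?_
    exact squeeze_zero (fun n => norm_nonneg _) (fun n => norm_ofWeight_le H.α_pos.le _) (h j)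
  have h2 := H.controlled.tendsto_sub H.dim_pos H.α_pos H.subcritical hv h1
  have h3 : ∀ j, Tendsto (fun n => ‖gradOfWeight α (w n j)‖ ^ 2 - ‖gradOfWeight α (v n j)‖ ^ 2)
      atTop (𝓝 0) := by
    intro j
    have hb : ∀ n, ‖‖gradOfWeight α (w n j)‖ ^ 2 - ‖gradOfWeight α (v n j)‖ ^ 2‖
        ≤ ‖w n j - v n j‖ * (C 0 + C 1 + 2 * M) := by
      intro n
      have e1 : |‖gradOfWeight α (w n j)‖ - ‖gradOfWeight α (v n j)‖| ≤ ‖w n j - v n j‖ := by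
        refine (abs_norm_sub_norm_le _ _).trans ?_
        rw [← map_sub]
        exact norm_gradOfWeight_le H.α_pos.le _
      have e2 : ‖gradOfWeight α (v n j)‖ ≤ M := (norm_gradOfWeight_le H.α_pos.le _).trans (hv n j)
      have e3 : ‖gradOfWeight α (w n j)‖ ≤ C 0 + C 1 + M := by
        have := abs_le.1 e1
        linarith [hC' n j]
      rw [sq_sub_sq, Real.norm_eq_abs, abs_mul, mul_comm]
      have e4 : |‖gradOfWeight α (w n j)‖ + ‖gradOfWeight α (v n j)‖| ≤ C 0 + C 1 + 2 * M := by
        rw [abs_of_nonneg (by positivity)]; linarith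
      exact mul_le_mul e1 e4 (abs_nonneg _) (norm_nonneg _)
    refine squeeze_zero_norm hb ?_
    simpa using (h j).mul_const (C 0 + C 1 + 2 * M)
  have h4 := (((h3 0).add (h3 1)).const_mul (1 / 2)).sub h2
  simp only [add_zero, mul_zero, sub_zero] at h4
  refine h4.congr fun n => ?_
  simp only [energyW, kineticW, Fin.sum_univ_two, potentialW]
  ring

/-- Superposition of two pairs does not increase the sum of the energies, and it decreases it
if they overlap. -/
lemma exists_superpose (H : Admissible N α β μ p r) (a b : Fin 2 → L2 N) :
    ∃ c : Fin 2 → L2 N,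
      (∀ j, ‖ofWeight α (c j)‖ ^ 2 = ‖ofWeight α (a j)‖ ^ 2 + ‖ofWeight α (b j)‖ ^ 2) ∧
      energyW α β μ p r c ≤ energyW α β μ p r a + energyW α β μ p r b ∧
      (∀ j k, ¬ (∀ᵐ x, pairVal α a x j = 0 ∨ pairVal α b x k = 0) →
        energyW α β μ p r c < energyW α β μ p r a + energyW α β μ p r b) := by
  have hα := H.α_pos
  have key : ∀ j, ∃ c : L2 N,
      (∀ᵐ x, ofWeight α c x = (√(‖ofWeight α (a j) x‖ ^ 2 + ‖ofWeight α (b j) x‖ ^ 2) : ℝ)) ∧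
      ‖gradOfWeight α c‖ ^ 2 ≤ ‖gradOfWeight α (a j)‖ ^ 2 + ‖gradOfWeight α (b j)‖ ^ 2 := by
    intro j
    obtain ⟨u, hu1, hu2⟩ := exists_superposition H.dim_pos hα H.α_lt (ofWeight α (a j))
      (ofWeight α (b j))
    rw [← enorm_gradOfWeight_sq hα.le, ← enorm_gradOfWeight_sq hα.le, ← ofReal_norm, ← ofReal_norm,
      ← ENNReal.ofReal_pow (norm_nonneg _), ← ENNReal.ofReal_pow (norm_nonneg _),
      ← ENNReal.ofReal_add (by positivity) (by positivity)] at hu2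
    obtain ⟨c, hc⟩ := (memH_of_kinetic_lt_top hα.le H.α_lt.le
      (hu2.trans_lt ENNReal.ofReal_lt_top)).exists_ofWeight_eq hα.le
    refine ⟨c, by rw [hc]; exact hu1, ?_⟩
    rw [← hc, ← enorm_gradOfWeight_sq hα.le, ← ofReal_norm, ← ENNReal.ofReal_pow (norm_nonneg _),
      ENNReal.ofReal_le_ofReal_iff (by positivity)] at hu2
    exact hu2
  choose c hc1 hc2 using key
  have hval : ∀ᵐ x, pairVal α c x = superpose (pairVal α a x) (pairVal α b x) := by
    filter_upwards [ae_all_iff.2 hc1] with x hx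
    ext j
    exact hx j
  have hp := fun j => (H.p_mem j).1
  have hia := H.integrable_density a
  have hib := H.integrable_density b
  have hic := H.integrable_density c
  have hle : ∀ᵐ x, density β μ p r (pairVal α a x) + density β μ p r (pairVal α b x)
      ≤ density β μ p r (pairVal α c x) := by
    filter_upwards [hval] with x hx
    rw [hx]
    exact density_add_le H.β_pos H.μ_pos hp H.r_gt _ _
  have hkin : kineticW α c ≤ kineticW α a + kineticW α b := by
    simp only [kineticW, ← Finset.sum_add_distrib]
    exact Finset.sum_le_sum fun j _ => hc2 j
  refine ⟨c, fun j => ?_, ?_, fun j k hjk => ?_⟩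
  · have hi : ∀ f : L2 N, Integrable (fun x => ‖f x‖ ^ 2) := fun f =>
      (Lp.memLp f).integrable_norm_pow (by norm_num)
    rw [norm_sq_eq_integral, norm_sq_eq_integral, norm_sq_eq_integral,
      ← integral_add (hi _) (hi _)]
    apply integral_congr_ae
    filter_upwards [hc1 j] with x hx
    rw [hx, Complex.norm_real, Real.norm_of_nonneg (Real.sqrt_nonneg _),
      Real.sq_sqrt (by positivity)]
  · have : potentialW α β μ p r a + potentialW α β μ p r b ≤ potentialW α β μ p r c := by
      simp only [potentialW]
      rw [← integral_add hia hib]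
      exact integral_mono_ae (hia.add hib) hic hle
    simp only [energyW]
    linarith
  · have : potentialW α β μ p r a + potentialW α β μ p r b < potentialW α β μ p r c := by
      simp only [potentialW]
      rw [← integral_add hia hib]
      refine lt_of_le_of_ne (integral_mono_ae (hia.add hib) hic hle) fun heq => hjk ?_
      have h0 := (integral_eq_iff_of_ae_le (hia.add hib) hic hle).1 heq
      filter_upwards [h0, hval] with x hx hv
      by_contra! hne
      have hlt := density_add_lt H.β_pos H.μ_pos hp H.r_gt hne.1 hne.2
      rw [← hv, ← hx] at hlt
      exact lt_irrefl _ hlt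
    simp only [energyW]
    linarith

/-- Energy and masses are translation invariant, so one pair may first be moved until some component
of it overlaps some component of the other. -/
lemma exists_superpose_lt (H : Admissible N α β μ p r) {a b : Fin 2 → L2 N} (ha : a ≠ 0)
    (hb : b ≠ 0) : ∃ c : Fin 2 → L2 N,
      (∀ j, ‖ofWeight α (c j)‖ ^ 2 = ‖ofWeight α (a j)‖ ^ 2 + ‖ofWeight α (b j)‖ ^ 2) ∧
      energyW α β μ p r c < energyW α β μ p r a + energyW α β μ p r b := by
  have hα := H.α_pos.le
  have hinj : ∀ w : L2 N, w ≠ 0 → ofWeight α w ≠ 0 := by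
    intro w hw h0
    have h1 := normH_ofWeight hα w
    have h2 := normH_ofWeight hα (0 : L2 N)
    rw [map_zero] at h2
    rw [h0, h2, enorm_zero] at h1
    exact hw (enorm_eq_zero.1 h1.symm)
  obtain ⟨j, hj⟩ := Function.ne_iff.1 ha
  obtain ⟨k, hk⟩ := Function.ne_iff.1 hb
  obtain ⟨y, hy⟩ := exists_translate_overlap (hinj _ hj) (hinj _ hk)
  obtain ⟨c, hc1, -, hc2⟩ := H.exists_superpose (shift y a) b
  refine ⟨c, fun i => by rw [hc1, norm_ofWeight_shift hα], ?_⟩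
  rw [← energyW_shift hα y a]
  refine hc2 j k fun h => hy ?_
  filter_upwards [h, pairVal_shift hα y a] with x hx hs
  rw [hs] at hx
  exact hx

/-- Each component is a Gaussian of negative energy, or 0 if its mass vanishes. The coupling is
nonnegative and can only lower the energy. -/
lemma exists_energyW_neg (H : Admissible N α β μ p r) {ρ : Fin 2 → ℝ} (hρ : ∀ j, 0 ≤ ρ j)
    (hρ0 : ρ ≠ 0) : ∃ g : Fin 2 → L2 N, (∀ j, ‖ofWeight α (g j)‖ ^ 2 = ρ j) ∧
      energyW α β μ p r g < 0 := by
  have key : ∀ j, ∃ g : L2 N, ‖ofWeight α g‖ ^ 2 = ρ j ∧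
      1 / 2 * ‖gradOfWeight α g‖ ^ 2 - μ j / p j * ∫ x, ‖ofWeight α g x‖ ^ p j ≤ 0 ∧
      (ρ j ≠ 0 →
        1 / 2 * ‖gradOfWeight α g‖ ^ 2 - μ j / p j * ∫ x, ‖ofWeight α g x‖ ^ p j < 0) := by
    intro j
    rcases (hρ j).eq_or_lt with h | h
    · refine ⟨0, by simp [← h], ?_, fun h' => absurd h.symm h'⟩
      have h1 : 0 ≤ ∫ x, ‖ofWeight α (0 : L2 N) x‖ ^ p j := integral_nonneg fun x => by positivity
      have h2 : 0 ≤ μ j / p j := div_nonneg (H.μ_pos j).le (by linarith [(H.p_mem j).1])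
      have := mul_nonneg h2 h1
      simpa using this
    · obtain ⟨g, hg1, hg2⟩ := exists_energy_neg H.dim_pos H.α_pos H.α_lt h (H.μ_pos j)
        (H.p_mem j).1 (H.p_mem j).2
      exact ⟨g, hg1, hg2.le, fun _ => hg2⟩
  choose g hg1 hg2 hg3 using key
  refine ⟨g, hg1, ?_⟩
  have hpow : ∀ j, Integrable (fun x => μ j / p j * ‖ofWeight α (g j) x‖ ^ p j) := fun j => by
    obtain ⟨C, -, hC⟩ := exists_integral_rpow_le H.dim_pos H.α_pos (H.p_mem j).1 (H.p_mem j).2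
      one_pos
    exact ((hC (g j)).1).const_mul _
  have hpot : μ 0 / p 0 * (∫ x, ‖ofWeight α (g 0) x‖ ^ p 0)
      + μ 1 / p 1 * (∫ x, ‖ofWeight α (g 1) x‖ ^ p 1) ≤ potentialW α β μ p r g := by
    rw [← integral_const_mul, ← integral_const_mul, ← integral_add (hpow 0) (hpow 1)]
    refine integral_mono ((hpow 0).add (hpow 1)) (H.integrable_density g) fun x => ?_
    have : 0 ≤ coupling β r (pairVal α g x) := by
      have := H.β_pos
      unfold coupling; positivity
    simp only [density, pairVal] at this ⊢
    linarith
  have hsum : (1 / 2 * ‖gradOfWeight α (g 0)‖ ^ 2 - μ 0 / p 0 * ∫ x, ‖ofWeight α (g 0) x‖ ^ p 0)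
      + (1 / 2 * ‖gradOfWeight α (g 1)‖ ^ 2 - μ 1 / p 1 * ∫ x, ‖ofWeight α (g 1) x‖ ^ p 1) < 0 := by
    obtain ⟨j, hj⟩ := Function.ne_iff.1 hρ0
    fin_cases j
    · have := hg3 0 hj; have := hg2 1; linarith
    · have := hg3 1 hj; have := hg2 0; linarith
  simp only [energyW, kineticW, Fin.sum_univ_two]
  linarith

/-- Lower bound for the energy under an asymptotic mass constraint. -/
lemma le_of_tendsto_energyW (H : Admissible N α β μ p r) {τ : Fin 2 → ℝ} (hτ : ∀ j, 0 < τ j)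
    {m : ℝ} (hm : ∀ w : Fin 2 → L2 N, (∀ j, ‖ofWeight α (w j)‖ ^ 2 = τ j) →
      m ≤ energyW α β μ p r w) {M e : ℝ} {g : ℕ → Fin 2 → L2 N} (hM : ∀ n j, ‖g n j‖ ≤ M)
    (hg : ∀ j, Tendsto (fun n => ‖ofWeight α (g n j)‖ ^ 2) atTop (𝓝 (τ j))) {E : ℕ → ℝ}
    (hE : ∀ n, energyW α β μ p r (g n) ≤ E n) (hEe : Tendsto E atTop (𝓝 e)) : m ≤ e := by
  -- Factors that restore the exact masses. They tend to 1, so the energy changes by o(1); for small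
  -- n a mass may vanish and the factor is a junk value, which is harmless in the limit.
  set t : ℕ → Fin 2 → ℝ := fun n j => √(τ j / ‖ofWeight α (g n j)‖ ^ 2) with ht
  have ht1 : ∀ j, Tendsto (fun n => t n j) atTop (𝓝 1) := by
    intro j
    have h1 : Tendsto (fun n => τ j / ‖ofWeight α (g n j)‖ ^ 2) atTop (𝓝 (τ j / τ j)) :=
      tendsto_const_nhds.div (hg j) (hτ j).ne'
    rw [div_self (hτ j).ne'] at h1
    have h2 := h1.sqrt
    rw [Real.sqrt_one] at h2
    exact h2
  set v : ℕ → Fin 2 → L2 N := fun n j => (t n j : ℂ) • g n j with hv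
  have hdiff : ∀ j, Tendsto (fun n => ‖v n j - g n j‖) atTop (𝓝 0) := by
    intro j
    have h1 : ∀ n, ‖v n j - g n j‖ ≤ |t n j - 1| * M := by
      intro n
      have : v n j - g n j = ((t n j - 1 : ℝ) : ℂ) • g n j := by
        simp only [hv]; push_cast; rw [sub_smul, one_smul]
      rw [this, norm_smul, Complex.norm_real, Real.norm_eq_abs]
      have := hM n j
      gcongr
    refine squeeze_zero (fun n => norm_nonneg _) h1 ?_
    have := (((ht1 j).sub_const 1).abs).mul_const M
    simpa using this
  have hsub := H.tendsto_energyW_sub hM hdiff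
  have hlim := hsub.add hEe
  rw [zero_add] at hlim
  have hpos : ∀ᶠ n in atTop, ∀ j, 0 < ‖ofWeight α (g n j)‖ ^ 2 :=
    eventually_all.2 fun j => (hg j).eventually (lt_mem_nhds (hτ j))
  refine ge_of_tendsto hlim ?_
  filter_upwards [hpos] with n hn
  have h2 := hm (v n) fun j => by
    simp only [hv, map_smul]
    rw [norm_smul, Complex.norm_real, Real.norm_of_nonneg (Real.sqrt_nonneg _), mul_pow,
      Real.sq_sqrt (div_nonneg (hτ j).le (by positivity)), div_mul_cancel₀ _ (hn j).ne']
  linarith [hE n]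

/-- Masses and kinetic energies split by weak convergence in a Hilbert space, the potential energy
by the Brezis–Lieb lemma. -/
lemma split (H : Admissible N α β μ p r) {M : ℝ} {w : ℕ → Fin 2 → L2 N} {w₀ : Fin 2 → L2 N}
    (hM : ∀ n j, ‖w n j‖ ≤ M) (hw : ∀ j, WeakTendsto (fun n => w n j) (w₀ j))
    (hae : ∀ j, ∀ᵐ x, Tendsto (fun n => ofWeight α (w n j) x) atTop (𝓝 (ofWeight α (w₀ j) x))) :
    Tendsto (fun n => energyW α β μ p r (w n) - energyW α β μ p r (w n - w₀)) atTop
      (𝓝 (energyW α β μ p r w₀)) ∧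
    ∀ j, Tendsto (fun n => ‖ofWeight α (w n j)‖ ^ 2 - ‖ofWeight α ((w n - w₀) j)‖ ^ 2) atTop
      (𝓝 (‖ofWeight α (w₀ j)‖ ^ 2)) := by
  have hM' : ∀ n j, ‖w n j - w₀ j‖ ≤ M + (‖w₀ 0‖ + ‖w₀ 1‖) := by
    intro n j
    refine (norm_sub_le _ _).trans (add_le_add (hM n j) ?_)
    fin_cases j <;> simp
  have h1 := H.controlled.brezis_lieb H.dim_pos H.α_pos H.subcritical hM' hae
  have h2 : ∀ j, Tendsto (fun n => ‖gradOfWeight α (w n j)‖ ^ 2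
      - ‖gradOfWeight α ((w n - w₀) j)‖ ^ 2) atTop (𝓝 (‖gradOfWeight α (w₀ j)‖ ^ 2)) := by
    intro j
    have := ((hw j).map (gradOfWeight α)).norm_sq
    simpa only [Pi.sub_apply, map_sub] using this
  constructor
  · have h3 := (((h2 0).add (h2 1)).const_mul (1 / 2)).sub h1
    simp only [energyW, kineticW, Fin.sum_univ_two, potentialW]
    refine h3.congr fun n => ?_
    ring
  · intro j
    have := ((hw j).map (ofWeight α)).norm_sq
    simpa only [Pi.sub_apply, map_sub] using this

lemma exists_shift_of_frequently (H : Admissible N α β μ p r) {M c : ℝ}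
    {w : ℕ → Fin 2 → L2 N} (hM : ∀ n j, ‖w n j‖ ≤ M) (hc : 0 < c)
    (h : ∃ᶠ n in atTop, c ≤ ∫ x, powerSum (exponents p r) (pairVal α (w n) x)) :
    ∃ (φ : ℕ → ℕ) (y : ℕ → Space N) (w₀ : Fin 2 → L2 N), StrictMono φ ∧ w₀ ≠ 0 ∧
      Tendsto (fun n => energyW α β μ p r (w (φ n)) - energyW α β μ p r (shift (y n) (w (φ n)) - w₀))
        atTop (𝓝 (energyW α β μ p r w₀)) ∧
      ∀ j, Tendsto (fun n => ‖ofWeight α (w (φ n) j)‖ ^ 2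
        - ‖ofWeight α ((shift (y n) (w (φ n)) - w₀) j)‖ ^ 2) atTop
        (𝓝 (‖ofWeight α (w₀ j)‖ ^ 2)) := by
  obtain ⟨φ₁, hφ₁, h1⟩ := extraction_of_frequently_atTop h
  obtain ⟨φ₂, y, w₀, hφ₂, hne, hweak, hae⟩ := exists_shift_weakTendsto H.dim_pos H.α_pos
    H.subcritical (fun n => hM (φ₁ n)) hc h1
  obtain ⟨h2, h3⟩ := H.split (M := M) (w := fun n => shift (y n) (w (φ₁ (φ₂ n))))
    (fun n j => by rw [norm_shift]; exact hM _ _) hweak hae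
  refine ⟨φ₁ ∘ φ₂, y, w₀, hφ₁.comp hφ₂, hne, ?_, fun j => ?_⟩
  · simp only [energyW_shift H.α_pos.le] at h2
    exact h2
  · have := h3 j
    simp only [norm_ofWeight_shift H.α_pos.le] at this
    exact this

end Admissible
end
end FractionalNLS

/-! ### Compactness of minimizing sequences. -/

namespace FractionalNLS
noncomputable section
variable {N : ℕ}
namespace Admissible

variable {α β : ℝ} {μ p r : Fin 2 → ℝ}

lemma tendsto_potentialW_zero (H : Admissible N α β μ p r) {w : ℕ → Fin 2 → L2 N}
    (h : Tendsto (fun n => ∫ x, powerSum (exponents p r) (pairVal α (w n) x)) atTop (𝓝 0)) :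
    Tendsto (fun n => potentialW α β μ p r (w n)) atTop (𝓝 0) := by
  obtain ⟨K, -, hK⟩ := H.exists_potentialW_le (N := N)
  refine squeeze_zero (fun n => H.potentialW_nonneg _) (fun n => hK _) ?_
  simpa using h.const_mul K

lemma norm_sub_le_bound {M : ℝ} {w : ℕ → Fin 2 → L2 N} (hM : ∀ n j, ‖w n j‖ ≤ M)
    (y : ℕ → Space N) (w₀ : Fin 2 → L2 N) (φ : ℕ → ℕ) (n : ℕ) (j : Fin 2) :
    ‖(shift (y n) (w (φ n)) - w₀) j‖ ≤ M + (‖w₀ 0‖ + ‖w₀ 1‖) := by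
  refine (norm_sub_le _ _).trans (add_le_add ((norm_shift _ _ _).trans_le (hM _ j)) ?_)
  fin_cases j <;> simp

lemma exists_bound_of_tendsto_sq {τ : Fin 2 → ℝ} {w : ℕ → Fin 2 → L2 N}
    (h : ∀ j, Tendsto (fun n => ‖ofWeight α (w n j)‖ ^ 2) atTop (𝓝 (τ j))) :
    ∃ A : ℝ, 0 ≤ A ∧ ∀ n j, ‖ofWeight α (w n j)‖ ≤ A := by
  choose C hC using fun j => (h j).bddAbove_range
  have hC' : ∀ j n, ‖ofWeight α (w n j)‖ ^ 2 ≤ C j := fun j n => hC j ⟨n, rfl⟩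
  have h0 : ∀ j, 0 ≤ C j := fun j => (sq_nonneg _).trans (hC' j 0)
  refine ⟨√(∑ j, C j), Real.sqrt_nonneg _, fun n j => Real.le_sqrt_of_sq_le ?_⟩
  exact (hC' j n).trans (Finset.single_le_sum (fun i _ => h0 i) (Finset.mem_univ j))

/-- If a minimizing sequence loses mass to infinity, the energy of the lost part together with
that of the limit lies above the minimum; so no mass is lost. -/
lemma remainder_eq_zero (H : Admissible N α β μ p r) {τ : Fin 2 → ℝ} (hτ : ∀ j, 0 < τ j)
    {m : ℝ} (hm : ∀ w : Fin 2 → L2 N, (∀ j, ‖ofWeight α (w j)‖ ^ 2 = τ j) →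
      m ≤ energyW α β μ p r w) {M : ℝ} {u : Fin 2 → L2 N} (hu : u ≠ 0)
    {f : ℕ → Fin 2 → L2 N} (hM : ∀ n j, ‖f n j‖ ≤ M)
    (hE : Tendsto (fun n => energyW α β μ p r (f n)) atTop (𝓝 (m - energyW α β μ p r u)))
    (hf : ∀ j, Tendsto (fun n => ‖ofWeight α (f n j)‖ ^ 2) atTop
      (𝓝 (τ j - ‖ofWeight α (u j)‖ ^ 2))) :
    ∀ j, ‖ofWeight α (u j)‖ ^ 2 = τ j := by
  by_contra hne
  have hα := H.α_pos.le
  set ρ : Fin 2 → ℝ := fun j => τ j - ‖ofWeight α (u j)‖ ^ 2 with hρ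
  have hρ0 : ρ ≠ 0 := fun h0 => hne fun j => by
    have := congrFun h0 j
    simp only [hρ, Pi.zero_apply] at this
    linarith
  have hρnn : ∀ j, 0 ≤ ρ j := fun j => ge_of_tendsto (hf j) (Eventually.of_forall fun n => by positivity)
  by_cases hvan : Tendsto (fun n => ∫ x, powerSum (exponents p r) (pairVal α (f n) x)) atTop (𝓝 0)
  -- Without potential energy the remainder has nonnegative limiting energy, so the energy of u is
  -- at most m. Superposing u with a pair g of negative energy and of the missing mass then gives
  -- admissible masses and an energy below m.
  · have h1 := hE.add (H.tendsto_potentialW_zero hvan)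
    have h2 : 0 ≤ m - energyW α β μ p r u + 0 := ge_of_tendsto h1 (Eventually.of_forall fun n => by
      have := kineticW_nonneg α (f n)
      simp only [energyW]; linarith)
    obtain ⟨g, hg1, hg2⟩ := H.exists_energyW_neg hρnn hρ0
    obtain ⟨c, hc1, hc2, -⟩ := H.exists_superpose u g
    have := hm c fun j => by rw [hc1, hg1]; simp only [hρ]; ring
    linarith
  · obtain ⟨c, hc, hfreq⟩ : ∃ c : ℝ, 0 < c ∧ ∃ᶠ n in atTop,
        c ≤ ∫ x, powerSum (exponents p r) (pairVal α (f n) x) := by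
      by_contra! h
      exact hvan (tendsto_order.2 ⟨fun a ha => Eventually.of_forall fun n =>
        ha.trans_le (integral_nonneg fun x => powerSum_nonneg _ _), fun a ha => h a ha⟩)
    obtain ⟨ψ, z, v, hψ, hv, hEv, hmv⟩ := H.exists_shift_of_frequently hM hc hfreq
    set h : ℕ → Fin 2 → L2 N := fun n => shift (z n) (f (ψ n)) - v with hh
    have hEh : Tendsto (fun n => energyW α β μ p r (h n)) atTop
        (𝓝 (m - energyW α β μ p r u - energyW α β μ p r v)) :=
      ((hE.comp hψ.tendsto_atTop).sub hEv).congr fun n => by simp [hh]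
    have hmh : ∀ j, Tendsto (fun n => ‖ofWeight α (h n j)‖ ^ 2) atTop
        (𝓝 (τ j - ‖ofWeight α (u j)‖ ^ 2 - ‖ofWeight α (v j)‖ ^ 2)) := fun j =>
      (((hf j).comp hψ.tendsto_atTop).sub (hmv j)).congr fun n => by simp [hh]
    -- Merging u and v is a strict gain independent of n. The pairs d n, obtained by superposing c
    -- and h n, have masses tending to τ, and their energies are bounded by a sequence whose limit
    -- is m plus the energy of c minus those of u and v, hence below m.
    obtain ⟨c, hc1, hc2⟩ := H.exists_superpose_lt hu hv
    choose d hd1 hd2 _ using fun n => H.exists_superpose c (h n)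
    have hdm : ∀ j, Tendsto (fun n => ‖ofWeight α (d n j)‖ ^ 2) atTop (𝓝 (τ j)) := by
      intro j
      have := (hmh j).const_add (‖ofWeight α (c j)‖ ^ 2)
      simp only [← hd1] at this
      rwa [hc1, show ‖ofWeight α (u j)‖ ^ 2 + ‖ofWeight α (v j)‖ ^ 2
        + (τ j - ‖ofWeight α (u j)‖ ^ 2 - ‖ofWeight α (v j)‖ ^ 2) = τ j by ring] at this
    have hdE := hEh.const_add (energyW α β μ p r c)
    obtain ⟨A, hA0, hA⟩ := exists_bound_of_tendsto_sq hdm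
    obtain ⟨B, hB⟩ := hdE.bddAbove_range
    obtain ⟨M', hM'⟩ := H.exists_bound (N := N) hA0 B
    have := H.le_of_tendsto_energyW hτ hm
      (fun n => hM' (d n) (hA n) ((hd2 n).trans (hB ⟨n, rfl⟩))) hdm hd2 hdE
    linarith

/-- Minimizing sequences are relatively compact up to translations. -/
lemma exists_shift_tendsto (H : Admissible N α β μ p r) {τ : Fin 2 → ℝ} (hτ : ∀ j, 0 < τ j)
    {m : ℝ} (hm : ∀ w : Fin 2 → L2 N, (∀ j, ‖ofWeight α (w j)‖ ^ 2 = τ j) →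
      m ≤ energyW α β μ p r w) {M : ℝ} {w : ℕ → Fin 2 → L2 N} (hM : ∀ n j, ‖w n j‖ ≤ M)
    (hE : Tendsto (fun n => energyW α β μ p r (w n)) atTop (𝓝 m))
    (hw : ∀ j, Tendsto (fun n => ‖ofWeight α (w n j)‖ ^ 2) atTop (𝓝 (τ j))) :
    ∃ (φ : ℕ → ℕ) (y : ℕ → Space N) (w₀ : Fin 2 → L2 N), StrictMono φ ∧
      (∀ j, ‖ofWeight α (w₀ j)‖ ^ 2 = τ j) ∧ energyW α β μ p r w₀ = m ∧
      ∀ j, Tendsto (fun n => ‖shift (y n) (w (φ n)) j - w₀ j‖) atTop (𝓝 0) := by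
  have hα := H.α_pos.le
  obtain ⟨g, hg1, hg2⟩ := H.exists_energyW_neg (fun j => (hτ j).le)
    (fun h => (hτ 0).ne' (congrFun h 0))
  have hm0 : m < 0 := (hm g hg1).trans_lt hg2
  obtain ⟨K, hK0, hK⟩ := H.exists_potentialW_le (N := N)
  -- Since m < 0, the potential energy is eventually at least -m/2, which rules out vanishing.
  have hfreq : ∃ᶠ n in atTop,
      -m / 2 / K ≤ ∫ x, powerSum (exponents p r) (pairVal α (w n) x) := by
    refine Eventually.frequently ?_
    filter_upwards [hE.eventually (gt_mem_nhds (show m < m / 2 by linarith))] with n hn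
    rw [div_le_iff₀' hK0]
    have h1 := kineticW_nonneg α (w n)
    have h2 := hK (w n)
    simp only [energyW] at hn
    linarith
  obtain ⟨φ, y, u, hφ, hu, hEu, hmu⟩ := H.exists_shift_of_frequently hM
    (div_pos (by linarith) hK0) hfreq
  set f : ℕ → Fin 2 → L2 N := fun n => shift (y n) (w (φ n)) - u with hf
  have hEf : Tendsto (fun n => energyW α β μ p r (f n)) atTop
      (𝓝 (m - energyW α β μ p r u)) :=
    ((hE.comp hφ.tendsto_atTop).sub hEu).congr fun n => by simp [hf]
  have hmf : ∀ j, Tendsto (fun n => ‖ofWeight α (f n j)‖ ^ 2) atTop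
      (𝓝 (τ j - ‖ofWeight α (u j)‖ ^ 2)) := fun j =>
    (((hw j).comp hφ.tendsto_atTop).sub (hmu j)).congr fun n => by simp [hf]
  have hMf : ∀ n j, ‖f n j‖ ≤ M + (‖u 0‖ + ‖u 1‖) := norm_sub_le_bound hM y u φ
  -- Since no mass is lost, the remainder tends to 0 in L² and its potential energy tends to 0. Its
  -- kinetic energy tends to 2(m - E(u)), which is nonnegative as a limit and nonpositive because u
  -- is admissible. Hence u is a minimizer and convergence is strong.
  have hmass := H.remainder_eq_zero hτ hm hu hMf hEf hmf
  have hmf0 : ∀ j, Tendsto (fun n => ‖ofWeight α (f n j)‖ ^ 2) atTop (𝓝 0) := fun j => by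
    have := hmf j
    rwa [hmass, sub_self] at this
  have hpot := H.tendsto_potentialW_zero (tendsto_integral_powerSum H.dim_pos H.α_pos H.subcritical
    hMf fun j => by simpa [Real.sqrt_sq] using (hmf0 j).sqrt)
  have hkin : Tendsto (fun n => kineticW α (f n)) atTop (𝓝 (2 * (m - energyW α β μ p r u))) := by
    have := (hEf.add hpot).const_mul 2
    rw [add_zero] at this
    refine this.congr fun n => ?_
    simp only [energyW]; ring
  have h1 : 0 ≤ 2 * (m - energyW α β μ p r u) :=
    ge_of_tendsto hkin (Eventually.of_forall fun n => kineticW_nonneg _ _)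
  have h2 := hm u hmass
  have hEm : energyW α β μ p r u = m := by linarith
  rw [hEm, sub_self, mul_zero] at hkin
  refine ⟨φ, y, u, hφ, hmass, hEm, fun j => ?_⟩
  have h3 : Tendsto (fun n => ‖f n j‖ ^ 2) atTop (𝓝 0) := by
    have h4 := (hmf0 j).add hkin
    rw [add_zero] at h4
    refine squeeze_zero (fun n => by positivity) (fun n => ?_) h4
    refine (norm_sq_le_add hα H.α_lt.le (f n j)).trans (add_le_add le_rfl ?_)
    exact Finset.single_le_sum (f := fun j => ‖gradOfWeight α (f n j)‖ ^ 2)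
      (fun j _ => by positivity) (Finset.mem_univ j)
  have h5 := h3.sqrt
  rw [Real.sqrt_zero] at h5
  refine h5.congr fun n => ?_
  rw [Real.sqrt_sq (norm_nonneg _)]
  rfl

lemma exists_ofWeight_pair {u : L2Pair N} (hα : 0 ≤ α) (hu : ∀ j, MemH α (u j)) :
    ∃ w : Fin 2 → L2 N, u = fun j => ofWeight α (w j) := by
  choose w hw using fun j => (hu j).exists_ofWeight_eq hα
  exact ⟨w, funext fun j => (hw j).symm⟩

lemma pairNorm_ofWeight_sub (hα : 0 ≤ α) (w v : Fin 2 → L2 N) :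
    pairNorm α ((fun j => ofWeight α (w j)) - fun j => ofWeight α (v j))
      = ENNReal.ofReal √(‖w 0 - v 0‖ ^ 2 + ‖w 1 - v 1‖ ^ 2) := by
  simp only [pairNorm, Pi.sub_apply, ← map_sub, normH_ofWeight hα]
  rw [← ofReal_norm, ← ofReal_norm, ← ENNReal.ofReal_pow (norm_nonneg _),
    ← ENNReal.ofReal_pow (norm_nonneg _), ← ENNReal.ofReal_add (by positivity) (by positivity),
    ENNReal.ofReal_rpow_of_nonneg (by positivity) (by positivity), Real.sqrt_eq_rpow]

lemma mem_constraintSet_ofWeight (hα : 0 ≤ α) {τ : Fin 2 → ℝ} (hτ : ∀ j, 0 < τ j)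
    (w : Fin 2 → L2 N) : (fun j => ofWeight α (w j)) ∈ constraintSet α τ ↔
      ∀ j, ‖ofWeight α (w j)‖ ^ 2 = τ j := by
  refine forall_congr' fun j => ?_
  rw [and_iff_right (memH_ofWeight hα _), eq_comm, Real.sqrt_eq_iff_eq_sq (hτ j).le (norm_nonneg _),
    eq_comm]

lemma mem_minimizers_ofWeight (H : Admissible N α β μ p r) {τ : Fin 2 → ℝ} (hτ : ∀ j, 0 < τ j)
    (w : Fin 2 → L2 N) : (fun j => ofWeight α (w j)) ∈ minimizers α β μ p r τ ↔
      (∀ j, ‖ofWeight α (w j)‖ ^ 2 = τ j) ∧ ∀ v : Fin 2 → L2 N,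
        (∀ j, ‖ofWeight α (v j)‖ ^ 2 = τ j) → energyW α β μ p r w ≤ energyW α β μ p r v := by
  have hα := H.α_pos.le
  refine and_congr (mem_constraintSet_ofWeight hα hτ w) ⟨fun h v hv => ?_, fun h v hv => ?_⟩
  · have := h _ ((mem_constraintSet_ofWeight hα hτ v).2 hv)
    rwa [H.energy_ofWeight, H.energy_ofWeight] at this
  · obtain ⟨v, rfl⟩ := exists_ofWeight_pair hα fun j => (hv j).1
    rw [H.energy_ofWeight, H.energy_ofWeight]
    exact h v ((mem_constraintSet_ofWeight hα hτ v).1 hv)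

lemma exists_mem_minimizers_lt (H : Admissible N α β μ p r) {τ : Fin 2 → ℝ}
    {u : Fin 2 → L2 N} {δ : ℝ}
    (h : pairDist α (fun j => ofWeight α (u j)) (minimizers α β μ p r τ) < ENNReal.ofReal δ) :
    ∃ x : Fin 2 → L2 N, (fun j => ofWeight α (x j)) ∈ minimizers α β μ p r τ ∧
      ∀ j, ‖u j - x j‖ < δ := by
  have hα := H.α_pos.le
  simp only [pairDist, iInf_lt_iff] at h
  obtain ⟨v, hv, hlt⟩ := h
  obtain ⟨x, rfl⟩ := exists_ofWeight_pair hα fun j => (hv.1 j).1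
  refine ⟨x, hv, fun j => ?_⟩
  rw [pairNorm_ofWeight_sub hα, ENNReal.ofReal_lt_ofReal_iff_of_nonneg (Real.sqrt_nonneg _)] at hlt
  refine lt_of_le_of_lt (Real.le_sqrt_of_sq_le ?_) hlt
  fin_cases j
  · exact le_add_of_nonneg_right (sq_nonneg _)
  · exact le_add_of_nonneg_left (sq_nonneg _)

/-- Pairs whose energy and masses are almost those of a minimizer are close to a minimizer. -/
lemma exists_pairDist_lt (H : Admissible N α β μ p r) {τ : Fin 2 → ℝ} (hτ : ∀ j, 0 < τ j)
    {m : ℝ} (hm : ∀ w : Fin 2 → L2 N, (∀ j, ‖ofWeight α (w j)‖ ^ 2 = τ j) →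
      m ≤ energyW α β μ p r w) {w : ℕ → Fin 2 → L2 N}
    (hE : Tendsto (fun n => energyW α β μ p r (w n)) atTop (𝓝 m))
    (hw : ∀ j, Tendsto (fun n => ‖ofWeight α (w n j)‖ ^ 2) atTop (𝓝 (τ j))) {ε : ℝ} (hε : 0 < ε) :
    ∃ n, pairDist α (fun j => ofWeight α (w n j)) (minimizers α β μ p r τ) < ENNReal.ofReal ε := by
  have hα := H.α_pos.le
  obtain ⟨A, hA0, hA⟩ := exists_bound_of_tendsto_sq hw
  obtain ⟨B, hB⟩ := hE.bddAbove_range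
  obtain ⟨M, hM⟩ := H.exists_bound (N := N) hA0 B
  obtain ⟨φ, y, w₀, -, hw₀, hEw₀, hlim⟩ := H.exists_shift_tendsto hτ hm
    (fun n => hM (w n) (hA n) (hB ⟨n, rfl⟩)) hE hw
  have h1 := (((hlim 0).pow 2).add ((hlim 1).pow 2)).sqrt
  norm_num at h1
  obtain ⟨n, hn⟩ := (h1.eventually (gt_mem_nhds hε)).exists
  refine ⟨φ n, ?_⟩
  -- The set of minimizers is translation invariant, so the limit is moved back instead of the
  -- sequence.
  have hv : (fun j => ofWeight α (shift (-y n) w₀ j)) ∈ minimizers α β μ p r τ := by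
    refine (H.mem_minimizers_ofWeight hτ _).2 ⟨fun j => by rw [norm_ofWeight_shift hα, hw₀],
      fun v hv => ?_⟩
    rw [energyW_shift hα, hEw₀]
    exact hm v hv
  refine (iInf₂_le _ hv).trans_lt ?_
  have h2 : ∀ j, ‖w (φ n) j - shift (-y n) w₀ j‖ = ‖shift (y n) (w (φ n)) j - w₀ j‖ := fun j => by
    have := norm_shift (-y n) (shift (y n) (w (φ n)) - w₀) j
    rwa [shift_sub, shift_neg_shift] at this
  rw [pairNorm_ofWeight_sub hα, h2, h2, ENNReal.ofReal_lt_ofReal_iff hε]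
  exact hn

end Admissible
end
end FractionalNLS

/-! ### Stability by contradiction. -/

theorem mainTheorem2 (N : ℕ) (hN : 2 ≤ N) (α : ℝ) (hα0 : 0 < α) (hα1 : α < 1)
    (β : ℝ) (hβ : 0 < β) (μ p r : Fin 2 → ℝ) (hμ : ∀ j, 0 < μ j)
    (hp : ∀ j, 2 < p j ∧ p j < 2 + 4 * α / (N : ℝ))
    (hr : ∀ j, 1 < r j) (hr' : r 0 + r 1 < 2 + 4 * α / (N : ℝ))
    (τ : Fin 2 → ℝ) (hτ : ∀ j, 0 < τ j) :
    ∀ ε : ℝ, 0 < ε → ∃ δ : ℝ, 0 < δ ∧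
      ∀ Ψ₀ : FractionalNLS.L2Pair N, (∀ j, FractionalNLS.MemH α (Ψ₀ j)) →
        FractionalNLS.pairDist α Ψ₀ (FractionalNLS.minimizers α β μ p r τ) < ENNReal.ofReal δ →
        ∀ Ψ : ℝ → FractionalNLS.L2Pair N,
          FractionalNLS.IsSolution α β μ p r Ψ →
          FractionalNLS.ConservesEnergyAndMass α β μ p r Ψ →
          Ψ 0 = Ψ₀ →
          (⨆ t ∈ Set.Ici (0 : ℝ),
            FractionalNLS.pairDist α (Ψ t) (FractionalNLS.minimizers α β μ p r τ))
              < ENNReal.ofReal ε := by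
  have H : FractionalNLS.Admissible N α β μ p r := ⟨by omega, hα0, hα1, hβ, hμ, hp, hr, hr'⟩
  intro ε hε
  by_contra! hcon
  have key : ∀ n : ℕ, ∃ w z x : FractionalNLS.L2Pair N,
      ENNReal.ofReal (ε / 2) <
        FractionalNLS.pairDist α (fun j => FractionalNLS.ofWeight α (w j))
          (FractionalNLS.minimizers α β μ p r τ) ∧
      (fun j => FractionalNLS.ofWeight α (x j)) ∈ FractionalNLS.minimizers α β μ p r τ ∧
      (∀ j, ‖z j - x j‖ < 1 / ((n : ℝ) + 1)) ∧
      FractionalNLS.energyW α β μ p r w = FractionalNLS.energyW α β μ p r z ∧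
      ∀ j, ‖FractionalNLS.ofWeight α (w j)‖ ^ 2 = ‖FractionalNLS.ofWeight α (z j)‖ ^ 2 := by
    intro n
    obtain ⟨Ψ₀, hΨ₀, hd, Ψ, hsol, hcons, rfl, hsup⟩ := hcon (1 / ((n : ℝ) + 1)) (by positivity)
    -- The supremum over times need not be attained; with ε/2 in place of ε some time t exceeds the
    -- bound strictly.
    have hlt := ((ENNReal.ofReal_lt_ofReal_iff hε).2 (half_lt_self hε)).trans_le hsup
    simp only [lt_iSup_iff] at hlt
    obtain ⟨t, ht, hlt⟩ := hlt
    obtain ⟨z, hz⟩ := FractionalNLS.Admissible.exists_ofWeight_pair hα0.le hΨ₀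
    obtain ⟨w, hw⟩ := FractionalNLS.Admissible.exists_ofWeight_pair hα0.le (hsol.memH t ht)
    rw [hz] at hd
    rw [hw] at hlt
    obtain ⟨x, hx, hzx⟩ := H.exists_mem_minimizers_lt hd
    obtain ⟨hE, hM⟩ := hcons t ht
    rw [hz, hw] at hE hM
    refine ⟨w, z, x, hlt, hx, hzx, ?_, fun j => ?_⟩
    · rwa [H.energy_ofWeight, H.energy_ofWeight] at hE
    · rw [FractionalNLS.norm_sq_eq_integral, FractionalNLS.norm_sq_eq_integral]
      exact hM j
  choose w z x hfar hx hzx hE hM using key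
  have hx' := fun n => (H.mem_minimizers_ofWeight hτ (x n)).1 (hx n)
  -- All x n are minimizers and share this energy. The data z n approach them, so energies and
  -- masses of z n converge, and conservation transfers both limits to w n, the pair at the later
  -- time.
  set m := FractionalNLS.energyW α β μ p r (x 0) with hm
  have hxm : ∀ n, FractionalNLS.energyW α β μ p r (x n) = m := fun n =>
    le_antisymm ((hx' n).2 _ (hx' 0).1) ((hx' 0).2 _ (hx' n).1)
  have hlim : ∀ j, Tendsto (fun n => ‖z n j - x n j‖) atTop (𝓝 0) := fun j =>
    squeeze_zero (fun n => norm_nonneg _) (fun n => (hzx n j).le)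
      tendsto_one_div_add_atTop_nhds_zero_nat
  obtain ⟨A, hA0, hA⟩ := FractionalNLS.Admissible.exists_bound_of_tendsto_sq (α := α) (w := x)
    (τ := τ) fun j => tendsto_const_nhds.congr fun n => ((hx' n).1 j).symm
  obtain ⟨B, hB⟩ := H.exists_bound hA0 m
  have hEz := (H.tendsto_energyW_sub (fun n => hB (x n) (hA n) (hxm n).le) hlim).add_const m
  have hEw : Tendsto (fun n => FractionalNLS.energyW α β μ p r (w n)) atTop (𝓝 m) := by
    rw [zero_add] at hEz
    refine hEz.congr fun n => ?_
    rw [hxm, hE]; ring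
  have hMw : ∀ j, Tendsto (fun n => ‖FractionalNLS.ofWeight α (w n j)‖ ^ 2) atTop
      (𝓝 (τ j)) := by
    intro j
    have h1 : Tendsto (fun n => ‖FractionalNLS.ofWeight α (z n j)‖) atTop (𝓝 √(τ j)) := by
      rw [tendsto_iff_norm_sub_tendsto_zero]
      refine squeeze_zero (fun n => norm_nonneg _) (fun n => ?_) (hlim j)
      rw [← (hx' n).1 j, Real.sqrt_sq (norm_nonneg _)]
      refine (abs_norm_sub_norm_le _ _).trans ?_
      rw [← map_sub]
      exact FractionalNLS.norm_ofWeight_le hα0.le _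
    have h2 := h1.pow 2
    rw [Real.sq_sqrt (hτ j).le] at h2
    exact h2.congr fun n => (hM n j).symm
  obtain ⟨n, hn⟩ := H.exists_pairDist_lt hτ (hx' 0).2 hEw hMw (half_pos hε)
  exact lt_asymm hn (hfar n)
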